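/- Let $m>0$, $0<\alpha<1$. For $\beta\in\mathbb{R}$ and $\varphi\in H^{1/2}(\mathbb{R}^3)$ (complex-valued) put $$\mathcal{E}_\beta(\varphi)=\frac12\langle\varphi,\sqrt{-\Delta+m^2}\,\varphi\rangle+\frac14\int_{\mathbb{R}^3}\int_{\mathbb{R}^3}\Big(\frac{\beta}{|x-y|^{\alpha}}-\frac{1}{|x-y|}\Big)|\varphi(x)|^2|\varphi(y)|^2\,dx\,dy,$$ where $\langle\cdot,\cdot\rangle$ is the $L^2$ product and $\sqrt{-\Delta+m^2}$ is understood through the Fourier transform as a quadratic form, and for $N>0$ let $$E(\beta,N)=\inf\Big\{\mathcal{E}_\beta(\varphi):\ \varphi\in H^{1/2}(\mathbb{R}^3),\ \int_{\mathbb{R}^3}|\varphi|^2\,dx=N\Big\}\in[-\infty,\infty).$$ A minimizer for $E(\beta,N)$ is a $\varphi\in H^{1/2}(\mathbb{R}^3)$ with $\int_{\mathbb{R}^3}|\varphi|^2\,dx=N$ and $\mathcal{E}_\beta(\varphi)=E(\beta,N)$. Let the critical mass $N_c$ be defined by $$\frac{N_c}{2}=\inf_{\psi\in H^{1/2}(\mathbb{R}^3),\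 \psi\not\equiv0}\frac{\langle\psi,\sqrt{-\Delta}\,\psi\rangle\,\langle\psi,\psi\rangle}{\int_{\mathbb{R}^3}\big(\frac{1}{|x|}\ast|\psi|^2\big)|\psi|^2\,dx}.$$ Then: (i) If $0<N<N_c$ and $\beta\le0$, there exists at least one minimizer for $E(\beta,N)$. (ii) There exist $\beta_0>0$ and $\delta>0$ (depending only on $m$ and $\alpha$) such that, whenever $0<\beta<\beta_0$, $0<N<N_c$ and $N>N_c-\delta$, there exists at least one minimizer for $E(\beta,N)$. (iii) If $N>N_c$, then for every $\beta\in\mathbb{R}$ we have $E(\beta,N)=-\infty$, and there is no minimizer for $E(\beta,N)$. -/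

import Mathlib

noncomputable section

namespace BosonStar

open MeasureTheory
open scoped FourierTransform SchwartzMap

/-- Three-dimensional Euclidean space. -/
abbrev R3 : Type := EuclideanSpace ℝ (Fin 3)

/-- The complex Hilbert space `L²(ℝ³; ℂ)`. -/
abbrev L2 : Type := Lp ℂ 2 (volume : Measure R3)

/-- `φ ∈ H^{1/2}(ℝ³)`: the Bessel potential of order `1/2` of `φ` lies in `L²`. -/
def MemHHalf (φ : L2) : Prop :=
  TemperedDistribution.MemSobolev (1 / 2 : ℝ) 2 (φ : 𝓢'(R3, ℂ))

/-- The mass `⟨φ, φ⟩ = ∫ |φ|² dx`. -/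
def mass (φ : L2) : ℝ :=
  ∫ x : R3, ‖φ x‖ ^ 2

/-- The quadratic form `⟨φ, √(-Δ + m²) φ⟩`. In the normalisation
`𝓕 φ (ξ) = ∫ exp(-2πi x·ξ) φ(x) dx` of the Fourier transform, the operator `√(-Δ + m²)` is
multiplication by `√((2π|ξ|)² + m²)` on the Fourier side. For `m = 0` this is `⟨φ, √(-Δ) φ⟩`. -/
def kinetic (m : ℝ) (φ : L2) : ℝ :=
  ∫ ξ : R3, Real.sqrt ((2 * Real.pi * ‖ξ‖) ^ 2 + m ^ 2) * ‖(𝓕 φ : L2) ξ‖ ^ 2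

/-- The interaction energy
`I(φ) = (1/4) ∬ (β / |x - y|^α - 1 / |x - y|) |φ(x)|² |φ(y)|² dx dy`. -/
def interaction (α β : ℝ) (φ : L2) : ℝ :=
  (1 / 4) * ∫ x : R3, ∫ y : R3,
    (β / ‖x - y‖ ^ α - 1 / ‖x - y‖) * ‖φ x‖ ^ 2 * ‖φ y‖ ^ 2

/-- The energy functional `𝓔_β(φ) = (1/2) ⟨φ, √(-Δ + m²) φ⟩ + I(φ)`. -/
def energy (m α β : ℝ) (φ : L2) : ℝ :=
  (1 / 2) * kinetic m φ + interaction α β φ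

/-- `E(β, N) = inf {𝓔_β(φ) : φ ∈ H^{1/2}(ℝ³), ∫ |φ|² = N}`, as an extended real number. -/
def groundEnergy (m α β N : ℝ) : EReal :=
  ⨅ φ : {φ : L2 // MemHHalf φ ∧ mass φ = N}, (energy m α β φ.1 : EReal)

/-- `φ` is a minimizer (ground state) for `E(β, N)`. -/
def IsMinimizer (m α β N : ℝ) (φ : L2) : Prop :=
  MemHHalf φ ∧ mass φ = N ∧ (energy m α β φ : EReal) = groundEnergy m α β N

/-- `∫ (|x|⁻¹ ∗ |ψ|²) |ψ|² dx`. -/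
def newtonEnergy (ψ : L2) : ℝ :=
  ∫ x : R3, (∫ y : R3, 1 / ‖x - y‖ * ‖ψ y‖ ^ 2) * ‖ψ x‖ ^ 2

/-- The critical mass: `N_c / 2` is the infimum of
`⟨ψ, √(-Δ) ψ⟩ ⟨ψ, ψ⟩ / ∫ (|x|⁻¹ ∗ |ψ|²) |ψ|² dx` over all nonzero `ψ ∈ H^{1/2}(ℝ³)`. -/
def criticalMass : ℝ :=
  2 * ⨅ ψ : {ψ : L2 // MemHHalf ψ ∧ ψ ≠ 0}, kinetic 0 ψ.1 * mass ψ.1 / newtonEnergy ψ.1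

end BosonStar

end

/-!
Kato's inequality bounds the Newtonian energy `∬ |φ(x)|² |φ(y)|² / |x - y|` by mass times kinetic
energy, and `criticalMass` is the sharp threshold of the resulting competition. Both terms scale
like `t` under the mass-preserving dilation by `t`, while the `|x|^(-α)` term scales like `t ^ α`
with `α < 1`; hence the energy is unbounded below above the critical mass and coercive below it.

Below the critical mass, a minimizing sequence cannot vanish as soon as `E(β, N) < m N / 2`, so
after translations it has a nonzero weak limit. Kinetic and Riesz energies split asymptotically into
the contributions of the weak limit and of the remainder, and the strict inequality
`E(β, N) < E(β, l) + E(β, N - l)` forces the limit to carry all the mass. Since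
`𝓔(c φ) = c⁴ 𝓔(φ) - c² (c² - 1) ⟨φ, √(-Δ + m²) φ⟩ / 2`, this strict inequality follows, when
`β ≤ 0`, from `E(β, l) < m l / 2` for all `l ≤ N`. When `β > 0` it follows from the stronger
`E(β, N) < m N / 6`, which holds for small `β` and `N` close to `N_c`: near-optimizers of the
quotient defining `N_c` have little mass at low frequencies, so suitable dilations of them have
arbitrarily small energy.
-/

noncomputable section

namespace BosonStar

open MeasureTheory Filter Topology Metric
open Module (finrank)
open scoped FourierTransform SchwartzMap ENNReal NNReal RealInnerProductSpace

section Density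

variable {X F : Type*} [MeasurableSpace X] {μ : Measure X} [NormedAddCommGroup F]

/-- The density `|f|²` of an `L²` function, with values in `[0, ∞]`. -/
def density (f : Lp F 2 μ) (x : X) : ℝ≥0∞ := ‖f x‖ₑ ^ 2

lemma measurable_density (f : Lp F 2 μ) : Measurable (density f) :=
  (Lp.stronglyMeasurable f).enorm.pow_const 2

lemma ofReal_norm_sq (f : Lp F 2 μ) (x : X) : ENNReal.ofReal (‖f x‖ ^ 2) = density f x := by
  rw [ENNReal.ofReal_pow (norm_nonneg _), ofReal_norm, density]

lemma toReal_density (f : Lp F 2 μ) (x : X) : (density f x).toReal = ‖f x‖ ^ 2 := by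
  rw [← ofReal_norm_sq, ENNReal.toReal_ofReal (by positivity)]

lemma lintegral_density_eq_enorm_sq (f : Lp F 2 μ) : ∫⁻ x, density f x ∂μ = ‖f‖ₑ ^ 2 := by
  have h := eLpNorm_nnreal_pow_eq_lintegral (μ := μ) (f := f) (p := 2) two_ne_zero
  simp only [NNReal.coe_ofNat, ENNReal.rpow_ofNat, ENNReal.coe_ofNat] at h
  exact h.symm.trans (by rw [Lp.enorm_def])

lemma lintegral_density (f : Lp F 2 μ) : ∫⁻ x, density f x ∂μ = ENNReal.ofReal (‖f‖ ^ 2) := by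
  rw [lintegral_density_eq_enorm_sq, ENNReal.ofReal_pow (norm_nonneg _), ofReal_norm]

lemma lintegral_density_ne_top (f : Lp F 2 μ) : ∫⁻ x, density f x ∂μ ≠ ⊤ := by
  rw [lintegral_density]
  exact ENNReal.ofReal_ne_top

lemma toReal_lintegral_density (f : Lp F 2 μ) : (∫⁻ x, density f x ∂μ).toReal = ‖f‖ ^ 2 := by
  rw [lintegral_density, ENNReal.toReal_ofReal (by positivity)]

lemma integral_norm_sq (f : Lp F 2 μ) : ∫ x, ‖f x‖ ^ 2 ∂μ = ‖f‖ ^ 2 := by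
  simp_rw [← toReal_density]
  rw [integral_toReal (measurable_density f).aemeasurable (ae_of_all _ fun x => by simp [density]),
    toReal_lintegral_density]

lemma integrable_norm_sq (f : Lp F 2 μ) : Integrable (fun x => ‖f x‖ ^ 2) μ :=
  (Lp.memLp f).integrable_norm_pow two_ne_zero

lemma memLp_two_of_lintegral_enorm_sq_lt_top {g : X → F} (hg : AEStronglyMeasurable g μ)
    (h : ∫⁻ x, ‖g x‖ₑ ^ 2 ∂μ < ⊤) : MemLp g 2 μ := by
  refine ⟨hg, ?_⟩
  rw [eLpNorm_lt_top_iff_lintegral_rpow_enorm_lt_top two_ne_zero ENNReal.ofNat_ne_top]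
  simpa using h

lemma density_add_le (f g : Lp F 2 μ) {κ : ℝ} (hκ : 0 < κ) :
    ∀ᵐ x ∂μ, density (f + g) x
      ≤ ENNReal.ofReal (1 + κ) * density f x + ENNReal.ofReal (1 + 1 / κ) * density g x := by
  filter_upwards [Lp.coeFn_add f g] with x hx
  rw [← ofReal_norm_sq, ← ofReal_norm_sq, ← ofReal_norm_sq, hx, Pi.add_apply,
    ← ENNReal.ofReal_mul (by positivity), ← ENNReal.ofReal_mul (by positivity),
    ← ENNReal.ofReal_add (by positivity) (by positivity)]
  apply ENNReal.ofReal_le_ofReal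
  have young : 2 * (‖f x‖ * ‖g x‖) ≤ κ * ‖f x‖ ^ 2 + 1 / κ * ‖g x‖ ^ 2 := by
    have h : κ * ‖f x‖ ^ 2 + 1 / κ * ‖g x‖ ^ 2 - 2 * (‖f x‖ * ‖g x‖)
        = (κ * ‖f x‖ - ‖g x‖) ^ 2 / κ := by field_simp; ring
    linarith [show 0 ≤ (κ * ‖f x‖ - ‖g x‖) ^ 2 / κ by positivity]
  calc ‖f x + g x‖ ^ 2 ≤ (‖f x‖ + ‖g x‖) ^ 2 := by gcongr; exact norm_add_le _ _
    _ ≤ (1 + κ) * ‖f x‖ ^ 2 + (1 + 1 / κ) * ‖g x‖ ^ 2 := by linarith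

lemma setLIntegral_density_add_le (f g : Lp F 2 μ) (S : Set X) :
    ∫⁻ x in S, density (f + g) x ∂μ
      ≤ 2 * (∫⁻ x in S, density f x ∂μ) + 2 * ∫⁻ x in S, density g x ∂μ := by
  have h := density_add_le f g one_pos
  norm_num only [ENNReal.ofReal_ofNat] at h
  refine (lintegral_mono_ae (ae_restrict_of_ae h)).trans_eq ?_
  rw [lintegral_add_left ((measurable_density f).const_mul 2),
    lintegral_const_mul 2 (measurable_density f), lintegral_const_mul 2 (measurable_density g)]

lemma density_eq_indicator_of_ae_eq {f g : Lp F 2 μ} {S : Set X}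
    (h : f =ᵐ[μ] S.indicator g) : density f =ᵐ[μ] S.indicator (density g) := by
  filter_upwards [h] with x hx
  by_cases hS : x ∈ S <;> simp [density, hx, hS]

end Density

lemma lintegral_mul_sq_le {X : Type*} [MeasurableSpace X] {μ : Measure X} {f g : X → ℝ≥0∞}
    (hf : AEMeasurable f μ) (hg : AEMeasurable g μ) :
    (∫⁻ a, f a * g a ∂μ) ^ 2 ≤ (∫⁻ a, f a ^ 2 ∂μ) * ∫⁻ a, g a ^ 2 ∂μ := by
  have hölder := ENNReal.lintegral_mul_le_Lp_mul_Lq μ Real.HolderConjugate.two_two hf hg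
  simp only [Pi.mul_apply, ENNReal.rpow_two] at hölder
  calc (∫⁻ a, f a * g a ∂μ) ^ 2
      ≤ ((∫⁻ a, f a ^ 2 ∂μ) ^ (1 / 2 : ℝ) * (∫⁻ a, g a ^ 2 ∂μ) ^ (1 / 2 : ℝ)) ^ 2 := by gcongr
    _ = (∫⁻ a, f a ^ 2 ∂μ) * ∫⁻ a, g a ^ 2 ∂μ := by
      rw [mul_pow, ← ENNReal.rpow_natCast, ← ENNReal.rpow_natCast, ← ENNReal.rpow_mul,
        ← ENNReal.rpow_mul]
      norm_num

lemma locallyIntegrable_L2 {X F : Type*} [TopologicalSpace X] [MeasurableSpace X] {μ : Measure X}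
    [IsLocallyFiniteMeasure μ] [NormedAddCommGroup F] (f : Lp F 2 μ) : LocallyIntegrable f μ :=
  (Lp.memLp f).locallyIntegrable one_le_two

section Fourier

variable {E F : Type*} [NormedAddCommGroup E] [InnerProductSpace ℝ E] [FiniteDimensional ℝ E]
  [MeasurableSpace E] [BorelSpace E] [NormedAddCommGroup F] [InnerProductSpace ℂ F]
  [CompleteSpace F]

lemma lintegral_density_fourier (f : Lp F 2 (volume : Measure E)) :
    ∫⁻ ξ, density (𝓕 f) ξ = ∫⁻ x, density f x := by
  rw [lintegral_density, lintegral_density, Lp.norm_fourier_eq]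

lemma integral_smul_fourier (f : Lp F 2 (volume : Measure E)) (h : 𝓢(E, ℂ)) :
    ∫ x, h x • 𝓕 f x = ∫ x, (𝓕 h) x • f x := by
  have := congrArg (fun u : 𝓢'(E, F) => u h) (Lp.fourier_toTemperedDistribution_eq f)
  simpa [Lp.toTemperedDistribution_apply] using this.symm

lemma integral_smul_fourierInv (f : Lp F 2 (volume : Measure E)) (h : 𝓢(E, ℂ)) :
    ∫ x, h x • 𝓕⁻ f x = ∫ x, (𝓕⁻ h) x • f x := by
  have := congrArg (fun u : 𝓢'(E, F) => u h) (Lp.fourierInv_toTemperedDistribution_eq f)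
  simpa [Lp.toTemperedDistribution_apply] using this.symm

lemma ae_eq_of_forall_integral_schwartz_smul_eq {u v : E → F}
    (hu : LocallyIntegrable u volume) (hv : LocallyIntegrable v volume)
    (huv : ∀ h : 𝓢(E, ℂ), ∫ x, h x • u x = ∫ x, h x • v x) : u =ᵐ[volume] v := by
  apply ae_eq_of_integral_contDiff_smul_eq hu hv
  intro g g_smooth g_cpt
  have hg₁ : HasCompactSupport (Complex.ofRealCLM ∘ g) := g_cpt.comp_left rfl
  have hg₂ : ContDiff ℝ (⊤ : ℕ∞) (Complex.ofRealCLM ∘ g) := by fun_prop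
  simpa using huv (hg₁.toSchwartzMap hg₂)

lemma fourierInv_ae_eq_integral {g : Lp F 2 (volume : Measure E)} (hg : Integrable g volume) :
    ⇑(𝓕⁻ g : Lp F 2 (volume : Measure E)) =ᵐ[volume] 𝓕⁻ (g : E → F) := by
  have hc : Continuous (𝓕⁻ (g : E → F)) := by
    rw [Real.fourierInv_eq_fourier_comp_neg]
    exact VectorFourier.fourierIntegral_continuous Real.continuous_fourierChar
      continuous_inner hg.comp_neg
  refine ae_eq_of_forall_integral_schwartz_smul_eq (locallyIntegrable_L2 _)
    hc.locallyIntegrable fun h => ?_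
  rw [integral_smul_fourierInv]
  have h_schwartz (x : E) : (𝓕⁻ h) x
      = VectorFourier.fourierIntegral Real.fourierChar volume (-innerₗ E) h x := by
    rw [SchwartzMap.fourierInv_coe, Real.fourierInv_eq]
    simp [VectorFourier.fourierIntegral]
  have h_flip (x : E) : 𝓕⁻ (g : E → F) x
      = VectorFourier.fourierIntegral Real.fourierChar volume (-innerₗ E).flip g x := by
    rw [Real.fourierInv_eq]
    simp [VectorFourier.fourierIntegral, real_inner_comm]
  simp_rw [h_schwartz, h_flip]
  exact VectorFourier.integral_fourierIntegral_smul_eq_flip (L := -innerₗ E)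
    Real.continuous_fourierChar
    (by simp only [LinearMap.neg_apply]; exact continuous_inner.neg) h.integrable hg

lemma memSobolev_two_iff_memLp_fourier (s : ℝ) (f : Lp F 2 (volume : Measure E)) :
    TemperedDistribution.MemSobolev s 2 (f : 𝓢'(E, F)) ↔
      MemLp (fun ξ => (1 + ‖ξ‖ ^ 2) ^ (s / 2) • 𝓕 f ξ) 2 (volume : Measure E) := by
  rw [TemperedDistribution.memSobolev_iff_exists_smulLeftCLM_fourier,
    Lp.fourier_toTemperedDistribution_eq]
  set w : E → ℂ := fun ξ => (((1 + ‖ξ‖ ^ 2) ^ (s / 2) : ℝ) : ℂ) with w_def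
  have hw : w.HasTemperateGrowth := by rw [w_def]; fun_prop
  have smul_eq (ξ : E) : (1 + ‖ξ‖ ^ 2) ^ (s / 2) • 𝓕 f ξ = w ξ • 𝓕 f ξ :=
    (Complex.coe_smul _ _).symm
  simp_rw [smul_eq]
  have apply_eq (h : 𝓢(E, ℂ)) : TemperedDistribution.smulLeftCLM F w (𝓕 f : Lp F 2 _) h
      = ∫ ξ, h ξ • w ξ • 𝓕 f ξ := by
    simp only [TemperedDistribution.smulLeftCLM_apply_apply, Lp.toTemperedDistribution_apply,
      SchwartzMap.smulLeftCLM_apply_apply hw, smul_smul, smul_eq_mul, mul_comm]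
  constructor
  · rintro ⟨g, hg⟩
    refine (memLp_congr_ae (ae_eq_of_forall_integral_schwartz_smul_eq
      ((locallyIntegrable_L2 _).continuous_smul hw.1.continuous) (locallyIntegrable_L2 g)
      fun h => ?_)).2 (Lp.memLp g)
    rw [← apply_eq, hg, Lp.toTemperedDistribution_apply]
  · intro hm
    refine ⟨hm.toLp, ?_⟩
    ext h
    rw [apply_eq, Lp.toTemperedDistribution_apply]
    refine integral_congr_ae ?_
    filter_upwards [hm.coeFn_toLp] with ξ hξ
    rw [hξ]

/-- The squared homogeneous `H^{1/2}` seminorm `∫ |ξ| |𝓕 f(ξ)|² dξ`, with values in `[0, ∞]`. It is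
`⟨f, √(-Δ) f⟩ / 2π`. -/
def ekinetic (f : Lp F 2 (volume : Measure E)) : ℝ≥0∞ := ∫⁻ ξ, ‖ξ‖ₑ * density (𝓕 f) ξ

lemma memSobolev_half_iff_ekinetic_lt_top (f : Lp F 2 (volume : Measure E)) :
    TemperedDistribution.MemSobolev (1 / 2 : ℝ) 2 (f : 𝓢'(E, F)) ↔ ekinetic f < ⊤ := by
  rw [memSobolev_two_iff_memLp_fourier]
  have weight_sq (ξ : E) : ‖(1 + ‖ξ‖ ^ 2) ^ ((1 / 2 : ℝ) / 2) • 𝓕 f ξ‖ₑ ^ 2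
      = ENNReal.ofReal (√(1 + ‖ξ‖ ^ 2)) * density (𝓕 f) ξ := by
    rw [enorm_smul, mul_pow, ← density, Real.enorm_of_nonneg (by positivity),
      ← ENNReal.ofReal_pow (by positivity), ← Real.rpow_natCast, ← Real.rpow_mul (by positivity),
      Real.sqrt_eq_rpow]
    norm_num
  constructor
  · intro hm
    have weighted_lt_top : ∫⁻ ξ, ENNReal.ofReal (√(1 + ‖ξ‖ ^ 2)) * density (𝓕 f) ξ < ⊤ := by
      have h := (eLpNorm_lt_top_iff_lintegral_rpow_enorm_lt_top two_ne_zero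
        ENNReal.ofNat_ne_top).1 hm.2
      simpa only [ENNReal.toReal_ofNat, ENNReal.rpow_ofNat, weight_sq] using h
    refine lt_of_le_of_lt (lintegral_mono fun ξ => ?_) weighted_lt_top
    rw [← ofReal_norm]
    gcongr
    exact Real.le_sqrt_of_sq_le (by linarith)
  · intro hk
    have hmeas : Continuous fun ξ : E => (1 + ‖ξ‖ ^ 2) ^ ((1 / 2 : ℝ) / 2) :=
      Continuous.rpow_const (by fun_prop) fun ξ => Or.inr (by norm_num)
    refine memLp_two_of_lintegral_enorm_sq_lt_top
      (hmeas.aestronglyMeasurable.smul (Lp.aestronglyMeasurable _)) ?_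
    simp_rw [weight_sq]
    calc ∫⁻ ξ, ENNReal.ofReal (√(1 + ‖ξ‖ ^ 2)) * density (𝓕 f) ξ
        ≤ ∫⁻ ξ, (density (𝓕 f) ξ + ‖ξ‖ₑ * density (𝓕 f) ξ) := by
          refine lintegral_mono fun ξ => ?_
          rw [← one_add_mul, ← ofReal_norm, ← ENNReal.ofReal_one,
            ← ENNReal.ofReal_add zero_le_one (norm_nonneg ξ)]
          gcongr
          rw [Real.sqrt_le_left (by positivity)]
          nlinarith [norm_nonneg ξ]
      _ = (∫⁻ ξ, density f ξ) + ekinetic f := by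
          rw [lintegral_add_left (measurable_density _), lintegral_density_fourier, ekinetic]
      _ < ⊤ := ENNReal.add_lt_top.2 ⟨(lintegral_density_ne_top f).lt_top, hk⟩

end Fourier

section FrequencyCutoff

variable {E F : Type*} [NormedAddCommGroup E] [InnerProductSpace ℝ E] [FiniteDimensional ℝ E]
  [MeasurableSpace E] [BorelSpace E] [NormedAddCommGroup F] [InnerProductSpace ℂ F]
  [CompleteSpace F]

lemma memLp_indicator_ball_fourier (A : ℝ) (f : Lp F 2 (volume : Measure E)) :
    MemLp ((ball (0 : E) A).indicator (𝓕 f : Lp F 2 (volume : Measure E))) 2 volume :=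
  (Lp.memLp (𝓕 f)).indicator measurableSet_ball

/-- The part of `f` with frequencies in the open ball of radius `A`. -/
def lowPass (A : ℝ) (f : Lp F 2 (volume : Measure E)) : Lp F 2 (volume : Measure E) :=
  𝓕⁻ (memLp_indicator_ball_fourier A f).toLp

/-- The part of `f` with frequencies outside the open ball of radius `A`. -/
def highPass (A : ℝ) (f : Lp F 2 (volume : Measure E)) : Lp F 2 (volume : Measure E) :=
  f - lowPass A f

lemma lowPass_add_highPass (A : ℝ) (f : Lp F 2 (volume : Measure E)) :
    lowPass A f + highPass A f = f := by
  rw [highPass, add_sub_cancel]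

lemma fourier_lowPass (A : ℝ) (f : Lp F 2 (volume : Measure E)) :
    ⇑(𝓕 (lowPass A f) : Lp F 2 (volume : Measure E)) =ᵐ[volume]
      (ball (0 : E) A).indicator (𝓕 f : Lp F 2 (volume : Measure E)) := by
  rw [lowPass, FourierTransform.fourier_fourierInv_eq]
  exact MemLp.coeFn_toLp _

lemma fourier_highPass (A : ℝ) (f : Lp F 2 (volume : Measure E)) :
    ⇑(𝓕 (highPass A f) : Lp F 2 (volume : Measure E)) =ᵐ[volume]
      (ball (0 : E) A)ᶜ.indicator (𝓕 f : Lp F 2 (volume : Measure E)) := by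
  have h_sub : 𝓕 (highPass A f) = 𝓕 f - 𝓕 (lowPass A f) :=
    (Lp.fourierTransformₗᵢ E F).map_sub f (lowPass A f)
  rw [h_sub, Set.indicator_compl]
  filter_upwards [fourier_lowPass A f, Lp.coeFn_sub (𝓕 f) (𝓕 (lowPass A f))] with x h_low h_sub
  rw [h_sub, Pi.sub_apply, Pi.sub_apply, h_low]

lemma density_fourier_lowPass (A : ℝ) (f : Lp F 2 (volume : Measure E)) :
    density (𝓕 (lowPass A f)) =ᵐ[volume] (ball (0 : E) A).indicator (density (𝓕 f)) :=
  density_eq_indicator_of_ae_eq (fourier_lowPass A f)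

lemma density_fourier_highPass (A : ℝ) (f : Lp F 2 (volume : Measure E)) :
    density (𝓕 (highPass A f)) =ᵐ[volume] (ball (0 : E) A)ᶜ.indicator (density (𝓕 f)) :=
  density_eq_indicator_of_ae_eq (fourier_highPass A f)

lemma lintegral_density_lowPass (A : ℝ) (f : Lp F 2 (volume : Measure E)) :
    ∫⁻ x, density (lowPass A f) x = ∫⁻ ξ in ball (0 : E) A, density (𝓕 f) ξ := by
  rw [← lintegral_density_fourier, lintegral_congr_ae (density_fourier_lowPass A f),
    lintegral_indicator measurableSet_ball]

lemma lintegral_density_highPass (A : ℝ) (f : Lp F 2 (volume : Measure E)) :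
    ∫⁻ x, density (highPass A f) x = ∫⁻ ξ in (ball (0 : E) A)ᶜ, density (𝓕 f) ξ := by
  rw [← lintegral_density_fourier, lintegral_congr_ae (density_fourier_highPass A f),
    lintegral_indicator measurableSet_ball.compl]

lemma lowPass_ae_eq_setIntegral (A : ℝ) (f : Lp F 2 (volume : Measure E)) :
    lowPass A f =ᵐ[volume]
      fun x => ∫ ξ in ball (0 : E) A, Real.fourierChar ⟪ξ, x⟫ • 𝓕 f ξ := by
  have hm := memLp_indicator_ball_fourier A f
  have hi : Integrable hm.toLp volume := by
    rw [integrable_congr hm.coeFn_toLp, integrable_indicator_iff measurableSet_ball]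
    exact (locallyIntegrable_L2 (𝓕 f)).integrableOn_isCompact (isCompact_closedBall 0 A)
      |>.mono_set ball_subset_closedBall
  refine (fourierInv_ae_eq_integral hi).trans (ae_of_all _ fun x => ?_)
  simp only [Real.fourierInv_eq]
  rw [← integral_indicator measurableSet_ball]
  apply integral_congr_ae
  filter_upwards [hm.coeFn_toLp] with ξ hξ
  rw [hξ, Set.indicator_smul_apply]

lemma density_lowPass_le (A : ℝ) (f : Lp F 2 (volume : Measure E)) :
    ∀ᵐ x, density (lowPass A f) x ≤ (∫⁻ ξ in ball (0 : E) A, ‖𝓕 f ξ‖ₑ) ^ 2 := by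
  filter_upwards [lowPass_ae_eq_setIntegral A f] with x hx
  rw [density, hx]
  gcongr
  refine (enorm_integral_le_lintegral_enorm _).trans (lintegral_mono fun ξ => ?_)
  rw [← ofReal_norm, Circle.norm_smul, ofReal_norm]

end FrequencyCutoff

section Translation

variable {E F : Type*} [NormedAddCommGroup E] [InnerProductSpace ℝ E] [FiniteDimensional ℝ E]
  [MeasurableSpace E] [BorelSpace E] [NormedAddCommGroup F]

/-- The translate `x ↦ f (x + a)`. -/
def translate (a : E) (f : Lp F 2 (volume : Measure E)) : Lp F 2 (volume : Measure E) :=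
  Lp.compMeasurePreserving (fun x => x + a) (measurePreserving_add_right volume a) f

lemma translate_ae_eq (a : E) (f : Lp F 2 (volume : Measure E)) :
    translate a f =ᵐ[volume] fun x => f (x + a) :=
  Lp.coeFn_compMeasurePreserving f (measurePreserving_add_right volume a)

lemma norm_translate (a : E) (f : Lp F 2 (volume : Measure E)) : ‖translate a f‖ = ‖f‖ :=
  Lp.norm_compMeasurePreserving f _

lemma density_translate (a : E) (f : Lp F 2 (volume : Measure E)) :
    density (translate a f) =ᵐ[volume] fun x => density f (x + a) := by
  filter_upwards [translate_ae_eq a f] with x hx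
  rw [density, hx, density]

lemma setLIntegral_ball_density_translate (a : E) (f : Lp F 2 (volume : Measure E)) (R : ℝ) :
    ∫⁻ x in ball (0 : E) R, density (translate a f) x = ∫⁻ x in ball a R, density f x := by
  have h_preimage : (fun x => x + a) ⁻¹' ball a R = ball 0 R := by
    ext x
    simp [dist_eq_norm]
  rw [← (measurePreserving_add_right volume a).setLIntegral_comp_preimage measurableSet_ball
    (measurable_density f), h_preimage]
  exact lintegral_congr_ae (ae_restrict_of_ae (density_translate a f))

lemma fourierInv_compSubConst_fourier (a : E) (h : 𝓢(E, ℂ)) (ξ : E) :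
    𝓕⁻ (SchwartzMap.compSubConstCLM ℂ a (𝓕 h)) ξ = Real.fourierChar ⟪a, ξ⟫ • h ξ := by
  have h_inv : h ξ = 𝓕⁻ (𝓕 h) ξ := by rw [FourierTransform.fourierInv_fourier_eq]
  rw [h_inv, SchwartzMap.fourierInv_coe, SchwartzMap.fourierInv_coe, Real.fourierInv_eq,
    Real.fourierInv_eq, ← integral_add_right_eq_self _ a, Circle.smul_def, ← integral_smul]
  congr 1
  ext x
  simp only [SchwartzMap.compSubConstCLM_apply, add_sub_cancel_right, inner_add_left,
    Circle.smul_def, smul_eq_mul, AddChar.map_add_eq_mul, Circle.coe_mul]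
  ring

variable [InnerProductSpace ℂ F] [CompleteSpace F]

lemma fourier_translate (a : E) (f : Lp F 2 (volume : Measure E)) :
    ⇑(𝓕 (translate a f) : Lp F 2 (volume : Measure E)) =ᵐ[volume]
      fun ξ => Real.fourierChar ⟪a, ξ⟫ • 𝓕 f ξ := by
  have hc : Continuous fun ξ : E => (Real.fourierChar ⟪a, ξ⟫ : ℂ) :=
    continuous_subtype_val.comp (Real.continuous_fourierChar.comp (by fun_prop))
  refine ae_eq_of_forall_integral_schwartz_smul_eq (locallyIntegrable_L2 _)
    ((locallyIntegrable_L2 (𝓕 f)).continuous_smul hc) fun h => ?_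
  calc ∫ x, h x • 𝓕 (translate a f) x
      = ∫ x, (𝓕 h) x • translate a f x := integral_smul_fourier _ h
    _ = ∫ x, (𝓕 h) x • f (x + a) := by
        refine integral_congr_ae ?_
        filter_upwards [translate_ae_eq a f] with x hx
        rw [hx]
    _ = ∫ x, SchwartzMap.compSubConstCLM ℂ a (𝓕 h) x • f x := by
        rw [← integral_sub_right_eq_self _ a]
        simp only [SchwartzMap.compSubConstCLM_apply, sub_add_cancel]
    _ = ∫ ξ, 𝓕⁻ (SchwartzMap.compSubConstCLM ℂ a (𝓕 h)) ξ • 𝓕 f ξ := by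
        rw [integral_smul_fourier, FourierTransform.fourier_fourierInv_eq]
    _ = ∫ ξ, h ξ • Real.fourierChar ⟪a, ξ⟫ • 𝓕 f ξ := by
        simp_rw [fourierInv_compSubConst_fourier, Circle.smul_def, smul_eq_mul, smul_smul, mul_comm]

lemma density_fourier_translate (a : E) (f : Lp F 2 (volume : Measure E)) :
    density (𝓕 (translate a f)) =ᵐ[volume] density (𝓕 f) := by
  filter_upwards [fourier_translate a f] with ξ hξ
  rw [← ofReal_norm_sq, hξ, Circle.norm_smul, ofReal_norm_sq]

end Translation

section Dilation

variable {E F : Type*} [NormedAddCommGroup E] [InnerProductSpace ℝ E] [FiniteDimensional ℝ E]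
  [MeasurableSpace E] [BorelSpace E] [NormedAddCommGroup F] [InnerProductSpace ℂ F]

lemma lintegral_comp_smul {g : E → ℝ≥0∞} (hg : Measurable g) {t : ℝ} (ht : 0 < t) :
    ∫⁻ x, g (t • x) = ENNReal.ofReal (t ^ finrank ℝ E)⁻¹ * ∫⁻ x, g x := by
  rw [← lintegral_map hg (measurable_const_smul t),
    Measure.map_addHaar_smul (volume : Measure E) ht.ne', lintegral_smul_measure,
    abs_of_pos (by positivity), smul_eq_mul]

lemma memLp_comp_smul (f : Lp F 2 (volume : Measure E)) {t : ℝ} (ht : 0 < t) :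
    MemLp (fun x => √(t ^ finrank ℝ E) • f (t • x)) 2 volume := by
  have hf : MemLp f 2 (Measure.map (fun x : E => t • x) volume) := by
    rw [Measure.map_addHaar_smul (volume : Measure E) ht.ne']
    exact (Lp.memLp f).smul_measure ENNReal.ofReal_ne_top
  exact (hf.comp_of_map (measurable_const_smul t).aemeasurable).const_smul _

/-- The `L²`-unitary dilation `x ↦ t^{d/2} f (t x)` in dimension `d`. -/
def dilate {t : ℝ} (ht : 0 < t) (f : Lp F 2 (volume : Measure E)) : Lp F 2 (volume : Measure E) :=
  (memLp_comp_smul f ht).toLp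

lemma dilate_ae_eq {t : ℝ} (ht : 0 < t) (f : Lp F 2 (volume : Measure E)) :
    dilate ht f =ᵐ[volume] fun x => √(t ^ finrank ℝ E) • f (t • x) :=
  MemLp.coeFn_toLp _

lemma density_dilate {t : ℝ} (ht : 0 < t) (f : Lp F 2 (volume : Measure E)) :
    density (dilate ht f) =ᵐ[volume]
      fun x => ENNReal.ofReal (t ^ finrank ℝ E) * density f (t • x) := by
  filter_upwards [dilate_ae_eq ht f] with x hx
  rw [← ofReal_norm_sq, hx, norm_smul, mul_pow, ENNReal.ofReal_mul (by positivity), ofReal_norm_sq,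
    Real.norm_eq_abs, sq_abs, Real.sq_sqrt (by positivity)]

lemma norm_dilate {t : ℝ} (ht : 0 < t) (f : Lp F 2 (volume : Measure E)) :
    ‖dilate ht f‖ = ‖f‖ := by
  have h : ∫⁻ x, density (dilate ht f) x = ∫⁻ x, density f x := by
    rw [lintegral_congr_ae (density_dilate ht f), lintegral_const_mul' _ _ ENNReal.ofReal_ne_top,
      lintegral_comp_smul (measurable_density f) ht, ← mul_assoc,
      ← ENNReal.ofReal_mul (by positivity), mul_inv_cancel₀ (by positivity), ENNReal.ofReal_one,
      one_mul]
  have h_sq := congrArg ENNReal.toReal h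
  rw [toReal_lintegral_density, toReal_lintegral_density] at h_sq
  exact (pow_left_inj₀ (norm_nonneg _) (norm_nonneg _) two_ne_zero).1 h_sq

lemma fourier_comp_smul (h : E → F) {t : ℝ} (ht : 0 < t) (ξ : E) :
    𝓕 (fun x => h (t • x)) ξ = (t ^ finrank ℝ E)⁻¹ • 𝓕 h (t⁻¹ • ξ) := by
  have h_subst := Measure.integral_comp_smul (volume : Measure E)
    (fun v => Real.fourierChar (-⟪v, t⁻¹ • ξ⟫) • h v) t
  rw [abs_of_pos (by positivity)] at h_subst
  rw [Real.fourier_eq, Real.fourier_eq, ← h_subst]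
  simp only [real_inner_smul_left, real_inner_smul_right, inv_mul_cancel_left₀ ht.ne']

variable [CompleteSpace F]

lemma fourier_dilate {t : ℝ} (ht : 0 < t) (f : Lp F 2 (volume : Measure E)) :
    ⇑(𝓕 (dilate ht f) : Lp F 2 (volume : Measure E)) =ᵐ[volume]
      fun ξ => √(t⁻¹ ^ finrank ℝ E) • 𝓕 f (t⁻¹ • ξ) := by
  refine ae_eq_of_forall_integral_schwartz_smul_eq (locallyIntegrable_L2 _)
    ((memLp_comp_smul (𝓕 f) (inv_pos.2 ht)).locallyIntegrable one_le_two) fun h => ?_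
  set h_dil : 𝓢(E, ℂ) := SchwartzMap.compCLMOfContinuousLinearEquiv ℂ
    (ContinuousLinearEquiv.smulLeft (Units.mk0 t ht.ne') : E ≃L[ℝ] E) h
  have fourier_h_dil (x : E) : (𝓕 h_dil) x = (t ^ finrank ℝ E)⁻¹ • (𝓕 h) (t⁻¹ • x) := by
    rw [SchwartzMap.fourier_coe, SchwartzMap.fourier_coe]
    exact fourier_comp_smul h ht x
  have subst_f := Measure.integral_comp_smul (volume : Measure E)
    (fun x => (𝓕 h) (t⁻¹ • x) • f x) t
  have subst_fourier := Measure.integral_comp_smul (volume : Measure E)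
    (fun ξ => h (t • ξ) • 𝓕 f ξ) t⁻¹
  rw [abs_of_pos (by positivity)] at subst_f subst_fourier
  simp only [inv_smul_smul₀ ht.ne', smul_inv_smul₀ ht.ne'] at subst_f subst_fourier
  have sqrt_eq : √(t⁻¹ ^ finrank ℝ E) = √(t ^ finrank ℝ E) * (t ^ finrank ℝ E)⁻¹ := by
    rw [inv_pow, Real.sqrt_inv, eq_mul_inv_iff_mul_eq₀ (by positivity), inv_mul_eq_div,
      Real.div_sqrt]
  calc ∫ ξ, h ξ • 𝓕 (dilate ht f) ξ
      = ∫ x, (𝓕 h) x • dilate ht f x := integral_smul_fourier _ h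
    _ = √(t ^ finrank ℝ E) • ∫ x, (𝓕 h) x • f (t • x) := by
        rw [← integral_smul]
        refine integral_congr_ae ?_
        filter_upwards [dilate_ae_eq ht f] with x hx
        rw [hx, smul_comm]
    _ = √(t ^ finrank ℝ E) • ∫ x, (𝓕 h_dil) x • f x := by
        simp_rw [subst_f, fourier_h_dil, smul_assoc, integral_smul]
    _ = √(t ^ finrank ℝ E) • ∫ ξ, h (t • ξ) • 𝓕 f ξ := by
        rw [← integral_smul_fourier]
        rfl
    _ = √(t⁻¹ ^ finrank ℝ E) • ∫ ξ, h ξ • 𝓕 f (t⁻¹ • ξ) := by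
        rw [subst_fourier, smul_smul, sqrt_eq, inv_pow, inv_inv]
        congr 1
        field_simp
    _ = ∫ ξ, h ξ • √(t⁻¹ ^ finrank ℝ E) • 𝓕 f (t⁻¹ • ξ) := by
        rw [← integral_smul]
        exact integral_congr_ae (ae_of_all _ fun ξ => smul_comm _ _ _)

lemma density_fourier_dilate {t : ℝ} (ht : 0 < t) (f : Lp F 2 (volume : Measure E)) :
    density (𝓕 (dilate ht f)) =ᵐ[volume]
      fun ξ => ENNReal.ofReal (t⁻¹ ^ finrank ℝ E) * density (𝓕 f) (t⁻¹ • ξ) := by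
  filter_upwards [fourier_dilate ht f] with x hx
  have : 0 < t⁻¹ := inv_pos.2 ht
  rw [← ofReal_norm_sq, hx, norm_smul, mul_pow, ENNReal.ofReal_mul (by positivity), ofReal_norm_sq,
    Real.norm_eq_abs, sq_abs, Real.sq_sqrt (by positivity)]

end Dilation

section RieszKernel

variable {E : Type*} [NormedAddCommGroup E]

/-- The Riesz kernel `1 / |z|^s`, with values in `[0, ∞]`. It takes the junk value `0` at the origin
when `s ≠ 0`. -/
def rieszKernel (s : ℝ) (z : E) : ℝ≥0∞ := ENNReal.ofReal (1 / ‖z‖ ^ s)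

lemma rieszKernel_smul [NormedSpace ℝ E] (s : ℝ) {t : ℝ} (ht : 0 < t) (z : E) :
    rieszKernel s (t • z) = ENNReal.ofReal (t ^ (-s)) * rieszKernel s z := by
  rw [rieszKernel, rieszKernel, ← ENNReal.ofReal_mul (by positivity), norm_smul, Real.norm_eq_abs,
    abs_of_pos ht, Real.mul_rpow ht.le (norm_nonneg _), Real.rpow_neg ht.le, one_div, mul_inv,
    one_div]

variable [MeasurableSpace E] [BorelSpace E]

@[fun_prop]
lemma measurable_rieszKernel (s : ℝ) : Measurable (rieszKernel s : E → ℝ≥0∞) := by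
  unfold rieszKernel
  fun_prop

end RieszKernel

section LocalMass

variable {E F : Type*} [NormedAddCommGroup E] [InnerProductSpace ℝ E] [FiniteDimensional ℝ E]
  [MeasurableSpace E] [BorelSpace E] [NormedAddCommGroup F] [InnerProductSpace ℂ F]
  [CompleteSpace F]

lemma setLIntegral_ball_rieszKernel_lt_top [Nontrivial E] {s : ℝ} (hs : s < finrank ℝ E) :
    ∫⁻ z in ball (0 : E) 1, rieszKernel s z < ⊤ := by
  have h : IntegrableOn (fun z : E => (fun r : ℝ => 1 / r ^ s) ‖z‖) (ball 0 1) volume := by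
    rw [integrableOn_fun_norm_addHaar volume (f := fun r : ℝ => 1 / r ^ s)]
    have h_radial : IntegrableOn (fun r : ℝ => r ^ ((finrank ℝ E : ℝ) - 1 - s)) (Set.Ioo 0 1) :=
      (intervalIntegral.integrableOn_Ioo_rpow_iff zero_lt_one).2 (by linarith)
    refine h_radial.congr_fun (fun r hr => ?_) measurableSet_Ioo
    simp only [smul_eq_mul]
    rw [Real.rpow_sub hr.1, ← Nat.cast_pred Module.finrank_pos, Real.rpow_natCast, mul_one_div]
  exact h.lintegral_lt_top

lemma setLIntegral_ball_rieszKernel (s : ℝ) {A : ℝ} (hA : 0 < A) :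
    ∫⁻ z in ball (0 : E) A, rieszKernel s z
      = ENNReal.ofReal (A ^ (finrank ℝ E - s)) * ∫⁻ z in ball (0 : E) 1, rieszKernel s z := by
  have indicator_smul (z : E) : (ball (0 : E) A).indicator (rieszKernel s) (A • z)
      = ENNReal.ofReal (A ^ (-s)) * (ball (0 : E) 1).indicator (rieszKernel s) z := by
    have hz : A • z ∈ ball (0 : E) A ↔ z ∈ ball (0 : E) 1 := by
      rw [mem_ball_zero_iff, mem_ball_zero_iff, norm_smul, Real.norm_eq_abs, abs_of_pos hA,
        mul_lt_iff_lt_one_right hA]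
    by_cases hm : z ∈ ball (0 : E) 1
    · rw [Set.indicator_of_mem (hz.2 hm), Set.indicator_of_mem hm, rieszKernel_smul s hA]
    · rw [Set.indicator_of_notMem (mt hz.1 hm), Set.indicator_of_notMem hm, mul_zero]
  have scaling := lintegral_comp_smul ((measurable_rieszKernel s).indicator
    (measurableSet_ball (x := (0 : E)) (ε := A))) hA
  simp_rw [indicator_smul] at scaling
  rw [lintegral_const_mul' _ _ ENNReal.ofReal_ne_top, lintegral_indicator measurableSet_ball,
    lintegral_indicator measurableSet_ball] at scaling
  calc ∫⁻ z in ball (0 : E) A, rieszKernel s z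
      = ENNReal.ofReal (A ^ finrank ℝ E) * (ENNReal.ofReal (A ^ finrank ℝ E)⁻¹
          * ∫⁻ z in ball (0 : E) A, rieszKernel s z) := by
        rw [← mul_assoc, ← ENNReal.ofReal_mul (by positivity), mul_inv_cancel₀ (by positivity),
          ENNReal.ofReal_one, one_mul]
    _ = ENNReal.ofReal (A ^ (finrank ℝ E - s)) * ∫⁻ z in ball (0 : E) 1, rieszKernel s z := by
        rw [← scaling, ← mul_assoc, ← ENNReal.ofReal_mul (by positivity), ← Real.rpow_natCast,
          ← Real.rpow_add hA, sub_eq_add_neg]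

lemma sq_setLIntegral_enorm_fourier_le [Nontrivial E] (f : Lp F 2 (volume : Measure E)) {A : ℝ}
    (hA : 0 < A) :
    (∫⁻ ξ in ball (0 : E) A, ‖𝓕 f ξ‖ₑ) ^ 2
      ≤ ENNReal.ofReal (A ^ (finrank ℝ E - 2 : ℝ)) * (∫⁻ z in ball (0 : E) 1, rieszKernel 2 z)
        * ∫⁻ ξ in ball (0 : E) A, ‖ξ‖ₑ ^ 2 * density (𝓕 f) ξ := by
  have h_weight : ∫⁻ ξ in ball (0 : E) A, ‖𝓕 f ξ‖ₑ
      = ∫⁻ ξ in ball (0 : E) A, rieszKernel 1 ξ * (‖ξ‖ₑ * ‖𝓕 f ξ‖ₑ) := by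
    refine lintegral_congr_ae (ae_restrict_of_ae ?_)
    filter_upwards [Measure.ae_ne (volume : Measure E) 0] with ξ hξ
    rw [← mul_assoc, rieszKernel, Real.rpow_one, ← ofReal_norm ξ,
      ← ENNReal.ofReal_mul (by positivity), one_div, inv_mul_cancel₀ (norm_ne_zero_iff.2 hξ),
      ENNReal.ofReal_one, one_mul]
  have h_kernel_sq (ξ : E) : rieszKernel 1 ξ ^ 2 = rieszKernel 2 ξ := by
    rw [rieszKernel, rieszKernel, ← ENNReal.ofReal_pow (by positivity), Real.rpow_one,
      Real.rpow_two, one_div_pow]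
  rw [h_weight, ← setLIntegral_ball_rieszKernel 2 hA]
  simp_rw [density, ← h_kernel_sq, ← mul_pow]
  exact lintegral_mul_sq_le (by fun_prop)
    (measurable_enorm.mul (Lp.stronglyMeasurable (𝓕 f)).enorm).aemeasurable

lemma setLIntegral_ball_density_lowPass_le [Nontrivial E] (f : Lp F 2 (volume : Measure E)) (a : E)
    {R : ℝ} (hR : 0 < R) :
    ∫⁻ y in ball a R, density (lowPass R⁻¹ f) y
      ≤ volume (ball (0 : E) 1) * (∫⁻ z in ball (0 : E) 1, rieszKernel 2 z)
        * ENNReal.ofReal (R ^ 2) * ∫⁻ ξ in ball (0 : E) R⁻¹, ‖ξ‖ₑ ^ 2 * density (𝓕 f) ξ := by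
  set K := ∫⁻ z in ball (0 : E) 1, rieszKernel 2 z
  set L := ∫⁻ ξ in ball (0 : E) R⁻¹, ‖ξ‖ₑ ^ 2 * density (𝓕 f) ξ
  calc ∫⁻ y in ball a R, density (lowPass R⁻¹ f) y
      ≤ ∫⁻ _ in ball a R, (∫⁻ ξ in ball (0 : E) R⁻¹, ‖𝓕 f ξ‖ₑ) ^ 2 :=
        lintegral_mono_ae (ae_restrict_of_ae (density_lowPass_le R⁻¹ f))
    _ = (∫⁻ ξ in ball (0 : E) R⁻¹, ‖𝓕 f ξ‖ₑ) ^ 2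
          * (ENNReal.ofReal (R ^ finrank ℝ E) * volume (ball (0 : E) 1)) := by
        rw [setLIntegral_const, Measure.addHaar_ball volume a hR.le]
    _ ≤ ENNReal.ofReal (R⁻¹ ^ (finrank ℝ E - 2 : ℝ)) * K * L
          * (ENNReal.ofReal (R ^ finrank ℝ E) * volume (ball (0 : E) 1)) := by
        gcongr
        exact sq_setLIntegral_enorm_fourier_le f (inv_pos.2 hR)
    _ = volume (ball (0 : E) 1) * K * ENNReal.ofReal (R ^ 2) * L := by
        have h_pow : R ^ 2 = R⁻¹ ^ (finrank ℝ E - 2 : ℝ) * R ^ finrank ℝ E := by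
          rw [Real.inv_rpow hR.le, ← Real.rpow_neg hR.le, ← Real.rpow_natCast R (finrank ℝ E),
            ← Real.rpow_add hR, ← Real.rpow_two]
          congr 1
          ring
        rw [h_pow, ENNReal.ofReal_mul (by positivity)]
        ring

/-- The uncertainty principle behind Kato's inequality: frequencies below `1 / R` see a ball of
radius `R` only through `∫ |ξ|² |𝓕 f|²`, the others are estimated by their whole mass. -/
lemma exists_setLIntegral_ball_density_le (hd : 2 < finrank ℝ E) :
    ∃ C : ℝ≥0, ∀ (f : Lp F 2 (volume : Measure E)) (a : E) (R : ℝ), 0 < R →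
      ∫⁻ y in ball a R, density f y ≤
        C * ENNReal.ofReal (R ^ 2) * (∫⁻ ξ in ball (0 : E) R⁻¹, ‖ξ‖ₑ ^ 2 * density (𝓕 f) ξ) +
        2 * ∫⁻ ξ in (ball (0 : E) R⁻¹)ᶜ, density (𝓕 f) ξ := by
  have : Nontrivial E := Module.finrank_pos_iff (R := ℝ).1 (by lia)
  set K := ∫⁻ z in ball (0 : E) 1, rieszKernel 2 z
  have hK : K ≠ ⊤ := (setLIntegral_ball_rieszKernel_lt_top (by exact_mod_cast hd)).ne
  have hV : volume (ball (0 : E) 1) ≠ ⊤ := measure_ball_lt_top.ne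
  refine ⟨2 * (volume (ball (0 : E) 1)).toNNReal * K.toNNReal, fun f a R hR => ?_⟩
  have h_split := setLIntegral_density_add_le (lowPass R⁻¹ f) (highPass R⁻¹ f) (ball a R)
  rw [lowPass_add_highPass] at h_split
  calc ∫⁻ y in ball a R, density f y
      ≤ 2 * (∫⁻ y in ball a R, density (lowPass R⁻¹ f) y)
        + 2 * ∫⁻ y in ball a R, density (highPass R⁻¹ f) y := h_split
    _ ≤ 2 * (volume (ball (0 : E) 1) * K * ENNReal.ofReal (R ^ 2)
          * ∫⁻ ξ in ball (0 : E) R⁻¹, ‖ξ‖ₑ ^ 2 * density (𝓕 f) ξ)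
        + 2 * ∫⁻ ξ in (ball (0 : E) R⁻¹)ᶜ, density (𝓕 f) ξ := by
        rw [← lintegral_density_highPass]
        gcongr
        · exact setLIntegral_ball_density_lowPass_le f a hR
        · exact Measure.restrict_le_self
    _ = _ := by
        push_cast
        rw [ENNReal.coe_toNNReal hV, ENNReal.coe_toNNReal hK]
        ring

end LocalMass

section Kato

lemma lintegral_setLIntegral_swap {X Y : Type*} [MeasurableSpace X] [MeasurableSpace Y]
    {μ : Measure X} {ν : Measure Y} [SFinite μ] [SFinite ν] {S : Set (X × Y)}
    (hS : MeasurableSet S) {k : X → Y → ℝ≥0∞} (hk : Measurable (Function.uncurry k)) :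
    ∫⁻ x, ∫⁻ y in {y | (x, y) ∈ S}, k x y ∂ν ∂μ = ∫⁻ y, ∫⁻ x in {x | (x, y) ∈ S}, k x y ∂μ ∂ν := by
  calc ∫⁻ x, ∫⁻ y in {y | (x, y) ∈ S}, k x y ∂ν ∂μ
      = ∫⁻ x, ∫⁻ y, S.indicator (Function.uncurry k) (x, y) ∂ν ∂μ := by
        congr with x
        exact (lintegral_indicator (measurable_prodMk_left hS) (k x)).symm
    _ = ∫⁻ y, ∫⁻ x, S.indicator (Function.uncurry k) (x, y) ∂μ ∂ν :=
        lintegral_lintegral_swap (hk.indicator hS).aemeasurable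
    _ = ∫⁻ y, ∫⁻ x in {x | (x, y) ∈ S}, k x y ∂μ ∂ν := by
        congr with y
        exact lintegral_indicator (measurable_prodMk_right hS) fun x => k x y

lemma lintegral_Ioi_inv_sq {c : ℝ} (hc : 0 < c) :
    ∫⁻ R in Set.Ioi c, ENNReal.ofReal (1 / R ^ 2) = ENNReal.ofReal (1 / c) := by
  have h_rpow : Set.EqOn (fun R : ℝ => ENNReal.ofReal (1 / R ^ 2))
      (fun R => ENNReal.ofReal (R ^ (-2 : ℝ))) (Set.Ioi c) := fun R hR => by
    simp only [Real.rpow_neg (hc.trans hR).le, Real.rpow_two, one_div]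
  have h_nonneg : 0 ≤ᵐ[volume.restrict (Set.Ioi c)] fun R : ℝ => R ^ (-2 : ℝ) := by
    filter_upwards [ae_restrict_mem measurableSet_Ioi] with R hR
    exact Real.rpow_nonneg (hc.trans hR).le _
  rw [setLIntegral_congr_fun measurableSet_Ioi h_rpow,
    ← ofReal_integral_eq_lintegral_ofReal (integrableOn_Ioi_rpow_of_lt (by norm_num) hc) h_nonneg,
    integral_Ioi_rpow_of_lt (by norm_num) hc, show (-2 : ℝ) + 1 = -1 by norm_num,
    Real.rpow_neg_one, neg_div_neg_eq, div_one, one_div]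

variable {E : Type*} [NormedAddCommGroup E]

lemma rieszKernel_one_le (z : E) :
    rieszKernel 1 z ≤ ∫⁻ R in Set.Ioi ‖z‖, ENNReal.ofReal (1 / R ^ 2) := by
  rcases eq_or_ne z 0 with rfl | hz
  · simp [rieszKernel]
  · rw [lintegral_Ioi_inv_sq (norm_pos_iff.2 hz), rieszKernel, Real.rpow_one]

variable [MeasurableSpace E] [BorelSpace E]

lemma measurableSet_norm_lt_inv : MeasurableSet {p : ℝ × E | p.2 ∈ ball (0 : E) p.1⁻¹} := by
  simp only [mem_ball_zero_iff]
  exact measurableSet_lt (by fun_prop) (by fun_prop)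

variable {μ : Measure E} [SFinite μ]

lemma lintegral_rieszKernel_one_mul_le {g : E → ℝ≥0∞} (hg : Measurable g) (a : E) :
    ∫⁻ y, rieszKernel 1 (a - y) * g y ∂μ
      ≤ ∫⁻ R in Set.Ioi (0 : ℝ), ENNReal.ofReal (1 / R ^ 2) * ∫⁻ y in ball a R, g y ∂μ := by
  have hS : MeasurableSet {p : E × ℝ | ‖a - p.1‖ < p.2} :=
    measurableSet_lt (by fun_prop) (by fun_prop)
  have h_ball (R : ℝ) : {y | ‖a - y‖ < R} = ball a R := by
    ext y
    rw [Set.mem_ofPred_eq, mem_ball, dist_comm, dist_eq_norm]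
  calc ∫⁻ y, rieszKernel 1 (a - y) * g y ∂μ
      ≤ ∫⁻ y, ∫⁻ R in Set.Ioi ‖a - y‖, ENNReal.ofReal (1 / R ^ 2) * g y ∂volume ∂μ := by
        refine lintegral_mono fun y => ?_
        rw [lintegral_mul_const _ (by fun_prop)]
        gcongr
        exact rieszKernel_one_le _
    _ = ∫⁻ R, ∫⁻ y in {y : E | ‖a - y‖ < R}, ENNReal.ofReal (1 / R ^ 2) * g y ∂μ :=
        lintegral_setLIntegral_swap hS (k := fun y R => ENNReal.ofReal (1 / R ^ 2) * g y)
          (by fun_prop)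
    _ = ∫⁻ R, ENNReal.ofReal (1 / R ^ 2) * ∫⁻ y in ball a R, g y ∂μ := by
        simp_rw [h_ball, lintegral_const_mul _ hg]
    _ = ∫⁻ R in Set.Ioi (0 : ℝ), ENNReal.ofReal (1 / R ^ 2) * ∫⁻ y in ball a R, g y ∂μ := by
        refine (setLIntegral_eq_of_support_subset fun R hR => ?_).symm
        by_contra hR_nonpos
        refine hR ?_
        simp only [ball_eq_empty.2 (not_lt.1 hR_nonpos), Measure.restrict_empty,
          lintegral_zero_measure, mul_zero]

lemma lintegral_lintegral_compl_ball_inv_le {g : E → ℝ≥0∞} (hg : Measurable g) :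
    ∫⁻ R in Set.Ioi (0 : ℝ), ENNReal.ofReal (1 / R ^ 2) * ∫⁻ ξ in (ball (0 : E) R⁻¹)ᶜ, g ξ ∂μ
      ≤ ∫⁻ ξ, ‖ξ‖ₑ * g ξ ∂μ := by
  have weight_le (ξ : E) : ∫⁻ R in {R : ℝ | ξ ∈ (ball (0 : E) R⁻¹)ᶜ}, ENNReal.ofReal (1 / R ^ 2)
      ∂volume.restrict (Set.Ioi 0) ≤ ‖ξ‖ₑ := by
    have h_meas : MeasurableSet {R : ℝ | ξ ∈ (ball (0 : E) R⁻¹)ᶜ} :=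
      measurable_prodMk_right measurableSet_norm_lt_inv.compl
    rw [Measure.restrict_restrict h_meas]
    rcases eq_or_ne ξ 0 with rfl | hξ
    · have h_empty : {R : ℝ | (0 : E) ∈ (ball (0 : E) R⁻¹)ᶜ} ∩ Set.Ioi 0 = ∅ := by
        refine Set.eq_empty_of_forall_notMem fun R hR => hR.1 ?_
        exact mem_ball_self (inv_pos.2 hR.2)
      rw [h_empty, Measure.restrict_empty, lintegral_zero_measure]
      exact zero_le
    have hξ_pos : 0 < ‖ξ‖ := norm_pos_iff.2 hξ
    have h_sub : {R : ℝ | ξ ∈ (ball (0 : E) R⁻¹)ᶜ} ∩ Set.Ioi 0 ⊆ Set.Ici ‖ξ‖⁻¹ := fun R hR =>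
      (inv_le_comm₀ hR.2 hξ_pos).1 (not_lt.1 (mt mem_ball_zero_iff.2 hR.1))
    calc ∫⁻ R in {R : ℝ | ξ ∈ (ball (0 : E) R⁻¹)ᶜ} ∩ Set.Ioi 0, ENNReal.ofReal (1 / R ^ 2)
        ≤ ∫⁻ R in Set.Ici ‖ξ‖⁻¹, ENNReal.ofReal (1 / R ^ 2) := lintegral_mono_set h_sub
      _ = ‖ξ‖ₑ := by
        rw [setLIntegral_congr Ioi_ae_eq_Ici.symm, lintegral_Ioi_inv_sq (inv_pos.2 hξ_pos),
          one_div, inv_inv, ofReal_norm]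
  simp_rw [← lintegral_const_mul _ hg]
  calc ∫⁻ R in Set.Ioi (0 : ℝ), ∫⁻ ξ in (ball (0 : E) R⁻¹)ᶜ, ENNReal.ofReal (1 / R ^ 2) * g ξ ∂μ
      = ∫⁻ ξ, ∫⁻ R in {R : ℝ | ξ ∈ (ball (0 : E) R⁻¹)ᶜ}, ENNReal.ofReal (1 / R ^ 2) * g ξ
          ∂volume.restrict (Set.Ioi 0) ∂μ :=
        lintegral_setLIntegral_swap measurableSet_norm_lt_inv.compl (by fun_prop)
    _ ≤ ∫⁻ ξ, ‖ξ‖ₑ * g ξ ∂μ := by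
        refine lintegral_mono fun ξ => ?_
        rw [lintegral_mul_const _ (by fun_prop)]
        gcongr
        exact weight_le ξ

variable [SecondCountableTopology E]

lemma lintegral_lintegral_ball_inv_le {g : E → ℝ≥0∞} (hg : Measurable g) :
    ∫⁻ R in Set.Ioi (0 : ℝ), ∫⁻ ξ in ball (0 : E) R⁻¹, ‖ξ‖ₑ ^ 2 * g ξ ∂μ
      ≤ ∫⁻ ξ, ‖ξ‖ₑ * g ξ ∂μ := by
  have weight_le (ξ : E) : ∫⁻ _ in {R : ℝ | ξ ∈ ball (0 : E) R⁻¹}, ‖ξ‖ₑ ^ 2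
      ∂volume.restrict (Set.Ioi 0) ≤ ‖ξ‖ₑ := by
    rcases eq_or_ne ξ 0 with rfl | hξ
    · simp
    have hξ_pos : 0 < ‖ξ‖ := norm_pos_iff.2 hξ
    have h_sub : {R : ℝ | ξ ∈ ball (0 : E) R⁻¹} ∩ Set.Ioi 0 ⊆ Set.Ioo 0 ‖ξ‖⁻¹ := fun R hR =>
      ⟨hR.2, (lt_inv_comm₀ hR.2 hξ_pos).2 (mem_ball_zero_iff.1 hR.1)⟩
    have h_meas : MeasurableSet {R : ℝ | ξ ∈ ball (0 : E) R⁻¹} :=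
      measurable_prodMk_right measurableSet_norm_lt_inv
    rw [Measure.restrict_restrict h_meas, setLIntegral_const]
    calc ‖ξ‖ₑ ^ 2 * volume ({R : ℝ | ξ ∈ ball (0 : E) R⁻¹} ∩ Set.Ioi 0)
        ≤ ‖ξ‖ₑ ^ 2 * volume (Set.Ioo 0 ‖ξ‖⁻¹) := by gcongr
      _ = ‖ξ‖ₑ := by
        rw [Real.volume_Ioo, sub_zero, ← ofReal_norm, ← ENNReal.ofReal_pow hξ_pos.le,
          ← ENNReal.ofReal_mul (by positivity), sq, mul_inv_cancel_right₀ hξ_pos.ne']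
  calc ∫⁻ R in Set.Ioi (0 : ℝ), ∫⁻ ξ in ball (0 : E) R⁻¹, ‖ξ‖ₑ ^ 2 * g ξ ∂μ
      = ∫⁻ ξ, ∫⁻ _ in {R : ℝ | ξ ∈ ball (0 : E) R⁻¹}, ‖ξ‖ₑ ^ 2 * g ξ
          ∂volume.restrict (Set.Ioi 0) ∂μ :=
        lintegral_setLIntegral_swap measurableSet_norm_lt_inv (by fun_prop)
    _ ≤ ∫⁻ ξ, ‖ξ‖ₑ * g ξ ∂μ := by
        refine lintegral_mono fun ξ => ?_
        rw [lintegral_mul_const _ measurable_const]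
        gcongr
        exact weight_le ξ

end Kato

/-- Kato's inequality: the Hardy potential `1 / |x - a|` is form-bounded by `√(-Δ)`. -/
theorem exists_lintegral_rieszKernel_one_mul_density_le {E F : Type*} [NormedAddCommGroup E]
    [InnerProductSpace ℝ E] [FiniteDimensional ℝ E] [MeasurableSpace E] [BorelSpace E]
    [NormedAddCommGroup F] [InnerProductSpace ℂ F] [CompleteSpace F] (hd : 2 < finrank ℝ E) :
    ∃ C : ℝ≥0, ∀ (f : Lp F 2 (volume : Measure E)) (a : E),
      ∫⁻ y, rieszKernel 1 (a - y) * density f y ≤ C * ekinetic f := by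
  obtain ⟨C, hC⟩ := exists_setLIntegral_ball_density_le (F := F) hd
  refine ⟨C + 2, fun f a => ?_⟩
  have meas_fourier := measurable_density (𝓕 f)
  have meas_low : Measurable fun R : ℝ =>
      ∫⁻ ξ in ball (0 : E) R⁻¹, ‖ξ‖ₑ ^ 2 * density (𝓕 f) ξ := by
    simp_rw [← lintegral_indicator measurableSet_ball]
    exact ((by fun_prop : Measurable fun p : ℝ × E => ‖p.2‖ₑ ^ 2 * density (𝓕 f) p.2).indicator
      measurableSet_norm_lt_inv).lintegral_prod_right'
  calc ∫⁻ y, rieszKernel 1 (a - y) * density f y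
      ≤ ∫⁻ R in Set.Ioi (0 : ℝ), ENNReal.ofReal (1 / R ^ 2) * ∫⁻ y in ball a R, density f y :=
        lintegral_rieszKernel_one_mul_le (measurable_density f) a
    _ ≤ ∫⁻ R in Set.Ioi (0 : ℝ), (C * (∫⁻ ξ in ball (0 : E) R⁻¹, ‖ξ‖ₑ ^ 2 * density (𝓕 f) ξ)
          + 2 * (ENNReal.ofReal (1 / R ^ 2) * ∫⁻ ξ in (ball (0 : E) R⁻¹)ᶜ, density (𝓕 f) ξ)) := by
        refine setLIntegral_mono' measurableSet_Ioi fun R (hR : 0 < R) => ?_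
        have h_inv : ENNReal.ofReal (1 / R ^ 2) * ENNReal.ofReal (R ^ 2) = 1 := by
          rw [← ENNReal.ofReal_mul (by positivity), one_div, inv_mul_cancel₀ (by positivity),
            ENNReal.ofReal_one]
        refine (mul_le_mul_right (hC f a R hR) _).trans_eq ?_
        rw [mul_add, ← mul_assoc, mul_left_comm _ (C : ℝ≥0∞), h_inv, mul_one, mul_left_comm]
    _ = C * (∫⁻ R in Set.Ioi (0 : ℝ), ∫⁻ ξ in ball (0 : E) R⁻¹, ‖ξ‖ₑ ^ 2 * density (𝓕 f) ξ)
          + 2 * ∫⁻ R in Set.Ioi (0 : ℝ), ENNReal.ofReal (1 / R ^ 2)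
            * ∫⁻ ξ in (ball (0 : E) R⁻¹)ᶜ, density (𝓕 f) ξ := by
        rw [lintegral_add_left (meas_low.const_mul _), lintegral_const_mul _ meas_low,
          lintegral_const_mul' _ _ ENNReal.ofNat_ne_top]
    _ ≤ C * ekinetic f + 2 * ekinetic f := by
        gcongr
        · exact lintegral_lintegral_ball_inv_le meas_fourier
        · exact lintegral_lintegral_compl_ball_inv_le meas_fourier
    _ = (C + 2 : ℝ≥0) * ekinetic f := by
        push_cast
        ring

section RieszPotential

variable {E : Type*} [NormedAddCommGroup E] [InnerProductSpace ℝ E] [FiniteDimensional ℝ E]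
  [MeasurableSpace E] [BorelSpace E]

/-- The Riesz potential `x ↦ ∫ g(y) / |x - y|^s dy`. -/
def rieszPotential (s : ℝ) (g : E → ℝ≥0∞) (x : E) : ℝ≥0∞ := ∫⁻ y, rieszKernel s (x - y) * g y

/-- The mutual Riesz energy `∬ g(x) h(y) / |x - y|^s dx dy`. -/
def rieszForm (s : ℝ) (g h : E → ℝ≥0∞) : ℝ≥0∞ := ∫⁻ x, g x * rieszPotential s h x

lemma measurable_rieszPotential (s : ℝ) {g : E → ℝ≥0∞} (hg : Measurable g) :
    Measurable (rieszPotential s g) :=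
  Measurable.lintegral_prod_right'
    (by fun_prop : Measurable fun p : E × E => rieszKernel s (p.1 - p.2) * g p.2)

lemma rieszPotential_mono (s : ℝ) {g h : E → ℝ≥0∞} (hgh : g ≤ᵐ[volume] h) (x : E) :
    rieszPotential s g x ≤ rieszPotential s h x := by
  refine lintegral_mono_ae ?_
  filter_upwards [hgh] with y hy
  gcongr

lemma rieszPotential_add (s : ℝ) {g h : E → ℝ≥0∞} (hg : Measurable g) (x : E) :
    rieszPotential s (g + h) x = rieszPotential s g x + rieszPotential s h x := by
  simp only [rieszPotential, Pi.add_apply, mul_add]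
  exact lintegral_add_left (by fun_prop) _

lemma rieszPotential_const_mul (s : ℝ) {c : ℝ≥0∞} (hc : c ≠ ⊤) (g : E → ℝ≥0∞) (x : E) :
    rieszPotential s (fun y => c * g y) x = c * rieszPotential s g x := by
  simp only [rieszPotential, ← lintegral_const_mul' _ _ hc, mul_left_comm]

lemma rieszForm_comm (s : ℝ) {g h : E → ℝ≥0∞} (hg : Measurable g) (hh : Measurable h) :
    rieszForm s g h = rieszForm s h g := by
  have expand (u : E → ℝ≥0∞) {v : E → ℝ≥0∞} (hv : Measurable v) :
      rieszForm s u v = ∫⁻ x, ∫⁻ y, u x * (rieszKernel s (x - y) * v y) := by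
    simp only [rieszForm, rieszPotential]
    congr with x
    exact (lintegral_const_mul _ (by fun_prop)).symm
  rw [expand g hh, expand h hg, lintegral_lintegral_swap (by fun_prop)]
  congr with x
  congr with y
  rw [rieszKernel, rieszKernel, norm_sub_rev]
  ring

lemma rieszForm_mono (s : ℝ) {g g' h h' : E → ℝ≥0∞} (hg : g ≤ᵐ[volume] g')
    (hh : h ≤ᵐ[volume] h') : rieszForm s g h ≤ rieszForm s g' h' := by
  refine lintegral_mono_ae ?_
  filter_upwards [hg] with x hx
  gcongr
  exact rieszPotential_mono s hh x

lemma rieszForm_congr (s : ℝ) {g g' h h' : E → ℝ≥0∞} (hg : g =ᵐ[volume] g')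
    (hh : h =ᵐ[volume] h') : rieszForm s g h = rieszForm s g' h' :=
  le_antisymm (rieszForm_mono s hg.le hh.le) (rieszForm_mono s hg.symm.le hh.symm.le)

lemma rieszForm_add_left (s : ℝ) {g g' h : E → ℝ≥0∞} (hg : Measurable g) (hh : Measurable h) :
    rieszForm s (g + g') h = rieszForm s g h + rieszForm s g' h := by
  simp only [rieszForm, Pi.add_apply, add_mul]
  exact lintegral_add_left (hg.mul (measurable_rieszPotential s hh)) _

lemma rieszForm_add_right (s : ℝ) {g h h' : E → ℝ≥0∞} (hg : Measurable g) (hh : Measurable h) :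
    rieszForm s g (h + h') = rieszForm s g h + rieszForm s g h' := by
  simp only [rieszForm, rieszPotential_add s hh, mul_add]
  exact lintegral_add_left (hg.mul (measurable_rieszPotential s hh)) _

lemma rieszForm_const_mul_left (s : ℝ) {c : ℝ≥0∞} (hc : c ≠ ⊤) (g h : E → ℝ≥0∞) :
    rieszForm s (fun y => c * g y) h = c * rieszForm s g h := by
  simp only [rieszForm, ← lintegral_const_mul' _ _ hc, mul_assoc]

lemma rieszForm_const_mul_right (s : ℝ) {c : ℝ≥0∞} (hc : c ≠ ⊤) (g h : E → ℝ≥0∞) :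
    rieszForm s g (fun y => c * h y) = c * rieszForm s g h := by
  simp only [rieszForm, rieszPotential_const_mul s hc, ← lintegral_const_mul' _ _ hc,
    mul_left_comm]

lemma rieszForm_le_of_rieszPotential_le (s : ℝ) {g h : E → ℝ≥0∞} (hg : Measurable g) {K : ℝ≥0∞}
    (hK : ∀ x, rieszPotential s h x ≤ K) : rieszForm s g h ≤ (∫⁻ x, g x) * K := by
  rw [← lintegral_mul_const _ hg]
  refine lintegral_mono fun x => ?_
  gcongr
  exact hK x

end RieszPotential

section KernelComparison

lemma one_div_rpow_le {α : ℝ} (hα₀ : 0 < α) (hα₁ : α ≤ 1) {r r₀ : ℝ} (hr : 0 ≤ r) (hr₀ : 0 < r₀) :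
    1 / r ^ α ≤ r₀ ^ (1 - α) * (1 / r ^ (1 : ℝ)) + r₀ ^ (-α) := by
  rcases hr.eq_or_lt with rfl | hr
  · rw [Real.zero_rpow hα₀.ne', Real.zero_rpow one_ne_zero, div_zero, mul_zero, zero_add]
    positivity
  rcases le_total r r₀ with h | h
  · calc 1 / r ^ α = r ^ (1 - α) * (1 / r ^ (1 : ℝ)) := by
          rw [Real.rpow_sub hr]
          field_simp
      _ ≤ r₀ ^ (1 - α) * (1 / r ^ (1 : ℝ)) := by
          gcongr
      _ ≤ r₀ ^ (1 - α) * (1 / r ^ (1 : ℝ)) + r₀ ^ (-α) := le_add_of_nonneg_right (by positivity)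
  · calc 1 / r ^ α = r ^ (-α) := by rw [Real.rpow_neg hr.le, one_div]
      _ ≤ r₀ ^ (-α) := Real.rpow_le_rpow_of_nonpos hr₀ h (by linarith)
      _ ≤ r₀ ^ (1 - α) * (1 / r ^ (1 : ℝ)) + r₀ ^ (-α) := le_add_of_nonneg_left (by positivity)

lemma rieszKernel_le {E : Type*} [NormedAddCommGroup E] {α : ℝ} (hα₀ : 0 < α) (hα₁ : α ≤ 1)
    {r₀ : ℝ} (hr₀ : 0 < r₀) (z : E) :
    rieszKernel α z
      ≤ ENNReal.ofReal (r₀ ^ (1 - α)) * rieszKernel 1 z + ENNReal.ofReal (r₀ ^ (-α)) := by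
  rw [rieszKernel, rieszKernel, ← ENNReal.ofReal_mul (by positivity),
    ← ENNReal.ofReal_add (by positivity) (by positivity)]
  exact ENNReal.ofReal_le_ofReal (one_div_rpow_le hα₀ hα₁ (norm_nonneg _) hr₀)

variable {E : Type*} [NormedAddCommGroup E] [InnerProductSpace ℝ E] [FiniteDimensional ℝ E]
  [MeasurableSpace E] [BorelSpace E]

lemma rieszPotential_le {α : ℝ} (hα₀ : 0 < α) (hα₁ : α ≤ 1) {r₀ : ℝ} (hr₀ : 0 < r₀)
    {g : E → ℝ≥0∞} (hg : Measurable g) (x : E) :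
    rieszPotential α g x ≤ ENNReal.ofReal (r₀ ^ (1 - α)) * rieszPotential 1 g x
      + ENNReal.ofReal (r₀ ^ (-α)) * ∫⁻ y, g y := by
  rw [rieszPotential, rieszPotential, ← lintegral_const_mul _ (by fun_prop),
    ← lintegral_const_mul _ hg, ← lintegral_add_left (by fun_prop)]
  refine lintegral_mono fun y => ?_
  rw [← mul_assoc, ← add_mul]
  gcongr
  exact rieszKernel_le hα₀ hα₁ hr₀ _

lemma rieszForm_le {α : ℝ} (hα₀ : 0 < α) (hα₁ : α ≤ 1) {r₀ : ℝ} (hr₀ : 0 < r₀)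
    {g h : E → ℝ≥0∞} (hg : Measurable g) (hh : Measurable h) :
    rieszForm α g h ≤ ENNReal.ofReal (r₀ ^ (1 - α)) * rieszForm 1 g h
      + ENNReal.ofReal (r₀ ^ (-α)) * ((∫⁻ x, g x) * ∫⁻ y, h y) := by
  have hp : Measurable fun x => g x * rieszPotential 1 h x :=
    hg.mul (measurable_rieszPotential 1 hh)
  rw [rieszForm, rieszForm, ← lintegral_mul_const _ hg, ← lintegral_const_mul _ hp,
    ← lintegral_const_mul _ (hg.mul_const _), ← lintegral_add_left (hp.const_mul _)]
  refine lintegral_mono fun x => ?_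
  rw [mul_left_comm, mul_left_comm _ (g x) (∫⁻ y, h y), ← mul_add]
  gcongr
  exact rieszPotential_le hα₀ hα₁ hr₀ hh x

end KernelComparison

section RieszEnergy

variable {E F : Type*} [NormedAddCommGroup E] [InnerProductSpace ℝ E] [FiniteDimensional ℝ E]
  [MeasurableSpace E] [BorelSpace E] [NormedAddCommGroup F]

/-- The Riesz energy `∬ |f(x)|² |f(y)|² / |x - y|^s dx dy`, with values in `[0, ∞]`. -/
def erieszEnergy (s : ℝ) (f : Lp F 2 (volume : Measure E)) : ℝ≥0∞ :=
  rieszForm s (density f) (density f)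

/-- The Riesz energy `∬ |f(x)|² |f(y)|² / |x - y|^s dx dy` as a real number, with the junk value `0`
if it is infinite. -/
def rieszEnergy (s : ℝ) (f : Lp F 2 (volume : Measure E)) : ℝ := (erieszEnergy s f).toReal

lemma measurable_riesz_integrand (s : ℝ) (f : Lp F 2 (volume : Measure E)) :
    Measurable fun p : E × E => 1 / ‖p.1 - p.2‖ ^ s * ‖f p.1‖ ^ 2 * ‖f p.2‖ ^ 2 := by
  have hf : Measurable fun x => ‖f x‖ := (Lp.stronglyMeasurable f).norm.measurable
  have hf_fst : Measurable fun p : E × E => ‖f p.1‖ := hf.comp measurable_fst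
  have hf_snd : Measurable fun p : E × E => ‖f p.2‖ := hf.comp measurable_snd
  fun_prop

lemma lintegral_riesz_integrand (s : ℝ) (f : Lp F 2 (volume : Measure E)) :
    ∫⁻ p : E × E, ENNReal.ofReal (1 / ‖p.1 - p.2‖ ^ s * ‖f p.1‖ ^ 2 * ‖f p.2‖ ^ 2)
      ∂(volume.prod volume) = erieszEnergy s f := by
  have hd := measurable_density f
  have integrand_eq (p : E × E) :
      ENNReal.ofReal (1 / ‖p.1 - p.2‖ ^ s * ‖f p.1‖ ^ 2 * ‖f p.2‖ ^ 2)
        = density f p.1 * (rieszKernel s (p.1 - p.2) * density f p.2) := by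
    rw [ENNReal.ofReal_mul (by positivity), ENNReal.ofReal_mul (by positivity), ofReal_norm_sq,
      ofReal_norm_sq, rieszKernel]
    ring
  have h_meas : Measurable fun p : E × E =>
      density f p.1 * (rieszKernel s (p.1 - p.2) * density f p.2) := by fun_prop
  simp_rw [integrand_eq]
  rw [lintegral_prod _ h_meas.aemeasurable, erieszEnergy]
  congr with x
  have h_inner : Measurable fun y => rieszKernel s (x - y) * density f y := by fun_prop
  exact lintegral_const_mul (density f x) h_inner

lemma integral_riesz_integrand (s : ℝ) (f : Lp F 2 (volume : Measure E)) :
    ∫ p : E × E, 1 / ‖p.1 - p.2‖ ^ s * ‖f p.1‖ ^ 2 * ‖f p.2‖ ^ 2 ∂(volume.prod volume)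
      = rieszEnergy s f := by
  rw [integral_eq_lintegral_of_nonneg_ae (ae_of_all _ fun p => by positivity)
    (measurable_riesz_integrand s f).aestronglyMeasurable, lintegral_riesz_integrand, rieszEnergy]

variable [InnerProductSpace ℂ F] [CompleteSpace F]

lemma exists_rieszPotential_density_le (hd : 2 < finrank ℝ E) :
    ∃ C : ℝ≥0, ∀ s : ℝ, 0 < s → s ≤ 1 → ∀ (f : Lp F 2 (volume : Measure E)) (a : E),
      rieszPotential s (density f) a ≤ C * ekinetic f + ∫⁻ y, density f y := by
  obtain ⟨C, kato⟩ := exists_lintegral_rieszKernel_one_mul_density_le (F := F) hd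
  refine ⟨C, fun s hs₀ hs₁ f a => ?_⟩
  have h := rieszPotential_le hs₀ hs₁ one_pos (measurable_density f) a
  simp only [Real.one_rpow, ENNReal.ofReal_one, one_mul] at h
  exact h.trans (add_le_add_left (kato f a) _)

lemma erieszEnergy_lt_top (hd : 2 < finrank ℝ E) {s : ℝ} (hs₀ : 0 < s) (hs₁ : s ≤ 1)
    {f : Lp F 2 (volume : Measure E)} (hf : ekinetic f < ⊤) : erieszEnergy s f < ⊤ := by
  obtain ⟨C, hC⟩ := exists_rieszPotential_density_le (F := F) hd
  have h_mass := (lintegral_density_ne_top f).lt_top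
  exact (rieszForm_le_of_rieszPotential_le s (measurable_density f) (hC s hs₀ hs₁ f)).trans_lt
    (ENNReal.mul_lt_top h_mass
      (ENNReal.add_lt_top.2 ⟨ENNReal.mul_lt_top ENNReal.coe_lt_top hf, h_mass⟩))

lemma integrable_riesz_integrand (hd : 2 < finrank ℝ E) {s : ℝ} (hs₀ : 0 < s) (hs₁ : s ≤ 1)
    {f : Lp F 2 (volume : Measure E)} (hf : ekinetic f < ⊤) :
    Integrable (fun p : E × E => 1 / ‖p.1 - p.2‖ ^ s * ‖f p.1‖ ^ 2 * ‖f p.2‖ ^ 2)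
      (volume.prod volume) := by
  refine ⟨(measurable_riesz_integrand s f).aestronglyMeasurable, ?_⟩
  rw [hasFiniteIntegral_iff_ofReal (ae_of_all _ fun p => by positivity),
    lintegral_riesz_integrand]
  exact erieszEnergy_lt_top hd hs₀ hs₁ hf

end RieszEnergy

section EnergyTerms

lemma two_lt_finrank_R3 : 2 < finrank ℝ R3 := by
  rw [finrank_euclideanSpace_fin]
  norm_num

lemma newtonEnergy_eq {f : L2} (hf : ekinetic f < ⊤) : newtonEnergy f = rieszEnergy 1 f := by
  rw [← integral_riesz_integrand, integral_prod _
    (integrable_riesz_integrand two_lt_finrank_R3 one_pos le_rfl hf), newtonEnergy]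
  congr with x
  rw [← integral_mul_const]
  congr with y
  rw [Real.rpow_one]
  ring

lemma interaction_eq {α : ℝ} (hα₀ : 0 < α) (hα₁ : α ≤ 1) (β : ℝ) {f : L2} (hf : ekinetic f < ⊤) :
    interaction α β f = 1 / 4 * (β * rieszEnergy α f - rieszEnergy 1 f) := by
  have int_one := integrable_riesz_integrand two_lt_finrank_R3 one_pos le_rfl hf
  have int_α := integrable_riesz_integrand two_lt_finrank_R3 hα₀ hα₁ hf
  have h_fubini := integral_prod _ ((int_α.const_mul β).sub int_one)
  simp only [Pi.sub_apply] at h_fubini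
  rw [← integral_riesz_integrand, ← integral_riesz_integrand, ← integral_const_mul,
    ← integral_sub (int_α.const_mul β) int_one, h_fubini, interaction]
  congr with x
  congr with y
  rw [Real.rpow_one]
  ring

end EnergyTerms

section Mass

lemma mass_eq_norm_sq (f : L2) : mass f = ‖f‖ ^ 2 := integral_norm_sq f

lemma mass_nonneg (f : L2) : 0 ≤ mass f := by
  rw [mass_eq_norm_sq]
  positivity

lemma mass_pos {f : L2} (hf : f ≠ 0) : 0 < mass f := by
  rw [mass_eq_norm_sq]
  exact pow_pos (norm_pos_iff.2 hf) 2

lemma toReal_lintegral_density_eq_mass (f : L2) : (∫⁻ x, density f x).toReal = mass f := by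
  rw [toReal_lintegral_density, mass_eq_norm_sq]

lemma lintegral_density_eq_mass (f : L2) : ∫⁻ x, density f x = ENNReal.ofReal (mass f) := by
  rw [lintegral_density, mass_eq_norm_sq]

lemma mass_fourier (f : L2) : mass (𝓕 f) = mass f := by
  rw [mass_eq_norm_sq, mass_eq_norm_sq, Lp.norm_fourier_eq]

end Mass

section Kinetic

/-- The symbol `√((2π|ξ|)² + m²)` of `√(-Δ + m²)`. -/
def kineticSymbol (m : ℝ) (ξ : R3) : ℝ := √((2 * Real.pi * ‖ξ‖) ^ 2 + m ^ 2)

lemma kineticSymbol_nonneg (m : ℝ) (ξ : R3) : 0 ≤ kineticSymbol m ξ := Real.sqrt_nonneg _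

lemma kineticSymbol_zero (ξ : R3) : kineticSymbol 0 ξ = 2 * Real.pi * ‖ξ‖ := by
  rw [kineticSymbol, zero_pow two_ne_zero, add_zero, Real.sqrt_sq (by positivity)]

lemma kineticSymbol_zero_le (m : ℝ) (ξ : R3) : kineticSymbol 0 ξ ≤ kineticSymbol m ξ := by
  rw [kineticSymbol_zero]
  exact Real.le_sqrt_of_sq_le (le_add_of_nonneg_right (sq_nonneg m))

lemma le_kineticSymbol (m : ℝ) (ξ : R3) : m ≤ kineticSymbol m ξ :=
  Real.le_sqrt_of_sq_le (le_add_of_nonneg_left (sq_nonneg _))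

lemma kineticSymbol_le {m : ℝ} (hm : 0 ≤ m) (ξ : R3) :
    kineticSymbol m ξ ≤ kineticSymbol 0 ξ + m := by
  have h : 0 ≤ 2 * Real.pi * ‖ξ‖ := by positivity
  rw [kineticSymbol_zero, kineticSymbol, Real.sqrt_le_left (by positivity)]
  nlinarith

lemma kineticSymbol_abs (m : ℝ) : kineticSymbol |m| = kineticSymbol m := by
  ext ξ
  rw [kineticSymbol, sq_abs, kineticSymbol]

lemma kineticSymbol_smul {t : ℝ} (ht : 0 < t) (m : ℝ) (ξ : R3) :
    kineticSymbol m (t • ξ) = t * kineticSymbol (m / t) ξ := by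
  have h : (2 * Real.pi * (t * ‖ξ‖)) ^ 2 + m ^ 2
      = t ^ 2 * ((2 * Real.pi * ‖ξ‖) ^ 2 + (m / t) ^ 2) := by field_simp
  rw [kineticSymbol, norm_smul, Real.norm_of_nonneg ht.le, h, Real.sqrt_mul (by positivity),
    Real.sqrt_sq ht.le, kineticSymbol]

@[fun_prop]
lemma continuous_kineticSymbol (m : ℝ) : Continuous (kineticSymbol m) := by
  unfold kineticSymbol
  fun_prop

lemma kinetic_eq (m : ℝ) (f : L2) :
    kinetic m f = ∫ ξ, kineticSymbol m ξ * ‖(𝓕 f : L2) ξ‖ ^ 2 := rfl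

lemma memHHalf_iff_ekinetic_lt_top (f : L2) : MemHHalf f ↔ ekinetic f < ⊤ :=
  memSobolev_half_iff_ekinetic_lt_top f

lemma integrable_norm_mul_fourier {f : L2} (hf : MemHHalf f) :
    Integrable (fun ξ : R3 => ‖ξ‖ * ‖(𝓕 f : L2) ξ‖ ^ 2) volume := by
  refine ⟨continuous_norm.aestronglyMeasurable.mul (integrable_norm_sq (𝓕 f)).1, ?_⟩
  rw [hasFiniteIntegral_iff_ofReal (ae_of_all _ fun ξ => by positivity)]
  simp_rw [ENNReal.ofReal_mul (norm_nonneg _), ofReal_norm_sq, ofReal_norm]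
  exact (memHHalf_iff_ekinetic_lt_top f).1 hf

lemma integrable_kineticSymbol_mul_fourier (m : ℝ) {f : L2} (hf : MemHHalf f) :
    Integrable (fun ξ => kineticSymbol m ξ * ‖(𝓕 f : L2) ξ‖ ^ 2) volume := by
  refine (((integrable_norm_mul_fourier hf).const_mul (2 * Real.pi)).add
    ((integrable_norm_sq (𝓕 f)).const_mul |m|)).mono'
    ((continuous_kineticSymbol m).aestronglyMeasurable.mul (integrable_norm_sq (𝓕 f)).1)
    (ae_of_all _ fun ξ => ?_)
  have h := kineticSymbol_le (abs_nonneg m) ξ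
  rw [kineticSymbol_abs, kineticSymbol_zero] at h
  rw [Real.norm_of_nonneg (mul_nonneg (kineticSymbol_nonneg m ξ) (by positivity)), Pi.add_apply,
    ← mul_assoc, ← add_mul]
  gcongr

lemma kinetic_zero (f : L2) : kinetic 0 f = 2 * Real.pi * (ekinetic f).toReal := by
  have h_meas : Measurable fun ξ : R3 => ‖ξ‖ₑ * density (𝓕 f : L2) ξ :=
    measurable_enorm.mul (measurable_density (𝓕 f))
  rw [kinetic_eq, ekinetic, ← integral_toReal h_meas.aemeasurable
    (ae_of_all _ fun ξ => ENNReal.mul_lt_top enorm_lt_top (ENNReal.pow_lt_top enorm_lt_top)),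
    ← integral_const_mul]
  congr with ξ
  rw [kineticSymbol_zero, ENNReal.toReal_mul, toReal_density, toReal_enorm, mul_assoc]

lemma kinetic_nonneg (m : ℝ) (f : L2) : 0 ≤ kinetic m f :=
  integral_nonneg fun ξ => mul_nonneg (kineticSymbol_nonneg m ξ) (by positivity)

lemma ekinetic_eq {f : L2} (hf : MemHHalf f) :
    ekinetic f = ENNReal.ofReal (kinetic 0 f / (2 * Real.pi)) := by
  rw [kinetic_zero, mul_div_cancel_left₀ _ (by positivity),
    ENNReal.ofReal_toReal ((memHHalf_iff_ekinetic_lt_top f).1 hf).ne]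

lemma kinetic_zero_le (m : ℝ) {f : L2} (hf : MemHHalf f) : kinetic 0 f ≤ kinetic m f := by
  refine integral_mono (integrable_kineticSymbol_mul_fourier 0 hf)
    (integrable_kineticSymbol_mul_fourier m hf) fun ξ => ?_
  exact mul_le_mul_of_nonneg_right (kineticSymbol_zero_le m ξ) (by positivity)

lemma mul_mass_le_kinetic (m : ℝ) {f : L2} (hf : MemHHalf f) : m * mass f ≤ kinetic m f := by
  rw [← mass_fourier, mass, ← integral_const_mul]
  refine integral_mono ((integrable_norm_sq _).const_mul m)
    (integrable_kineticSymbol_mul_fourier m hf) fun ξ => ?_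
  exact mul_le_mul_of_nonneg_right (le_kineticSymbol m ξ) (by positivity)

lemma kinetic_le {m : ℝ} (hm : 0 ≤ m) {f : L2} (hf : MemHHalf f) :
    kinetic m f ≤ kinetic 0 f + m * mass f := by
  have int_zero := integrable_kineticSymbol_mul_fourier 0 hf
  have int_mass := (integrable_norm_sq (𝓕 f : L2)).const_mul m
  rw [← mass_fourier, mass, kinetic_eq, kinetic_eq, ← integral_const_mul,
    ← integral_add int_zero int_mass]
  refine integral_mono (integrable_kineticSymbol_mul_fourier m hf) (int_zero.add int_mass)
    fun ξ => ?_
  rw [← add_mul]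
  exact mul_le_mul_of_nonneg_right (kineticSymbol_le hm ξ) (by positivity)

lemma kinetic_congr {m : ℝ} {f g : L2} (h : density (𝓕 f) =ᵐ[volume] density (𝓕 g)) :
    kinetic m f = kinetic m g := by
  refine integral_congr_ae ?_
  filter_upwards [h] with ξ hξ
  rw [← toReal_density, ← toReal_density, hξ]

end Kinetic

section RieszBounds

lemma rieszEnergy_nonneg (s : ℝ) (f : L2) : 0 ≤ rieszEnergy s f := ENNReal.toReal_nonneg

lemma erieszEnergy_ne_top {s : ℝ} (hs₀ : 0 < s) (hs₁ : s ≤ 1) {f : L2} (hf : MemHHalf f) :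
    erieszEnergy s f ≠ ⊤ :=
  (erieszEnergy_lt_top two_lt_finrank_R3 hs₀ hs₁ ((memHHalf_iff_ekinetic_lt_top f).1 hf)).ne

lemma exists_rieszEnergy_one_le :
    ∃ C : ℝ, 0 < C ∧ ∀ f : L2, MemHHalf f → rieszEnergy 1 f ≤ C * kinetic 0 f * mass f := by
  obtain ⟨C, kato⟩ := exists_lintegral_rieszKernel_one_mul_density_le (F := ℂ) two_lt_finrank_R3
  refine ⟨(C + 1) / (2 * Real.pi), by positivity, fun f hf => ?_⟩
  have h_energy : erieszEnergy 1 f ≤ (∫⁻ x, density f x) * (C * ekinetic f) :=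
    rieszForm_le_of_rieszPotential_le 1 (measurable_density f) (kato f)
  have h_finite : (∫⁻ x, density f x) * (C * ekinetic f) ≠ ⊤ :=
    ENNReal.mul_ne_top (lintegral_density_ne_top f)
      (ENNReal.mul_ne_top ENNReal.coe_ne_top ((memHHalf_iff_ekinetic_lt_top f).1 hf).ne)
  calc rieszEnergy 1 f ≤ mass f * (C * (ekinetic f).toReal) := by
        have h := ENNReal.toReal_mono h_finite h_energy
        rwa [ENNReal.toReal_mul, ENNReal.toReal_mul, ENNReal.coe_toReal,
          toReal_lintegral_density_eq_mass] at h
    _ ≤ mass f * ((C + 1) * (ekinetic f).toReal) := by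
        gcongr
        · exact mass_nonneg f
        · linarith
    _ = (C + 1) / (2 * Real.pi) * kinetic 0 f * mass f := by
        rw [kinetic_zero]
        field_simp

lemma rieszEnergy_le {α : ℝ} (hα₀ : 0 < α) (hα₁ : α ≤ 1) {r₀ : ℝ} (hr₀ : 0 < r₀) {f : L2}
    (hf : MemHHalf f) :
    rieszEnergy α f ≤ r₀ ^ (1 - α) * rieszEnergy 1 f + r₀ ^ (-α) * mass f ^ 2 := by
  have h_energy : erieszEnergy α f ≤ ENNReal.ofReal (r₀ ^ (1 - α)) * erieszEnergy 1 f
      + ENNReal.ofReal (r₀ ^ (-α)) * ((∫⁻ x, density f x) * ∫⁻ y, density f y) :=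
    rieszForm_le hα₀ hα₁ hr₀ (measurable_density f) (measurable_density f)
  have riesz_ne_top : ENNReal.ofReal (r₀ ^ (1 - α)) * erieszEnergy 1 f ≠ ⊤ :=
    ENNReal.mul_ne_top ENNReal.ofReal_ne_top (erieszEnergy_ne_top one_pos le_rfl hf)
  have mass_ne_top :
      ENNReal.ofReal (r₀ ^ (-α)) * ((∫⁻ x, density f x) * ∫⁻ y, density f y) ≠ ⊤ :=
    ENNReal.mul_ne_top ENNReal.ofReal_ne_top
      (ENNReal.mul_ne_top (lintegral_density_ne_top f) (lintegral_density_ne_top f))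
  have h := ENNReal.toReal_mono (ENNReal.add_ne_top.2 ⟨riesz_ne_top, mass_ne_top⟩) h_energy
  rwa [ENNReal.toReal_add riesz_ne_top mass_ne_top, ENNReal.toReal_mul, ENNReal.toReal_mul,
    ENNReal.toReal_mul, ENNReal.toReal_ofReal (by positivity), ENNReal.toReal_ofReal
    (by positivity), toReal_lintegral_density_eq_mass, ← sq] at h

lemma exists_rieszEnergy_le {α : ℝ} (hα₀ : 0 < α) (hα₁ : α < 1) {κ : ℝ} (hκ : 0 < κ) :
    ∃ C : ℝ, 0 < C ∧
      ∀ f : L2, MemHHalf f → rieszEnergy α f ≤ κ * rieszEnergy 1 f + C * mass f ^ 2 := by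
  refine ⟨(κ ^ (1 - α)⁻¹) ^ (-α), by positivity, fun f hf => ?_⟩
  have h := rieszEnergy_le hα₀ hα₁.le (Real.rpow_pos_of_pos hκ (1 - α)⁻¹) hf
  rwa [Real.rpow_inv_rpow hκ.le (sub_pos.2 hα₁).ne'] at h

end RieszBounds

section Transformations

variable {E F : Type*} [NormedAddCommGroup E] [InnerProductSpace ℝ E] [FiniteDimensional ℝ E]
  [MeasurableSpace E] [BorelSpace E] [NormedAddCommGroup F]

lemma rieszForm_comp_add_right (s : ℝ) (g h : E → ℝ≥0∞) (a : E) :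
    rieszForm s (fun x => g (x + a)) (fun x => h (x + a)) = rieszForm s g h := by
  have potential_comp (x : E) :
      rieszPotential s (fun y => h (y + a)) x = rieszPotential s h (x + a) := by
    rw [rieszPotential, rieszPotential,
      ← lintegral_add_right_eq_self (fun y => rieszKernel s (x + a - y) * h y) a]
    simp only [add_sub_add_right_eq_sub]
  simp_rw [rieszForm, potential_comp]
  exact lintegral_add_right_eq_self (fun x => g x * rieszPotential s h x) a

lemma rieszEnergy_translate (s : ℝ) (a : E) (f : Lp F 2 (volume : Measure E)) :
    rieszEnergy s (translate a f) = rieszEnergy s f := by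
  rw [rieszEnergy, erieszEnergy, rieszForm_congr s (density_translate a f) (density_translate a f),
    rieszForm_comp_add_right, rieszEnergy, erieszEnergy]

lemma rieszPotential_comp_smul (s : ℝ) {h : E → ℝ≥0∞} (hh : Measurable h) {t : ℝ} (ht : 0 < t)
    (x : E) :
    rieszPotential s (fun y => h (t • y)) x
      = ENNReal.ofReal (t ^ s * (t ^ finrank ℝ E)⁻¹) * rieszPotential s h (t • x) := by
  have kernel_eq (y : E) :
      rieszKernel s (x - y) = ENNReal.ofReal (t ^ s) * rieszKernel s (t • x - t • y) := by
    rw [← smul_sub, rieszKernel_smul s ht, ← mul_assoc, ← ENNReal.ofReal_mul (by positivity),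
      ← Real.rpow_add ht, add_neg_cancel, Real.rpow_zero, ENNReal.ofReal_one, one_mul]
  simp_rw [rieszPotential, kernel_eq, mul_assoc]
  rw [lintegral_const_mul' _ _ ENNReal.ofReal_ne_top,
    lintegral_comp_smul (g := fun y => rieszKernel s (t • x - y) * h y) (by fun_prop) ht,
    ← mul_assoc, ← ENNReal.ofReal_mul (by positivity)]

lemma rieszForm_comp_smul (s : ℝ) {g h : E → ℝ≥0∞} (hg : Measurable g) (hh : Measurable h) {t : ℝ}
    (ht : 0 < t) :
    rieszForm s (fun x => g (t • x)) (fun x => h (t • x))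
      = ENNReal.ofReal (t ^ s * (t ^ finrank ℝ E)⁻¹ * (t ^ finrank ℝ E)⁻¹) * rieszForm s g h := by
  simp_rw [rieszForm, rieszPotential_comp_smul s hh ht, mul_left_comm (g _)]
  rw [lintegral_const_mul' _ _ ENNReal.ofReal_ne_top,
    lintegral_comp_smul (g := fun x => g x * rieszPotential s h x)
      (hg.mul (measurable_rieszPotential s hh)) ht, ← mul_assoc,
    ← ENNReal.ofReal_mul (by positivity)]

variable [InnerProductSpace ℂ F]

lemma density_smul {X : Type*} [MeasurableSpace X] {μ : Measure X} (c : ℝ) (f : Lp F 2 μ) :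
    density ((c : ℂ) • f) =ᵐ[μ] fun x => ENNReal.ofReal (c ^ 2) * density f x := by
  filter_upwards [Lp.coeFn_smul (c : ℂ) f] with x hx
  rw [← ofReal_norm_sq, hx, Pi.smul_apply, norm_smul, mul_pow, ENNReal.ofReal_mul (by positivity),
    ofReal_norm_sq, Complex.norm_real, Real.norm_eq_abs, sq_abs]

lemma rieszEnergy_smul (s c : ℝ) (f : Lp F 2 (volume : Measure E)) :
    rieszEnergy s ((c : ℂ) • f) = c ^ 4 * rieszEnergy s f := by
  rw [rieszEnergy, erieszEnergy, rieszForm_congr s (density_smul c f) (density_smul c f),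
    rieszForm_const_mul_left s ENNReal.ofReal_ne_top,
    rieszForm_const_mul_right s ENNReal.ofReal_ne_top, ENNReal.toReal_mul, ENNReal.toReal_mul,
    ENNReal.toReal_ofReal (by positivity), rieszEnergy, erieszEnergy]
  ring

lemma rieszEnergy_dilate (s : ℝ) {t : ℝ} (ht : 0 < t) (f : Lp F 2 (volume : Measure E)) :
    rieszEnergy s (dilate ht f) = t ^ s * rieszEnergy s f := by
  have hm := measurable_density f
  rw [rieszEnergy, erieszEnergy, rieszForm_congr s (density_dilate ht f) (density_dilate ht f),
    rieszForm_const_mul_left s ENNReal.ofReal_ne_top,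
    rieszForm_const_mul_right s ENNReal.ofReal_ne_top, rieszForm_comp_smul s hm hm ht,
    ENNReal.toReal_mul, ENNReal.toReal_mul, ENNReal.toReal_mul,
    ENNReal.toReal_ofReal (by positivity), ENNReal.toReal_ofReal (by positivity),
    rieszEnergy, erieszEnergy]
  field_simp

variable [CompleteSpace F]

lemma ekinetic_congr {f g : Lp F 2 (volume : Measure E)}
    (h : density (𝓕 f) =ᵐ[volume] density (𝓕 g)) : ekinetic f = ekinetic g := by
  refine lintegral_congr_ae ?_
  filter_upwards [h] with ξ hξ
  rw [hξ]

lemma ekinetic_dilate {t : ℝ} (ht : 0 < t) (f : Lp F 2 (volume : Measure E)) :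
    ekinetic (dilate ht f) = ENNReal.ofReal t * ekinetic f := by
  have ht_inv : 0 < t⁻¹ := inv_pos.2 ht
  have enorm_eq (ξ : E) : ‖ξ‖ₑ = ENNReal.ofReal t * ‖t⁻¹ • ξ‖ₑ := by
    rw [← ofReal_norm, ← ofReal_norm, ← ENNReal.ofReal_mul ht.le, norm_smul,
      Real.norm_of_nonneg ht_inv.le, mul_inv_cancel_left₀ ht.ne']
  have hm : Measurable fun η : E => ‖η‖ₑ * density (𝓕 f) η :=
    measurable_enorm.mul (measurable_density _)
  calc ekinetic (dilate ht f)
      = ∫⁻ ξ, ENNReal.ofReal (t * t⁻¹ ^ finrank ℝ E)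
          * (‖t⁻¹ • ξ‖ₑ * density (𝓕 f) (t⁻¹ • ξ)) := by
        refine lintegral_congr_ae ?_
        filter_upwards [density_fourier_dilate ht f] with ξ hξ
        rw [hξ, enorm_eq, ENNReal.ofReal_mul ht.le]
        ring
    _ = ENNReal.ofReal t * ekinetic f := by
        rw [lintegral_const_mul' _ _ ENNReal.ofReal_ne_top, lintegral_comp_smul hm ht_inv,
          ← mul_assoc, ← ENNReal.ofReal_mul (by positivity), mul_assoc,
          mul_inv_cancel₀ (by positivity), mul_one, ekinetic]

lemma MemHHalf.smul (c : ℂ) {f : L2} (hf : MemHHalf f) : MemHHalf (c • f) := by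
  have h := TemperedDistribution.MemSobolev.smul c hf
  rw [MemHHalf, ← Lp.toTemperedDistributionCLM_apply] at *
  rwa [map_smul]

lemma MemHHalf.translate (a : R3) {f : L2} (hf : MemHHalf f) :
    MemHHalf (BosonStar.translate a f) := by
  rw [memHHalf_iff_ekinetic_lt_top] at *
  rwa [ekinetic_congr (density_fourier_translate a f)]

lemma MemHHalf.dilate {t : ℝ} (ht : 0 < t) {f : L2} (hf : MemHHalf f) :
    MemHHalf (BosonStar.dilate ht f) := by
  rw [memHHalf_iff_ekinetic_lt_top] at *
  rw [ekinetic_dilate]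
  exact ENNReal.mul_lt_top ENNReal.ofReal_lt_top hf

lemma mass_smul (c : ℝ) (f : L2) : mass ((c : ℂ) • f) = c ^ 2 * mass f := by
  rw [mass_eq_norm_sq, mass_eq_norm_sq, norm_smul, mul_pow, Complex.norm_real, Real.norm_eq_abs,
    sq_abs]

lemma mass_translate (a : R3) (f : L2) : mass (translate a f) = mass f := by
  rw [mass_eq_norm_sq, mass_eq_norm_sq, norm_translate]

lemma mass_dilate {t : ℝ} (ht : 0 < t) (f : L2) : mass (dilate ht f) = mass f := by
  rw [mass_eq_norm_sq, mass_eq_norm_sq, norm_dilate]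

lemma kinetic_smul (m c : ℝ) (f : L2) : kinetic m ((c : ℂ) • f) = c ^ 2 * kinetic m f := by
  rw [kinetic_eq, kinetic_eq, FourierTransform.fourier_smul, ← integral_const_mul]
  refine integral_congr_ae ?_
  filter_upwards [density_smul c (𝓕 f : L2)] with ξ hξ
  rw [← toReal_density, hξ, ENNReal.toReal_mul, toReal_density,
    ENNReal.toReal_ofReal (by positivity)]
  ring

lemma kinetic_translate (m : ℝ) (a : R3) (f : L2) : kinetic m (translate a f) = kinetic m f :=
  kinetic_congr (density_fourier_translate a f)

lemma kinetic_dilate (m : ℝ) {t : ℝ} (ht : 0 < t) (f : L2) :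
    kinetic m (dilate ht f) = t * kinetic (m / t) f := by
  have h_subst := Measure.integral_comp_smul (volume : Measure R3)
    (fun η => kineticSymbol (m / t) η * ‖(𝓕 f : L2) η‖ ^ 2) t⁻¹
  rw [abs_of_pos (by positivity), inv_pow, inv_inv, smul_eq_mul] at h_subst
  calc kinetic m (dilate ht f)
      = ∫ ξ, t⁻¹ ^ finrank ℝ R3 * t
          * (kineticSymbol (m / t) (t⁻¹ • ξ) * ‖(𝓕 f : L2) (t⁻¹ • ξ)‖ ^ 2) := by
        refine integral_congr_ae ?_
        filter_upwards [density_fourier_dilate ht f] with ξ hξ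
        rw [← toReal_density, hξ, ENNReal.toReal_mul, toReal_density,
          ENNReal.toReal_ofReal (by positivity), mul_assoc _ t, ← mul_assoc t,
          ← kineticSymbol_smul ht, smul_inv_smul₀ ht.ne', kineticSymbol]
        ring
    _ = t * kinetic (m / t) f := by
        rw [integral_const_mul, h_subst, kinetic_eq, inv_pow]
        field_simp

end Transformations

section Positivity

variable {E : Type*} [NormedAddCommGroup E] [InnerProductSpace ℝ E] [FiniteDimensional ℝ E]
  [MeasurableSpace E] [BorelSpace E]

lemma rieszPotential_ne_zero [Nontrivial E] (s : ℝ) {h : E → ℝ≥0∞} (hh : Measurable h)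
    (hh₀ : ∫⁻ y, h y ≠ 0) (x : E) : rieszPotential s h x ≠ 0 := by
  contrapose! hh₀
  rw [rieszPotential, lintegral_eq_zero_iff (by fun_prop)] at hh₀
  rw [lintegral_eq_zero_iff hh]
  filter_upwards [hh₀, Measure.ae_ne volume x] with y hy hyx
  have kernel_ne_zero : rieszKernel s (x - y) ≠ 0 := by
    have : 0 < ‖x - y‖ := norm_pos_iff.2 (sub_ne_zero.2 hyx.symm)
    exact (ENNReal.ofReal_pos.2 (by positivity)).ne'
  exact (mul_eq_zero.1 hy).resolve_left kernel_ne_zero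

lemma rieszForm_ne_zero [Nontrivial E] (s : ℝ) {g h : E → ℝ≥0∞} (hg : Measurable g)
    (hh : Measurable h) (hg₀ : ∫⁻ x, g x ≠ 0) (hh₀ : ∫⁻ y, h y ≠ 0) : rieszForm s g h ≠ 0 := by
  contrapose! hg₀
  have h_meas : Measurable fun x => g x * rieszPotential s h x :=
    hg.mul (measurable_rieszPotential s hh)
  rw [rieszForm, lintegral_eq_zero_iff h_meas] at hg₀
  rw [lintegral_eq_zero_iff hg]
  filter_upwards [hg₀] with x hx
  exact (mul_eq_zero.1 hx).resolve_right (rieszPotential_ne_zero s hh hh₀ x)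

lemma rieszEnergy_pos {s : ℝ} (hs₀ : 0 < s) (hs₁ : s ≤ 1) {f : L2} (hf : MemHHalf f)
    (hf₀ : f ≠ 0) : 0 < rieszEnergy s f := by
  have h_mass : ∫⁻ x, density f x ≠ 0 := by
    rw [lintegral_density_eq_mass]
    exact (ENNReal.ofReal_pos.2 (mass_pos hf₀)).ne'
  have hd := measurable_density f
  exact ENNReal.toReal_pos (rieszForm_ne_zero s hd hd h_mass h_mass)
    (erieszEnergy_ne_top hs₀ hs₁ hf)

end Positivity

section CriticalMass

lemma exists_memHHalf_ne_zero : ∃ f : L2, MemHHalf f ∧ f ≠ 0 := by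
  set B : Set R3 := ball 0 1
  have hB : MeasurableSet B := measurableSet_ball
  set g : L2 := indicatorConstLp 2 hB measure_ball_lt_top.ne (1 : ℂ)
  have hg : g =ᵐ[volume] B.indicator fun _ => (1 : ℂ) := indicatorConstLp_coeFn
  have hg₀ : g ≠ 0 := by
    rw [← norm_pos_iff, norm_indicatorConstLp two_ne_zero ENNReal.ofNat_ne_top, norm_one, one_mul]
    have : 0 < volume.real B :=
      ENNReal.toReal_pos (measure_ball_pos _ _ one_pos).ne' measure_ball_lt_top.ne
    positivity
  refine ⟨𝓕⁻ g, ?_, (Lp.fourierTransformₗᵢ R3 ℂ).symm.map_eq_zero_iff.not.2 hg₀⟩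
  rw [memHHalf_iff_ekinetic_lt_top, ekinetic, FourierTransform.fourier_fourierInv_eq]
  calc ∫⁻ ξ, ‖ξ‖ₑ * density g ξ ≤ ∫⁻ ξ, B.indicator 1 ξ := by
        refine lintegral_mono_ae ?_
        filter_upwards [hg] with ξ hξ
        rw [density, hξ]
        by_cases h : ξ ∈ B
        · have h_norm : ‖ξ‖ₑ ≤ 1 := by
            rw [← ofReal_norm]
            exact ENNReal.ofReal_le_one.2 (mem_ball_zero_iff.1 h).le
          simpa [h] using h_norm
        · simp [h]
    _ = volume B := lintegral_indicator_one hB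
    _ < ⊤ := measure_ball_lt_top

instance : Nonempty {ψ : L2 // MemHHalf ψ ∧ ψ ≠ 0} :=
  let ⟨f, hf⟩ := exists_memHHalf_ne_zero
  ⟨f, hf⟩

lemma criticalMass_eq : criticalMass = 2 * ⨅ ψ : {ψ : L2 // MemHHalf ψ ∧ ψ ≠ 0},
    kinetic 0 ψ.1 * mass ψ.1 / rieszEnergy 1 ψ.1 := by
  rw [criticalMass]
  congr 2 with ψ
  rw [newtonEnergy_eq ((memHHalf_iff_ekinetic_lt_top _).1 ψ.2.1)]

lemma criticalMass_pos : 0 < criticalMass := by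
  obtain ⟨C, hC, hardy⟩ := exists_rieszEnergy_one_le
  rw [criticalMass_eq]
  refine mul_pos two_pos ((inv_pos.2 hC).trans_le (le_ciInf fun ⟨ψ, hψ, hψ₀⟩ => ?_))
  rw [le_div_iff₀ (rieszEnergy_pos one_pos le_rfl hψ hψ₀), inv_mul_le_iff₀ hC, ← mul_assoc]
  exact hardy ψ hψ

lemma criticalMass_mul_rieszEnergy_le {f : L2} (hf : MemHHalf f) :
    criticalMass * rieszEnergy 1 f ≤ 2 * (kinetic 0 f * mass f) := by
  rcases eq_or_ne f 0 with rfl | hf₀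
  · obtain ⟨C, -, hardy⟩ := exists_rieszEnergy_one_le
    have h_mass : mass (0 : L2) = 0 := by simp [mass_eq_norm_sq]
    have h_riesz : rieszEnergy 1 (0 : L2) ≤ 0 := by simpa only [h_mass, mul_zero] using hardy 0 hf
    rw [h_mass, h_riesz.antisymm (rieszEnergy_nonneg 1 0), mul_zero, mul_zero, mul_zero]
  · have h_bdd : BddBelow (Set.range fun ψ : {ψ : L2 // MemHHalf ψ ∧ ψ ≠ 0} =>
        kinetic 0 ψ.1 * mass ψ.1 / rieszEnergy 1 ψ.1) := by
      refine ⟨0, ?_⟩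
      rintro _ ⟨ψ, rfl⟩
      exact div_nonneg (mul_nonneg (kinetic_nonneg _ _) (mass_nonneg _)) (rieszEnergy_nonneg _ _)
    have h := ciInf_le h_bdd ⟨f, hf, hf₀⟩
    rw [le_div_iff₀ (rieszEnergy_pos one_pos le_rfl hf hf₀)] at h
    rw [criticalMass_eq, mul_assoc]
    exact mul_le_mul_of_nonneg_left h two_pos.le

lemma exists_smul_mass_eq {f : L2} (hf₀ : f ≠ 0) {N : ℝ} (hN : 0 ≤ N) :
    ∃ c : ℝ, c ^ 2 * mass f = N ∧ mass ((c : ℂ) • f) = N := by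
  have hm := mass_pos hf₀
  have hc : √(N / mass f) ^ 2 * mass f = N := by
    rw [Real.sq_sqrt (by positivity), div_mul_cancel₀ _ hm.ne']
  exact ⟨√(N / mass f), hc, by rw [mass_smul, hc]⟩

lemma exists_two_mul_kinetic_lt_of_criticalMass_lt {N : ℝ} (hN : criticalMass < N) :
    ∃ φ : L2, MemHHalf φ ∧ mass φ = N ∧ 2 * kinetic 0 φ < rieszEnergy 1 φ := by
  have hN₀ : 0 < N := criticalMass_pos.trans hN
  rw [criticalMass_eq, ← lt_div_iff₀' two_pos] at hN
  obtain ⟨⟨ψ, hψ, hψ₀⟩, h_quot⟩ := exists_lt_of_ciInf_lt hN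
  rw [div_lt_iff₀ (rieszEnergy_pos one_pos le_rfl hψ hψ₀)] at h_quot
  obtain ⟨c, hc, h_mass⟩ := exists_smul_mass_eq hψ₀ hN₀.le
  have h_mass_pos := mass_pos hψ₀
  have hc_sq : 0 < c ^ 2 := pos_of_mul_pos_left (hc ▸ hN₀) h_mass_pos.le
  refine ⟨(c : ℂ) • ψ, hψ.smul c, h_mass, ?_⟩
  rw [kinetic_smul, rieszEnergy_smul]
  have h_ratio : 2 * kinetic 0 ψ < c ^ 2 * rieszEnergy 1 ψ := by
    refine lt_of_mul_lt_mul_right ?_ h_mass_pos.le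
    calc 2 * kinetic 0 ψ * mass ψ < N * rieszEnergy 1 ψ := by linarith
      _ = c ^ 2 * rieszEnergy 1 ψ * mass ψ := by rw [← hc]; ring
  calc 2 * (c ^ 2 * kinetic 0 ψ) = c ^ 2 * (2 * kinetic 0 ψ) := by ring
    _ < c ^ 2 * (c ^ 2 * rieszEnergy 1 ψ) := by gcongr
    _ = c ^ 4 * rieszEnergy 1 ψ := by ring

end CriticalMass

section Supercritical

variable {m α β : ℝ}

lemma energy_eq (hα₀ : 0 < α) (hα₁ : α ≤ 1) (m β : ℝ) {f : L2} (hf : MemHHalf f) :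
    energy m α β f
      = 1 / 2 * kinetic m f + 1 / 4 * (β * rieszEnergy α f - rieszEnergy 1 f) := by
  rw [energy, interaction_eq hα₀ hα₁ β ((memHHalf_iff_ekinetic_lt_top f).1 hf)]

lemma energy_dilate (hα₀ : 0 < α) (hα₁ : α ≤ 1) (m β : ℝ) {f : L2} (hf : MemHHalf f) {t : ℝ}
    (ht : 0 < t) :
    energy m α β (dilate ht f) = 1 / 2 * (t * kinetic (m / t) f)
      + 1 / 4 * (β * (t ^ α * rieszEnergy α f) - t * rieszEnergy 1 f) := by
  rw [energy_eq hα₀ hα₁ m β (hf.dilate ht), kinetic_dilate, rieszEnergy_dilate, rieszEnergy_dilate,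
    Real.rpow_one]

lemma energy_dilate_le (hm : 0 ≤ m) (hα₀ : 0 < α) (hα₁ : α ≤ 1) (β : ℝ) {f : L2}
    (hf : MemHHalf f) {t : ℝ} (ht : 0 < t) :
    energy m α β (dilate ht f)
      ≤ β / 4 * rieszEnergy α f * t ^ α - (rieszEnergy 1 f - 2 * kinetic 0 f) / 4 * t
        + m / 2 * mass f := by
  have h_kinetic : t * kinetic (m / t) f ≤ t * kinetic 0 f + m * mass f := by
    calc t * kinetic (m / t) f ≤ t * (kinetic 0 f + m / t * mass f) := by
          gcongr
          exact kinetic_le (by positivity) hf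
      _ = t * kinetic 0 f + m * mass f := by field_simp
  rw [energy_dilate hα₀ hα₁ m β hf ht]
  linarith

lemma tendsto_const_mul_rpow_sub_atBot (hα₁ : α < 1) (C : ℝ) {γ : ℝ} (hγ : 0 < γ) :
    Tendsto (fun t : ℝ => C * t ^ α - γ * t) atTop atBot := by
  have h_lim : Tendsto (fun t : ℝ => C * t ^ (-(1 - α)) - γ) atTop (𝓝 (-γ)) := by
    have h := ((tendsto_rpow_neg_atTop (sub_pos.2 hα₁)).const_mul C).sub_const γ
    rwa [mul_zero, zero_sub] at h
  refine (tendsto_id.atTop_mul_neg (neg_lt_zero.2 hγ) h_lim).congr' ?_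
  filter_upwards [eventually_gt_atTop 0] with t ht
  have h_pow : t * t ^ (-(1 - α)) = t ^ α := by
    rw [Real.rpow_neg ht.le, Real.rpow_sub ht, Real.rpow_one, inv_div]
    field_simp
  rw [id, ← h_pow]
  ring

lemma exists_energy_lt_of_criticalMass_lt (hm : 0 ≤ m) (hα₀ : 0 < α) (hα₁ : α < 1) (β : ℝ) {N : ℝ}
    (hN : criticalMass < N) (b : ℝ) : ∃ φ : L2, MemHHalf φ ∧ mass φ = N ∧ energy m α β φ < b := by
  obtain ⟨φ, hφ, h_mass, h_neg⟩ := exists_two_mul_kinetic_lt_of_criticalMass_lt hN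
  have h_lim := tendsto_atBot_add_const_right _ (m / 2 * mass φ)
    (tendsto_const_mul_rpow_sub_atBot hα₁ (β / 4 * rieszEnergy α φ)
      (γ := (rieszEnergy 1 φ - 2 * kinetic 0 φ) / 4) (by linarith))
  obtain ⟨t, ht, htb⟩ := ((eventually_gt_atTop 0).and (h_lim.eventually_lt_atBot b)).exists
  exact ⟨dilate ht φ, hφ.dilate ht, by rw [mass_dilate, h_mass],
    (energy_dilate_le hm hα₀ hα₁.le β hφ ht).trans_lt htb⟩

lemma groundEnergy_le {N : ℝ} {φ : L2} (hφ : MemHHalf φ) (h_mass : mass φ = N) :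
    groundEnergy m α β N ≤ energy m α β φ :=
  iInf_le (fun φ : {φ : L2 // MemHHalf φ ∧ mass φ = N} => (energy m α β φ.1 : EReal))
    ⟨φ, hφ, h_mass⟩

theorem groundEnergy_eq_bot (hm : 0 ≤ m) (hα₀ : 0 < α) (hα₁ : α < 1) (β : ℝ) {N : ℝ}
    (hN : criticalMass < N) : groundEnergy m α β N = ⊥ := by
  rw [EReal.eq_bot_iff_forall_lt]
  intro b
  obtain ⟨φ, hφ, h_mass, hb⟩ := exists_energy_lt_of_criticalMass_lt hm hα₀ hα₁ β hN b
  exact (groundEnergy_le hφ h_mass).trans_lt (EReal.coe_lt_coe_iff.2 hb)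

lemma not_isMinimizer_of_criticalMass_lt (hm : 0 ≤ m) (hα₀ : 0 < α) (hα₁ : α < 1) (β : ℝ) {N : ℝ}
    (hN : criticalMass < N) (φ : L2) : ¬ IsMinimizer m α β N φ := fun ⟨_, _, h_eq⟩ =>
  EReal.coe_ne_bot _ (h_eq.trans (groundEnergy_eq_bot hm hα₀ hα₁ β hN))

end Supercritical

section Coercivity

variable {m α β N : ℝ}

lemma rieszEnergy_one_le_of_mass_le {f : L2} (hf : MemHHalf f) (hfN : mass f ≤ N) :
    rieszEnergy 1 f ≤ N / criticalMass * (2 * kinetic 0 f) := by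
  have hc := criticalMass_pos
  rw [div_mul_eq_mul_div, le_div_iff₀' hc]
  calc criticalMass * rieszEnergy 1 f ≤ 2 * (kinetic 0 f * mass f) :=
        criticalMass_mul_rieszEnergy_le hf
    _ ≤ 2 * (kinetic 0 f * N) := by
        have := kinetic_nonneg 0 f
        gcongr
    _ = N * (2 * kinetic 0 f) := by ring

lemma exists_const_mul_kinetic_sub_le_energy (hα₀ : 0 < α) (hα₁ : α < 1) (β : ℝ) (hN₀ : 0 ≤ N)
    (hN : N < criticalMass) :
    ∃ c K : ℝ, 0 < c ∧ ∀ φ : L2, MemHHalf φ → mass φ ≤ N →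
      c * kinetic 0 φ - K ≤ energy m α β φ := by
  have hc := criticalMass_pos
  set q := N / criticalMass
  have : 0 ≤ q := by positivity
  have hq₁ : 0 < 1 - q := sub_pos.2 ((div_lt_one hc).2 hN)
  obtain ⟨C, hC, h_short⟩ :=
    exists_rieszEnergy_le hα₀ hα₁ (κ := (1 - q) / (2 * (|β| + 1))) (by positivity)
  refine ⟨(1 - q) / 4, 1 / 4 * (|β| * (C * N ^ 2)), by positivity, fun φ hφ hφN => ?_⟩
  have hT := kinetic_nonneg 0 φ
  have hM := mass_nonneg φ
  have hR := rieszEnergy_nonneg 1 φ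
  have h_weight : |β| * ((1 - q) / (2 * (|β| + 1))) ≤ (1 - q) / 2 := by
    rw [← mul_div_assoc, div_le_div_iff₀ (by positivity) two_pos]
    nlinarith [abs_nonneg β]
  have h_power : |β| * rieszEnergy α φ ≤ (1 - q) / 2 * rieszEnergy 1 φ + |β| * (C * N ^ 2) := by
    calc |β| * rieszEnergy α φ
        ≤ |β| * ((1 - q) / (2 * (|β| + 1)) * rieszEnergy 1 φ + C * mass φ ^ 2) := by
          gcongr
          exact h_short φ hφ
      _ = |β| * ((1 - q) / (2 * (|β| + 1))) * rieszEnergy 1 φ + |β| * (C * mass φ ^ 2) := by ring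
      _ ≤ (1 - q) / 2 * rieszEnergy 1 φ + |β| * (C * N ^ 2) := by gcongr
  have h_newton : (1 + (1 - q) / 2) * rieszEnergy 1 φ ≤ (1 + q) * kinetic 0 φ := by
    calc (1 + (1 - q) / 2) * rieszEnergy 1 φ ≤ (1 + (1 - q) / 2) * (q * (2 * kinetic 0 φ)) := by
          gcongr
          exact rieszEnergy_one_le_of_mass_le hφ hφN
      _ ≤ (1 + q) * kinetic 0 φ := by nlinarith [mul_nonneg (sq_nonneg (1 - q)) hT]
  have h_sign : -(|β| * rieszEnergy α φ) ≤ β * rieszEnergy α φ := by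
    rw [← neg_mul]
    exact mul_le_mul_of_nonneg_right (neg_abs_le β) (rieszEnergy_nonneg α φ)
  rw [energy_eq hα₀ hα₁.le m β hφ]
  linarith [kinetic_zero_le m hφ]

end Coercivity

section InfEnergy

variable {m α β N : ℝ}

/-- The infimum `E(β, N)` of the energy as a real number. It agrees with `groundEnergy` when the
energy is bounded from below, and is the junk value `0` otherwise. -/
def infEnergy (m α β N : ℝ) : ℝ :=
  ⨅ φ : {φ : L2 // MemHHalf φ ∧ mass φ = N}, energy m α β φ.1

lemma nonempty_mass_eq (hN : 0 ≤ N) : Nonempty {φ : L2 // MemHHalf φ ∧ mass φ = N} := by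
  obtain ⟨f, hf, hf₀⟩ := exists_memHHalf_ne_zero
  obtain ⟨c, -, hc⟩ := exists_smul_mass_eq hf₀ hN
  exact ⟨(c : ℂ) • f, hf.smul c, hc⟩

lemma bddBelow_energy (hα₀ : 0 < α) (hα₁ : α < 1) (hN₀ : 0 ≤ N) (hN : N < criticalMass) :
    BddBelow (Set.range fun φ : {φ : L2 // MemHHalf φ ∧ mass φ = N} => energy m α β φ.1) := by
  obtain ⟨c, K, hc, coercive⟩ :=
    exists_const_mul_kinetic_sub_le_energy (m := m) hα₀ hα₁ β hN₀ hN
  refine ⟨-K, ?_⟩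
  rintro _ ⟨⟨φ, hφ, hφN⟩, rfl⟩
  have h_kinetic := mul_nonneg hc.le (kinetic_nonneg 0 φ)
  exact (by linarith : -K ≤ c * kinetic 0 φ - K).trans (coercive φ hφ hφN.le)

lemma infEnergy_le (hα₀ : 0 < α) (hα₁ : α < 1) (hN₀ : 0 ≤ N) (hN : N < criticalMass) {φ : L2}
    (hφ : MemHHalf φ) (hφN : mass φ = N) : infEnergy m α β N ≤ energy m α β φ :=
  ciInf_le (bddBelow_energy hα₀ hα₁ hN₀ hN) ⟨φ, hφ, hφN⟩

lemma exists_energy_lt (hN : 0 ≤ N) {b : ℝ} (hb : infEnergy m α β N < b) :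
    ∃ φ : L2, MemHHalf φ ∧ mass φ = N ∧ energy m α β φ < b := by
  have := nonempty_mass_eq hN
  obtain ⟨⟨φ, hφ, hφN⟩, h⟩ := exists_lt_of_ciInf_lt hb
  exact ⟨φ, hφ, hφN, h⟩

lemma le_infEnergy (hN : 0 ≤ N) {b : ℝ}
    (hb : ∀ φ : L2, MemHHalf φ → mass φ = N → b ≤ energy m α β φ) : b ≤ infEnergy m α β N := by
  have := nonempty_mass_eq hN
  exact le_ciInf fun φ => hb φ.1 φ.2.1 φ.2.2

lemma isMinimizer_of_energy_le (hα₀ : 0 < α) (hα₁ : α < 1) (hN₀ : 0 ≤ N) (hN : N < criticalMass)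
    {φ : L2} (hφ : MemHHalf φ) (hφN : mass φ = N) (h : energy m α β φ ≤ infEnergy m α β N) :
    IsMinimizer m α β N φ :=
  ⟨hφ, hφN, le_antisymm
    (le_iInf fun ψ => EReal.coe_le_coe_iff.2 (h.trans (infEnergy_le hα₀ hα₁ hN₀ hN ψ.2.1 ψ.2.2)))
    (groundEnergy_le hφ hφN)⟩

lemma infEnergy_nonneg (hα₀ : 0 < α) (hα₁ : α < 1) (hβ : 0 ≤ β) (hN₀ : 0 ≤ N)
    (hN : N < criticalMass) : 0 ≤ infEnergy m α β N := by
  refine le_infEnergy hN₀ fun φ hφ hφN => ?_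
  have h_newton : rieszEnergy 1 φ ≤ 2 * kinetic 0 φ :=
    (rieszEnergy_one_le_of_mass_le hφ hφN.le).trans (mul_le_of_le_one_left
      (mul_nonneg two_pos.le (kinetic_nonneg 0 φ)) ((div_lt_one criticalMass_pos).2 hN).le)
  rw [energy_eq hα₀ hα₁.le m β hφ]
  linarith [kinetic_zero_le m hφ, kinetic_nonneg 0 φ, mul_nonneg hβ (rieszEnergy_nonneg α φ)]

end InfEnergy

section Subadditivity

variable {m α β N : ℝ}

lemma energy_smul (hα₀ : 0 < α) (hα₁ : α ≤ 1) (c : ℝ) {φ : L2} (hφ : MemHHalf φ) :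
    energy m α β ((c : ℂ) • φ)
      = c ^ 4 * energy m α β φ - c ^ 2 * (c ^ 2 - 1) * (1 / 2 * kinetic m φ) := by
  rw [energy_eq hα₀ hα₁ m β hφ, energy_eq hα₀ hα₁ m β (hφ.smul _), kinetic_smul,
    rieszEnergy_smul, rieszEnergy_smul]
  ring

lemma infEnergy_mul_le (hα₀ : 0 < α) (hα₁ : α < 1) (hN₀ : 0 ≤ N) {k : ℝ} (hk : 1 ≤ k)
    (hkN : k * N < criticalMass) :
    infEnergy m α β (k * N) ≤ k ^ 2 * infEnergy m α β N - k * (k - 1) * (1 / 2 * (m * N)) := by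
  have hk₀ : 0 < k := one_pos.trans_le hk
  have : 0 ≤ k - 1 := sub_nonneg.2 hk
  suffices h : (infEnergy m α β (k * N) + k * (k - 1) * (1 / 2 * (m * N))) / k ^ 2
      ≤ infEnergy m α β N by
    rw [div_le_iff₀' (by positivity)] at h
    linarith
  refine le_infEnergy hN₀ fun φ hφ hφN => ?_
  have h_sqrt : √k ^ 2 = k := Real.sq_sqrt hk₀.le
  have h_smul := energy_smul (m := m) (β := β) hα₀ hα₁.le √k hφ
  rw [h_sqrt, (by rw [← h_sqrt, ← pow_mul, h_sqrt] : √k ^ 4 = k ^ 2)] at h_smul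
  have h_inf : infEnergy m α β (k * N) ≤ energy m α β ((√k : ℂ) • φ) :=
    infEnergy_le hα₀ hα₁ (by positivity) hkN (hφ.smul _) (by rw [mass_smul, h_sqrt, hφN])
  have h_kinetic : k * (k - 1) * (1 / 2 * (m * N)) ≤ k * (k - 1) * (1 / 2 * kinetic m φ) := by
    gcongr
    exact hφN ▸ mul_mass_le_kinetic m hφ
  rw [div_le_iff₀' (by positivity)]
  linarith

lemma infEnergy_le_of_lt (hα₀ : 0 < α) (hα₁ : α < 1) {x : ℝ} (hx : 0 < x) (hxN : x < N)
    (hN : N < criticalMass) :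
    infEnergy m α β N
      ≤ (N / x) ^ 2 * infEnergy m α β x - N / x * (N / x - 1) * (1 / 2 * (m * x)) := by
  have h := infEnergy_mul_le (m := m) (β := β) hα₀ hα₁ hx.le ((one_lt_div hx).2 hxN).le
    (by rwa [div_mul_cancel₀ _ hx.ne'])
  rwa [div_mul_cancel₀ _ hx.ne'] at h

lemma tendsto_kineticSymbol_sub (ξ : R3) :
    Tendsto (fun M : ℝ => kineticSymbol M ξ - M) atTop (𝓝 0) := by
  have h_lim : Tendsto (fun M : ℝ => kineticSymbol 0 ξ ^ 2 / M) atTop (𝓝 0) :=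
    tendsto_const_nhds.div_atTop tendsto_id
  refine tendsto_of_tendsto_of_tendsto_of_le_of_le' tendsto_const_nhds h_lim
    (.of_forall fun M => sub_nonneg.2 (le_kineticSymbol M ξ)) ?_
  filter_upwards [eventually_gt_atTop 0] with M hM
  have h_sq : kineticSymbol M ξ ^ 2 = kineticSymbol 0 ξ ^ 2 + M ^ 2 := by
    rw [kineticSymbol_zero, kineticSymbol, Real.sq_sqrt (by positivity)]
  rw [le_div_iff₀ hM]
  nlinarith [le_kineticSymbol M ξ]

lemma tendsto_kinetic_sub {φ : L2} (hφ : MemHHalf φ) :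
    Tendsto (fun M : ℝ => kinetic M φ - M * mass φ) atTop (𝓝 0) := by
  have kinetic_sub (M : ℝ) : kinetic M φ - M * mass φ
      = ∫ ξ, (kineticSymbol M ξ - M) * ‖(𝓕 φ : L2) ξ‖ ^ 2 := by
    rw [← mass_fourier, mass, kinetic_eq, ← integral_const_mul,
      ← integral_sub (integrable_kineticSymbol_mul_fourier M hφ)
        ((integrable_norm_sq _).const_mul M)]
    simp_rw [sub_mul]
  simp_rw [kinetic_sub]
  rw [← integral_zero R3 ℝ]
  refine tendsto_integral_filter_of_dominated_convergence
    (fun ξ => kineticSymbol 0 ξ * ‖(𝓕 φ : L2) ξ‖ ^ 2) (.of_forall fun M => ?_) ?_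
    (integrable_kineticSymbol_mul_fourier 0 hφ) (ae_of_all _ fun ξ => ?_)
  · exact ((continuous_kineticSymbol M).sub continuous_const).aestronglyMeasurable.mul
      (integrable_norm_sq _).1
  · filter_upwards [eventually_ge_atTop 0] with M hM
    refine ae_of_all _ fun ξ => ?_
    have h_symbol := kineticSymbol_le hM ξ
    rw [norm_mul, norm_pow, norm_norm, Real.norm_of_nonneg (sub_nonneg.2 (le_kineticSymbol M ξ))]
    gcongr
    linarith
  · simpa only [zero_mul] using (tendsto_kineticSymbol_sub ξ).mul_const (‖(𝓕 φ : L2) ξ‖ ^ 2)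

-- The dilation by `m / M` turns the mass parameter `m` into the large parameter `M`: the kinetic
-- excess over `m * N` is then much smaller than the attraction.
lemma infEnergy_lt_of_nonpos (hm : 0 < m) (hα₀ : 0 < α) (hα₁ : α < 1) (hβ : β ≤ 0) (hN₀ : 0 < N)
    (hN : N < criticalMass) : infEnergy m α β N < 1 / 2 * (m * N) := by
  obtain ⟨φ, hφ, hφN⟩ := nonempty_mass_eq hN₀.le
  have hφ₀ : φ ≠ 0 := by
    rintro rfl
    simp [mass_eq_norm_sq, hN₀.ne] at hφN
  have h_newton := rieszEnergy_pos one_pos le_rfl hφ hφ₀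
  obtain ⟨M, hM₀, hM⟩ := ((eventually_gt_atTop (0 : ℝ)).and
    ((tendsto_kinetic_sub hφ).eventually_lt_const (half_pos h_newton))).exists
  have ht : 0 < m / M := by positivity
  refine (infEnergy_le hα₀ hα₁ hN₀.le hN (hφ.dilate ht) (by rw [mass_dilate, hφN])).trans_lt ?_
  have h_power : β * ((m / M) ^ α * rieszEnergy α φ) ≤ 0 :=
    mul_nonpos_of_nonpos_of_nonneg hβ (mul_nonneg (by positivity) (rieszEnergy_nonneg _ _))
  have h_kinetic : m / M * kinetic M φ < m * N + m / M * (rieszEnergy 1 φ / 2) := by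
    calc m / M * kinetic M φ < m / M * (M * mass φ + rieszEnergy 1 φ / 2) := by
          gcongr
          linarith
      _ = m * N + m / M * (rieszEnergy 1 φ / 2) := by rw [hφN]; field_simp
  rw [energy_dilate hα₀ hα₁.le m β hφ ht, div_div_cancel₀ hm.ne']
  linarith

lemma infEnergy_lt_add_of_nonpos (hm : 0 < m) (hα₀ : 0 < α) (hα₁ : α < 1) (hβ : β ≤ 0)
    (hN : N < criticalMass) {l : ℝ} (hl₀ : 0 < l) (hlN : l < N) :
    infEnergy m α β N < infEnergy m α β l + infEnergy m α β (N - l) := by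
  have per_mass_lt {x : ℝ} (hx : 0 < x) (hxN : x < N) :
      x / N * infEnergy m α β N < infEnergy m α β x := by
    have hN₀ : 0 < N := hx.trans hxN
    have hk : 0 < N / x * (N / x - 1) :=
      mul_pos (by positivity) (sub_pos.2 ((one_lt_div hx).2 hxN))
    have h_small := mul_lt_mul_of_pos_left
      (infEnergy_lt_of_nonpos hm hα₀ hα₁ hβ hx (hxN.trans hN)) hk
    calc x / N * infEnergy m α β N < x / N * (N / x * infEnergy m α β x) := by
          gcongr
          linarith [infEnergy_le_of_lt (m := m) (β := β) hα₀ hα₁ hx hxN hN]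
      _ = infEnergy m α β x := by field_simp
  have hN₀ : 0 < N := hl₀.trans hlN
  calc infEnergy m α β N = l / N * infEnergy m α β N + (N - l) / N * infEnergy m α β N := by
        field_simp
        ring
    _ < infEnergy m α β l + infEnergy m α β (N - l) :=
        add_lt_add (per_mass_lt hl₀ hlN) (per_mass_lt (by linarith) (by linarith))

lemma infEnergy_lt_add_of_lt (hα₀ : 0 < α) (hα₁ : α < 1) (hβ : 0 ≤ β) (hN : N < criticalMass)
    (hE : infEnergy m α β N < m * N / 6) {l : ℝ} (hl₀ : 0 < l) (hlN : l < N) :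
    infEnergy m α β N < infEnergy m α β l + infEnergy m α β (N - l) := by
  have lt_of_half_le {x : ℝ} (hx : 0 < x) (hxN : x < N) (hNx : N ≤ 2 * x) :
      infEnergy m α β N < infEnergy m α β x := by
    rcases le_or_gt (m * N / 6) (infEnergy m α β x) with h_large | h_small
    · exact hE.trans_le h_large
    have hk : 0 < N / x - 1 := sub_pos.2 ((one_lt_div hx).2 hxN)
    have hk_le : N / x + 1 ≤ 3 := by linarith [(div_le_iff₀ hx).2 hNx]
    have h_nonneg := infEnergy_nonneg (m := m) hα₀ hα₁ hβ hx.le (hxN.trans hN)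
    have h_three : (N / x + 1) * infEnergy m α β x < 1 / 2 * (m * N) := by
      linarith [mul_le_mul_of_nonneg_right hk_le h_nonneg]
    calc infEnergy m α β N
        ≤ (N / x) ^ 2 * infEnergy m α β x - N / x * (N / x - 1) * (1 / 2 * (m * x)) :=
          infEnergy_le_of_lt hα₀ hα₁ hx hxN hN
      _ = infEnergy m α β x
            + (N / x - 1) * ((N / x + 1) * infEnergy m α β x - 1 / 2 * (m * N)) := by
          field_simp
          ring
      _ < infEnergy m α β x :=
          add_lt_of_neg_right _ (mul_neg_of_pos_of_neg hk (sub_neg.2 h_three))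
  have hr₀ : 0 < N - l := sub_pos.2 hlN
  have hl := infEnergy_nonneg (m := m) hα₀ hα₁ hβ hl₀.le (hlN.trans hN)
  have hr := infEnergy_nonneg (m := m) (N := N - l) hα₀ hα₁ hβ hr₀.le (by linarith)
  rcases le_total N (2 * l) with h | h
  · linarith [lt_of_half_le hl₀ hlN h]
  · linarith [lt_of_half_le hr₀ (by linarith) (by linarith)]

end Subadditivity

section FrequencySplitting

variable {E F : Type*} [NormedAddCommGroup E] [InnerProductSpace ℝ E] [FiniteDimensional ℝ E]
  [MeasurableSpace E] [BorelSpace E] [NormedAddCommGroup F] [InnerProductSpace ℂ F]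
  [CompleteSpace F]

lemma ekinetic_lowPass_le (A : ℝ) (f : Lp F 2 (volume : Measure E)) :
    ekinetic (lowPass A f) ≤ ENNReal.ofReal A * ∫⁻ x, density f x := by
  rw [← lintegral_density_fourier, ← lintegral_const_mul _ (measurable_density _), ekinetic]
  refine lintegral_mono_ae ?_
  filter_upwards [density_fourier_lowPass A f] with ξ hξ
  rw [hξ]
  by_cases h : ξ ∈ ball (0 : E) A
  · rw [Set.indicator_of_mem h, ← ofReal_norm]
    gcongr
    exact (mem_ball_zero_iff.1 h).le
  · simp [Set.indicator_of_notMem h]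

lemma ekinetic_highPass_le (A : ℝ) (f : Lp F 2 (volume : Measure E)) :
    ekinetic (highPass A f) ≤ ekinetic f := by
  refine lintegral_mono_ae ?_
  filter_upwards [density_fourier_highPass A f] with ξ hξ
  rw [hξ]
  exact mul_le_mul_right (Set.indicator_le_self _ _ _) _

lemma lintegral_density_lowPass_add_highPass (A : ℝ) (f : Lp F 2 (volume : Measure E)) :
    (∫⁻ x, density (lowPass A f) x) + ∫⁻ x, density (highPass A f) x = ∫⁻ x, density f x := by
  rw [lintegral_density_lowPass, lintegral_density_highPass,
    lintegral_add_compl _ measurableSet_ball, lintegral_density_fourier]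

lemma lintegral_density_highPass_le (A : ℝ) (f : Lp F 2 (volume : Measure E)) :
    ∫⁻ x, density (highPass A f) x ≤ ∫⁻ x, density f x :=
  le_add_self.trans (lintegral_density_lowPass_add_highPass A f).le

end FrequencySplitting

section LowFrequencyRieszEnergy

variable {E F : Type*} [NormedAddCommGroup E] [InnerProductSpace ℝ E] [FiniteDimensional ℝ E]
  [MeasurableSpace E] [BorelSpace E] [NormedAddCommGroup F]

lemma rieszForm_density_add_le (s : ℝ) {g : E → ℝ≥0∞} (hg : Measurable g)
    (f f' : Lp F 2 (volume : Measure E)) {κ : ℝ} (hκ : 0 < κ) :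
    rieszForm s g (density (f + f')) ≤ ENNReal.ofReal (1 + κ) * rieszForm s g (density f)
      + ENNReal.ofReal (1 + 1 / κ) * rieszForm s g (density f') := by
  rw [← rieszForm_const_mul_right s ENNReal.ofReal_ne_top,
    ← rieszForm_const_mul_right s ENNReal.ofReal_ne_top,
    ← rieszForm_add_right s hg ((measurable_density f).const_mul _)]
  exact rieszForm_mono s (EventuallyLE.refl _ g) (density_add_le f f' hκ)

variable [InnerProductSpace ℂ F] [CompleteSpace F]

lemma exists_rieszForm_density_lowPass_le (hd : 2 < finrank ℝ E) :
    ∃ C : ℝ≥0, ∀ (A : ℝ) (f : Lp F 2 (volume : Measure E)) (g : E → ℝ≥0∞), Measurable g →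
      rieszForm 1 g (density (lowPass A f))
        ≤ (∫⁻ x, g x) * (C * (ENNReal.ofReal A * ∫⁻ x, density f x)) := by
  obtain ⟨C, kato⟩ := exists_lintegral_rieszKernel_one_mul_density_le (F := F) hd
  refine ⟨C, fun A f g hg => rieszForm_le_of_rieszPotential_le 1 hg fun a => ?_⟩
  exact (kato (lowPass A f) a).trans (mul_le_mul_right (ekinetic_lowPass_le A f) _)

lemma exists_erieszEnergy_one_le_highPass (hd : 2 < finrank ℝ E) :
    ∃ C : ℝ≥0, ∀ (f : Lp F 2 (volume : Measure E)) (A κ : ℝ), 0 < κ →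
      erieszEnergy 1 f ≤ ENNReal.ofReal (1 + κ) ^ 2 * erieszEnergy 1 (highPass A f)
        + (1 + ENNReal.ofReal (1 + κ)) * ENNReal.ofReal (1 + 1 / κ)
          * (C * (ENNReal.ofReal A * (∫⁻ x, density f x) ^ 2)) := by
  obtain ⟨C, low⟩ := exists_rieszForm_density_lowPass_le (F := F) hd
  refine ⟨C, fun f A κ hκ => ?_⟩
  set l := lowPass A f
  set h := highPass A f
  set M := ∫⁻ x, density f x
  have h_add : h + l = f := (add_comm h l).trans (lowPass_add_highPass A f)
  have h_low (g : Lp F 2 (volume : Measure E)) (hg : ∫⁻ x, density g x ≤ M) :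
      rieszForm 1 (density g) (density l) ≤ C * (ENNReal.ofReal A * M ^ 2) := by
    calc rieszForm 1 (density g) (density l) ≤ M * (C * (ENNReal.ofReal A * M)) :=
          (low A f _ (measurable_density g)).trans (by gcongr)
      _ = C * (ENNReal.ofReal A * M ^ 2) := by ring
  have h_split (g : Lp F 2 (volume : Measure E)) (hg : ∫⁻ x, density g x ≤ M) :
      rieszForm 1 (density g) (density f)
        ≤ ENNReal.ofReal (1 + κ) * rieszForm 1 (density g) (density h)
          + ENNReal.ofReal (1 + 1 / κ) * (C * (ENNReal.ofReal A * M ^ 2)) := by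
    refine (h_add ▸ rieszForm_density_add_le 1 (measurable_density g) h l hκ).trans ?_
    gcongr
    exact h_low g hg
  refine (h_split f le_rfl).trans ?_
  rw [rieszForm_comm 1 (measurable_density f) (measurable_density h)]
  refine (add_le_add_left (mul_le_mul_right
    (h_split h (lintegral_density_highPass_le A f)) _) _).trans_eq ?_
  rw [erieszEnergy]
  ring

end LowFrequencyRieszEnergy

section NearOptimizers

lemma MemHHalf.highPass (A : ℝ) {f : L2} (hf : MemHHalf f) :
    MemHHalf (BosonStar.highPass A f) := by
  rw [memHHalf_iff_ekinetic_lt_top] at hf ⊢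
  exact (ekinetic_highPass_le A f).trans_lt hf

lemma mass_lowPass_add_mass_highPass (A : ℝ) (f : L2) :
    mass (lowPass A f) + mass (highPass A f) = mass f := by
  have h := congrArg ENNReal.toReal (lintegral_density_lowPass_add_highPass A f)
  rwa [ENNReal.toReal_add (lintegral_density_ne_top _) (lintegral_density_ne_top _),
    toReal_lintegral_density_eq_mass, toReal_lintegral_density_eq_mass,
    toReal_lintegral_density_eq_mass] at h

lemma kinetic_zero_highPass_le (A : ℝ) {f : L2} (hf : MemHHalf f) :
    kinetic 0 (highPass A f) ≤ kinetic 0 f := by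
  rw [kinetic_zero, kinetic_zero]
  gcongr
  · exact ((memHHalf_iff_ekinetic_lt_top f).1 hf).ne
  · exact ekinetic_highPass_le A f

lemma exists_rieszEnergy_one_le_highPass :
    ∃ C : ℝ, 0 ≤ C ∧ ∀ (f : L2) (κ : ℝ), MemHHalf f → 0 < κ → κ ≤ 1 →
      rieszEnergy 1 f
        ≤ (1 + κ) ^ 2 * rieszEnergy 1 (highPass (κ ^ 2) f) + C * κ * mass f ^ 2 := by
  obtain ⟨C, h_split⟩ := exists_erieszEnergy_one_le_highPass (F := ℂ) two_lt_finrank_R3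
  refine ⟨6 * C, by positivity, fun f κ hf hκ₀ hκ₁ => ?_⟩
  have h := h_split f (κ ^ 2) κ hκ₀
  have h_mass := mass_nonneg f
  have h_riesz := rieszEnergy_nonneg 1 (highPass (κ ^ 2) f)
  rw [lintegral_density_eq_mass, ← ENNReal.ofReal_toReal
    (erieszEnergy_ne_top one_pos le_rfl (hf.highPass (κ ^ 2))), ← ENNReal.ofReal_coe_nnreal,
    ← ENNReal.ofReal_one, ← ENNReal.ofReal_add one_pos.le (by positivity),
    ← ENNReal.ofReal_pow (by positivity), ← ENNReal.ofReal_pow (by positivity),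
    ← ENNReal.ofReal_mul (by positivity), ← ENNReal.ofReal_mul (by positivity),
    ← ENNReal.ofReal_mul (by positivity), ← ENNReal.ofReal_mul (by positivity),
    ← ENNReal.ofReal_mul (by positivity),
    ← ENNReal.ofReal_add (by positivity) (by positivity)] at h
  refine (ENNReal.toReal_le_of_le_ofReal
    (add_nonneg (mul_nonneg (by positivity) h_riesz) (by positivity)) h).trans ?_
  refine add_le_add_right ?_ _
  calc (1 + (1 + κ)) * (1 + 1 / κ) * (C * (κ ^ 2 * mass f ^ 2))
      = (2 + κ) * (1 + κ) * (C * κ * mass f ^ 2) := by field_simp; ring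
    _ ≤ (2 + 1) * (1 + 1) * (C * κ * mass f ^ 2) := by gcongr
    _ = 6 * C * κ * mass f ^ 2 := by ring

lemma exists_mass_lowPass_le {μ : ℝ} (hμ : 0 < μ) :
    ∃ ε η : ℝ, 0 < ε ∧ 0 < η ∧ ∀ ψ : L2, MemHHalf ψ → mass ψ = 1 → kinetic 0 ψ = 1 →
      2 * (1 - η) ≤ criticalMass * rieszEnergy 1 ψ → mass (lowPass ε ψ) ≤ μ := by
  obtain ⟨C, hC, h_split⟩ := exists_rieszEnergy_one_le_highPass
  have hc := criticalMass_pos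
  set B := 3 + criticalMass * C with hB
  have : 0 < B := by positivity
  set κ := min 1 (μ / (2 * B))
  have hκ₀ : 0 < κ := by positivity
  have hκ₁ : κ ≤ 1 := min_le_left _ _
  have hκB : κ * B ≤ μ / 2 := by
    calc κ * B ≤ μ / (2 * B) * B := by gcongr; exact min_le_right _ _
      _ = μ / 2 := by field_simp
  refine ⟨κ ^ 2, μ / 2, by positivity, by positivity, fun ψ hψ h_mass h_kinetic h_opt => ?_⟩
  have h_total := mass_lowPass_add_mass_highPass (κ ^ 2) ψ
  have h_low := mass_nonneg (lowPass (κ ^ 2) ψ)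
  have h_high := mass_nonneg (highPass (κ ^ 2) ψ)
  have h_riesz := h_split ψ κ hψ hκ₀ hκ₁
  have h_kinetic_high := kinetic_zero_highPass_le (κ ^ 2) hψ
  rw [h_mass] at h_total h_riesz
  rw [h_kinetic] at h_kinetic_high
  have h_newton : criticalMass * rieszEnergy 1 (highPass (κ ^ 2) ψ)
      ≤ 2 * mass (highPass (κ ^ 2) ψ) :=
    (criticalMass_mul_rieszEnergy_le (hψ.highPass (κ ^ 2))).trans
      (mul_le_mul_of_nonneg_left (mul_le_of_le_one_left h_high h_kinetic_high) two_pos.le)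
  have h_upper : criticalMass * rieszEnergy 1 ψ
      ≤ 2 * mass (highPass (κ ^ 2) ψ) + 2 * (κ * B) := by
    calc criticalMass * rieszEnergy 1 ψ
        ≤ criticalMass * ((1 + κ) ^ 2 * rieszEnergy 1 (highPass (κ ^ 2) ψ) + C * κ * 1 ^ 2) := by
          gcongr
      _ = (1 + κ) ^ 2 * (criticalMass * rieszEnergy 1 (highPass (κ ^ 2) ψ))
          + criticalMass * C * κ := by ring
      _ ≤ (1 + κ) ^ 2 * (2 * mass (highPass (κ ^ 2) ψ)) + criticalMass * C * κ := by gcongr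
      _ ≤ 2 * mass (highPass (κ ^ 2) ψ) + 2 * (κ * B) := by
          have : 0 ≤ criticalMass * C * κ := by positivity
          have : (2 * κ + κ ^ 2) * mass (highPass (κ ^ 2) ψ) ≤ 3 * κ * 1 := by
            gcongr
            · nlinarith
            · linarith
          rw [hB]
          linarith
  linarith

lemma kineticSymbol_le_of_le_norm (M : ℝ) {ε : ℝ} (hε : 0 < ε) {ξ : R3} (hξ : ε ≤ ‖ξ‖) :
    kineticSymbol M ξ ≤ kineticSymbol 0 ξ + M ^ 2 / (4 * Real.pi * ε) := by
  have hc : 0 ≤ M ^ 2 / (4 * Real.pi * ε) := by positivity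
  rw [kineticSymbol_zero, kineticSymbol, Real.sqrt_le_left (by positivity)]
  have h_cross : M ^ 2 ≤ 2 * (2 * Real.pi * ‖ξ‖) * (M ^ 2 / (4 * Real.pi * ε)) := by
    calc M ^ 2 = 2 * (2 * Real.pi * ε) * (M ^ 2 / (4 * Real.pi * ε)) := by field_simp; norm_num
      _ ≤ 2 * (2 * Real.pi * ‖ξ‖) * (M ^ 2 / (4 * Real.pi * ε)) := by gcongr
  nlinarith

lemma mass_lowPass (A : ℝ) (f : L2) :
    mass (lowPass A f) = ∫ ξ, (ball (0 : R3) A).indicator (fun ξ => ‖(𝓕 f : L2) ξ‖ ^ 2) ξ := by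
  rw [← mass_fourier, mass]
  refine integral_congr_ae ?_
  filter_upwards [fourier_lowPass A f] with ξ hξ
  rw [hξ]
  by_cases h : ξ ∈ ball (0 : R3) A
  · rw [Set.indicator_of_mem h, Set.indicator_of_mem h]
  · rw [Set.indicator_of_notMem h, Set.indicator_of_notMem h, norm_zero, zero_pow two_ne_zero]

lemma kinetic_le_add_mass_lowPass {M ε : ℝ} (hM : 0 ≤ M) (hε : 0 < ε) {f : L2}
    (hf : MemHHalf f) :
    kinetic M f
      ≤ kinetic 0 f + (M * mass (lowPass ε f) + M ^ 2 / (4 * Real.pi * ε) * mass f) := by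
  have h_low := ((integrable_norm_sq (𝓕 f : L2)).indicator
    (measurableSet_ball (x := (0 : R3)) (ε := ε))).const_mul M
  have h_all := (integrable_norm_sq (𝓕 f : L2)).const_mul (M ^ 2 / (4 * Real.pi * ε))
  have h_extra : Integrable (fun ξ => M * (ball (0 : R3) ε).indicator
      (fun ξ => ‖(𝓕 f : L2) ξ‖ ^ 2) ξ + M ^ 2 / (4 * Real.pi * ε) * ‖(𝓕 f : L2) ξ‖ ^ 2) volume :=
    h_low.add h_all
  have h_zero := integrable_kineticSymbol_mul_fourier 0 hf
  rw [mass_lowPass, ← mass_fourier f, mass, kinetic_eq, kinetic_eq, ← integral_const_mul,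
    ← integral_const_mul, ← integral_add h_low h_all, ← integral_add h_zero h_extra]
  refine integral_mono (integrable_kineticSymbol_mul_fourier M hf) (h_zero.add h_extra)
    fun ξ => ?_
  by_cases h : ξ ∈ ball (0 : R3) ε
  · have h_symbol : kineticSymbol M ξ
        ≤ kineticSymbol 0 ξ + (M + M ^ 2 / (4 * Real.pi * ε)) :=
      (kineticSymbol_le hM ξ).trans (by gcongr; exact le_add_of_nonneg_right (by positivity))
    simp only [Set.indicator_of_mem h, ← add_mul]
    gcongr
  · simp only [Set.indicator_of_notMem h, mul_zero, zero_add, ← add_mul]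
    gcongr
    exact kineticSymbol_le_of_le_norm M hε (by simpa using h)

lemma kinetic_zero_pos {f : L2} (hf : MemHHalf f) (hf₀ : f ≠ 0) : 0 < kinetic 0 f := by
  have h := (mul_pos criticalMass_pos (rieszEnergy_pos one_pos le_rfl hf hf₀)).trans_le
    (criticalMass_mul_rieszEnergy_le hf)
  exact pos_of_mul_pos_left (pos_of_mul_pos_right h two_pos.le) (mass_nonneg f)

lemma exists_near_optimizer {η : ℝ} (hη : 0 < η) :
    ∃ ψ : L2, MemHHalf ψ ∧ mass ψ = 1 ∧ kinetic 0 ψ = 1 ∧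
      2 * (1 - η) ≤ criticalMass * rieszEnergy 1 ψ := by
  have hc := criticalMass_pos
  obtain ⟨φ, hφ, h_mass, h_quot⟩ := exists_two_mul_kinetic_lt_of_criticalMass_lt
    (lt_mul_of_one_lt_left hc (lt_add_of_pos_right 1 hη))
  set N := (1 + η) * criticalMass
  have hN : 0 < N := by positivity
  have hK : 0 < kinetic 0 φ := kinetic_zero_pos hφ (by
    rintro rfl
    simp [mass_eq_norm_sq, hN.ne] at h_mass)
  have ht : 0 < N / kinetic 0 φ := by positivity
  have h_sq : (√N)⁻¹ ^ 2 = N⁻¹ := by rw [inv_pow, Real.sq_sqrt hN.le]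
  have h_four : (√N)⁻¹ ^ 4 = (N⁻¹) ^ 2 := by rw [← h_sq, ← pow_mul]
  refine ⟨dilate ht ((((√N)⁻¹ : ℝ) : ℂ) • φ), (hφ.smul _).dilate ht, ?_, ?_, ?_⟩
  · rw [mass_dilate, mass_smul, h_sq, h_mass, inv_mul_cancel₀ hN.ne']
  · rw [kinetic_dilate, zero_div, kinetic_smul, h_sq]
    field_simp
  · rw [rieszEnergy_dilate, Real.rpow_one, rieszEnergy_smul, h_four]
    have h_value : criticalMass * (N / kinetic 0 φ * ((N⁻¹) ^ 2 * rieszEnergy 1 φ))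
        = rieszEnergy 1 φ / (kinetic 0 φ * (1 + η)) := by
      simp only [N]
      field_simp
    rw [h_value, le_div_iff₀ (by positivity)]
    nlinarith [mul_nonneg hK.le (sq_nonneg η)]

lemma exists_two_mul_kinetic_le {m κ : ℝ} (hm : 0 < m) (hκ : 0 < κ) :
    ∃ φ : L2, MemHHalf φ ∧ mass φ = 1 ∧
      2 * kinetic m φ ≤ criticalMass * rieszEnergy 1 φ + κ := by
  obtain ⟨ε, η₀, hε, hη₀, h_low⟩ := exists_mass_lowPass_le (μ := κ / (8 * m)) (by positivity)
  set t := m ^ 2 / (ε * κ) with ht_def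
  have ht : 0 < t := by positivity
  set η := min η₀ (κ / (8 * t))
  obtain ⟨ψ, hψ, h_mass, h_kinetic, h_opt⟩ := exists_near_optimizer (η := η) (by positivity)
  have h_mass_low : mass (lowPass ε ψ) ≤ κ / (8 * m) :=
    h_low ψ hψ h_mass h_kinetic (le_trans (by gcongr; exact min_le_left _ _) h_opt)
  refine ⟨dilate ht ψ, hψ.dilate ht, by rw [mass_dilate, h_mass], ?_⟩
  rw [kinetic_dilate, rieszEnergy_dilate, Real.rpow_one]
  have h_upper : t * kinetic (m / t) ψ ≤ t + κ / 8 + κ / 8 := by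
    calc t * kinetic (m / t) ψ
        ≤ t * (1 + (m / t * (κ / (8 * m)) + (m / t) ^ 2 / (4 * 2 * ε) * 1)) := by
          have h := kinetic_le_add_mass_lowPass (M := m / t) (by positivity) hε hψ
          rw [h_mass, h_kinetic] at h
          refine mul_le_mul_of_nonneg_left (h.trans ?_) ht.le
          gcongr
          exact Real.two_le_pi
      _ = t + κ / 8 + κ / 8 := by
          rw [ht_def]
          field_simp
          ring
  have h_lower : 2 * t - κ / 4 ≤ criticalMass * (t * rieszEnergy 1 ψ) := by
    calc 2 * t - κ / 4 = t * (2 * (1 - κ / (8 * t))) := by field_simp; ring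
      _ ≤ t * (2 * (1 - η)) := by gcongr; exact min_le_right _ _
      _ ≤ t * (criticalMass * rieszEnergy 1 ψ) := by gcongr
      _ = criticalMass * (t * rieszEnergy 1 ψ) := by ring
  linarith

lemma exists_infEnergy_lt {m α : ℝ} (hm : 0 < m) (hα₀ : 0 < α) (hα₁ : α < 1) :
    ∃ β₀ δ : ℝ, 0 < β₀ ∧ 0 < δ ∧ ∀ β N : ℝ, 0 < β → β < β₀ → 0 < N → criticalMass - δ < N →
      N < criticalMass → infEnergy m α β N < m * N / 6 := by
  have hc := criticalMass_pos
  obtain ⟨φ, hφ, h_mass, h_kinetic⟩ := exists_two_mul_kinetic_le hm (κ := m / 6) (by positivity)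
  have hR₁ := rieszEnergy_nonneg 1 φ
  have hRα := rieszEnergy_nonneg α φ
  refine ⟨m / (6 * (criticalMass * rieszEnergy α φ + 1)), m / (6 * (rieszEnergy 1 φ + 1)),
    by positivity, by positivity, fun β N hβ₀ hβ hN₀ hNδ hN => ?_⟩
  have h_sq : √N ^ 2 = N := Real.sq_sqrt hN₀.le
  have h_four : √N ^ 4 = N ^ 2 := by rw [← h_sq, ← pow_mul, h_sq]
  rw [lt_div_iff₀ (by positivity)] at hβ
  rw [sub_lt_comm, lt_div_iff₀ (by positivity)] at hNδ
  have : (criticalMass - N) * rieszEnergy 1 φ ≤ m / 6 := by nlinarith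
  have h_repulsion : β * (N * rieszEnergy α φ) ≤ m / 6 := by
    calc β * (N * rieszEnergy α φ) ≤ β * (criticalMass * rieszEnergy α φ + 1) := by
          gcongr
          exact (mul_le_mul_of_nonneg_right hN.le hRα).trans (lt_add_one _).le
      _ ≤ m / 6 := by linarith
  calc infEnergy m α β N ≤ energy m α β ((√N : ℂ) • φ) :=
        infEnergy_le hα₀ hα₁ hN₀.le hN (hφ.smul _) (by rw [mass_smul, h_sq, h_mass, mul_one])
    _ = N / 4 * (2 * kinetic m φ + β * (N * rieszEnergy α φ) - N * rieszEnergy 1 φ) := by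
        rw [energy_eq hα₀ hα₁.le m β (hφ.smul _), kinetic_smul, rieszEnergy_smul,
          rieszEnergy_smul, h_sq, h_four]
        ring
    _ ≤ N / 4 * (m / 6 + m / 6 + m / 6) := by
        gcongr
        linarith
    _ < m * N / 6 := by linarith [mul_pos hm hN₀]

end NearOptimizers

lemma exists_pos_le_one_mul_ofReal_le {c ε : ℝ≥0∞} (hc : c ≠ ⊤) (hε : ε ≠ 0) :
    ∃ r : ℝ, 0 < r ∧ r ≤ 1 ∧ c * ENNReal.ofReal r ≤ ε := by
  have h_lim : Tendsto (fun r : ℝ => c * ENNReal.ofReal r) (𝓝[>] 0) (𝓝 0) := by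
    have h := ENNReal.Tendsto.const_mul
      ((ENNReal.continuous_ofReal.tendsto 0).mono_left (nhdsWithin_le_nhds (s := Set.Ioi 0)))
      (Or.inr hc)
    rwa [ENNReal.ofReal_zero, mul_zero] at h
  obtain ⟨r, h_le, hr⟩ := ((h_lim.eventually (Iic_mem_nhds hε.bot_lt)).and
    (Ioc_mem_nhdsGT one_pos)).exists
  exact ⟨r, hr.1, hr.2, h_le⟩

section ShortRange

variable {E F : Type*} [NormedAddCommGroup E] [InnerProductSpace ℝ E] [FiniteDimensional ℝ E]
  [MeasurableSpace E] [BorelSpace E] [NormedAddCommGroup F]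

lemma setLIntegral_ball_rieszKernel_sub (s : ℝ) (x : E) (δ : ℝ) :
    ∫⁻ y in ball x δ, rieszKernel s (x - y) = ∫⁻ z in ball (0 : E) δ, rieszKernel s z := by
  rw [← lintegral_indicator measurableSet_ball, ← lintegral_indicator measurableSet_ball,
    ← lintegral_sub_left_eq_self ((ball (0 : E) δ).indicator (rieszKernel s)) x]
  refine lintegral_congr fun y => ?_
  classical
  simp only [Set.indicator_apply, mem_ball', dist_eq_norm, zero_sub, norm_neg]

lemma setLIntegral_ball_rieszKernel_mul_le (s : ℝ) {h : E → ℝ≥0∞} {M : ℝ≥0∞} (hM : M ≠ ⊤)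
    (h_le : ∀ᵐ y, h y ≤ M) (x : E) (δ : ℝ) :
    ∫⁻ y in ball x δ, rieszKernel s (x - y) * h y
      ≤ (∫⁻ z in ball (0 : E) δ, rieszKernel s z) * M := by
  rw [← setLIntegral_ball_rieszKernel_sub s x, ← lintegral_mul_const' _ _ hM]
  apply lintegral_mono_ae
  filter_upwards [ae_restrict_of_ae h_le] with y hy
  gcongr

lemma setLIntegral_ball_rieszKernel_density_add_le (s : ℝ) (f g : Lp F 2 (volume : Measure E))
    (x : E) (δ : ℝ) :
    ∫⁻ y in ball x δ, rieszKernel s (x - y) * density (f + g) y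
      ≤ 2 * (∫⁻ y in ball x δ, rieszKernel s (x - y) * density f y)
        + 2 * rieszPotential s (density g) x := by
  have h_meas (u : Lp F 2 (volume : Measure E)) :
      Measurable fun y => rieszKernel s (x - y) * density u y :=
    ((measurable_rieszKernel s).comp (measurable_const.sub measurable_id)).mul
      (measurable_density u)
  have h_add := density_add_le f g one_pos
  norm_num only [ENNReal.ofReal_ofNat] at h_add
  calc ∫⁻ y in ball x δ, rieszKernel s (x - y) * density (f + g) y
      ≤ ∫⁻ y in ball x δ, (2 * (rieszKernel s (x - y) * density f y)
          + 2 * (rieszKernel s (x - y) * density g y)) := by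
        apply lintegral_mono_ae
        filter_upwards [ae_restrict_of_ae h_add] with y hy
        calc rieszKernel s (x - y) * density (f + g) y
            ≤ rieszKernel s (x - y) * (2 * density f y + 2 * density g y) := by gcongr
          _ = _ := by ring
    _ = 2 * (∫⁻ y in ball x δ, rieszKernel s (x - y) * density f y)
          + 2 * ∫⁻ y in ball x δ, rieszKernel s (x - y) * density g y := by
        rw [lintegral_add_left ((h_meas f).const_mul _), lintegral_const_mul _ (h_meas f),
          lintegral_const_mul _ (h_meas g)]
    _ ≤ _ := by
        gcongr
        exact setLIntegral_le_lintegral _ _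

variable [InnerProductSpace ℂ F] [CompleteSpace F]

lemma lintegral_density_highPass_le_ekinetic {A : ℝ} (hA : 0 < A)
    (f : Lp F 2 (volume : Measure E)) :
    ∫⁻ x, density (highPass A f) x ≤ ENNReal.ofReal A⁻¹ * ekinetic f := by
  rw [lintegral_density_highPass, ekinetic, ← lintegral_const_mul' _ _ ENNReal.ofReal_ne_top]
  refine (setLIntegral_mono' measurableSet_ball.compl fun ξ hξ => ?_).trans
    (setLIntegral_le_lintegral _ _)
  have hξA : A ≤ ‖ξ‖ := by simpa using hξ
  have h_one_le : 1 ≤ ENNReal.ofReal A⁻¹ * ‖ξ‖ₑ := by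
    rwa [← ofReal_norm, ← ENNReal.ofReal_mul (inv_pos.2 hA).le, ENNReal.one_le_ofReal,
      inv_mul_eq_div, one_le_div hA]
  calc density (𝓕 f) ξ ≤ ENNReal.ofReal A⁻¹ * ‖ξ‖ₑ * density (𝓕 f) ξ :=
        le_mul_of_one_le_left zero_le h_one_le
    _ = ENNReal.ofReal A⁻¹ * (‖ξ‖ₑ * density (𝓕 f) ξ) := mul_assoc _ _ _

lemma density_lowPass_le_volume_mul (A : ℝ) (f : Lp F 2 (volume : Measure E)) :
    ∀ᵐ x, density (lowPass A f) x ≤ volume (ball (0 : E) A) * ∫⁻ y, density f y := by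
  have h := lintegral_mul_sq_le (μ := volume.restrict (ball (0 : E) A)) (f := fun _ => 1)
    (g := fun ξ => ‖𝓕 f ξ‖ₑ) aemeasurable_const
    (Lp.aestronglyMeasurable (𝓕 f : Lp F 2 (volume : Measure E))).restrict.enorm
  simp only [one_mul, one_pow, setLIntegral_one] at h
  filter_upwards [density_lowPass_le A f] with x hx
  calc density (lowPass A f) x
      ≤ volume (ball (0 : E) A) * ∫⁻ ξ in ball (0 : E) A, density (𝓕 f) ξ := hx.trans h
    _ ≤ volume (ball (0 : E) A) * ∫⁻ y, density f y := by
        rw [← lintegral_density_fourier f]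
        gcongr
        exact Measure.restrict_le_self

lemma lintegral_density_mul_setLIntegral_ball_le {C : ℝ≥0} {δ A : ℝ} (hA : 0 < A)
    {f : Lp F 2 (volume : Measure E)}
    (hC : ∀ a, rieszPotential 1 (density f) a ≤ C * ekinetic f) :
    ∫⁻ x, density f x * ∫⁻ y in ball x δ, rieszKernel 1 (x - y) * density f y
      ≤ 2 * (volume (ball (0 : E) A) * (∫⁻ x, density f x) ^ 2
          * ∫⁻ z in ball (0 : E) δ, rieszKernel 1 z)
        + 2 * (C * ekinetic f ^ 2 * ENNReal.ofReal A⁻¹) := by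
  set M := ∫⁻ x, density f x
  set I := (∫⁻ z in ball (0 : E) δ, rieszKernel 1 z) * (volume (ball (0 : E) A) * M)
  have hf := measurable_density f
  have h_high := measurable_density (highPass A f)
  have hp : Measurable fun x => density f x * rieszPotential 1 (density (highPass A f)) x :=
    hf.mul (measurable_rieszPotential 1 h_high)
  have h_pt (x : E) : ∫⁻ y in ball x δ, rieszKernel 1 (x - y) * density f y
      ≤ 2 * I + 2 * rieszPotential 1 (density (highPass A f)) x := by
    have h := setLIntegral_ball_rieszKernel_density_add_le 1 (lowPass A f) (highPass A f) x δ
    rw [lowPass_add_highPass] at h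
    refine h.trans ?_
    gcongr
    exact setLIntegral_ball_rieszKernel_mul_le 1
      (ENNReal.mul_ne_top measure_ball_lt_top.ne (lintegral_density_ne_top f))
      (density_lowPass_le_volume_mul A f) x δ
  have h_form : rieszForm 1 (density f) (density (highPass A f))
      ≤ ENNReal.ofReal A⁻¹ * ekinetic f * (C * ekinetic f) := by
    rw [rieszForm_comm 1 hf h_high]
    refine (rieszForm_le_of_rieszPotential_le 1 h_high hC).trans ?_
    gcongr
    exact lintegral_density_highPass_le_ekinetic hA f
  calc ∫⁻ x, density f x * ∫⁻ y in ball x δ, rieszKernel 1 (x - y) * density f y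
      ≤ ∫⁻ x, (density f x * (2 * I)
          + 2 * (density f x * rieszPotential 1 (density (highPass A f)) x)) := by
        refine lintegral_mono fun x => (mul_le_mul_right (h_pt x) _).trans_eq ?_
        ring
    _ = M * (2 * I) + 2 * rieszForm 1 (density f) (density (highPass A f)) := by
        rw [lintegral_add_left (hf.mul_const _), lintegral_mul_const _ hf,
          lintegral_const_mul _ hp, rieszForm]
    _ ≤ M * (2 * I) + 2 * (ENNReal.ofReal A⁻¹ * ekinetic f * (C * ekinetic f)) := by gcongr
    _ = _ := by ring

lemma exists_lintegral_density_mul_setLIntegral_ball_le (hd : 2 < finrank ℝ E) (K : ℝ≥0)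
    {ε : ℝ≥0∞} (hε : ε ≠ 0) :
    ∃ δ : ℝ, 0 < δ ∧ ∀ f : Lp F 2 (volume : Measure E), ∫⁻ x, density f x ≤ K → ekinetic f ≤ K →
      ∫⁻ x, density f x * ∫⁻ y in ball x δ, rieszKernel 1 (x - y) * density f y ≤ ε := by
  have : Nontrivial E := Module.nontrivial_of_finrank_pos (R := ℝ) (by omega)
  obtain ⟨C, hC⟩ := exists_lintegral_rieszKernel_one_mul_density_le (F := F) hd
  have hε₂ : ε / 2 ≠ 0 := (ENNReal.half_pos hε).ne'
  set κ := ∫⁻ z in ball (0 : E) 1, rieszKernel 1 z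
  have hκ : κ ≠ ⊤ :=
    (setLIntegral_ball_rieszKernel_lt_top (by exact_mod_cast one_lt_two.trans hd)).ne
  obtain ⟨r, hr₀, -, hr⟩ := exists_pos_le_one_mul_ofReal_le (c := 2 * (C * K ^ 2))
    (by finiteness) hε₂
  obtain ⟨δ, hδ₀, hδ₁, hδ⟩ := exists_pos_le_one_mul_ofReal_le
    (c := 2 * (volume (ball (0 : E) r⁻¹) * K ^ 2 * κ))
    (by have := measure_ball_lt_top (μ := volume) (x := (0 : E)) (r := r⁻¹); finiteness) hε₂
  refine ⟨δ, hδ₀, fun f hfM hfT => ?_⟩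
  have h_pow : δ ^ (finrank ℝ E - 1 : ℝ) ≤ δ := by
    have hd' : (2 : ℝ) < finrank ℝ E := by exact_mod_cast hd
    simpa using Real.rpow_le_rpow_of_exponent_ge hδ₀ hδ₁ (by linarith : 1 ≤ (finrank ℝ E - 1 : ℝ))
  calc ∫⁻ x, density f x * ∫⁻ y in ball x δ, rieszKernel 1 (x - y) * density f y
      ≤ 2 * (volume (ball (0 : E) r⁻¹) * (∫⁻ x, density f x) ^ 2
          * ∫⁻ z in ball (0 : E) δ, rieszKernel 1 z)
        + 2 * (C * ekinetic f ^ 2 * ENNReal.ofReal r⁻¹⁻¹) :=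
        lintegral_density_mul_setLIntegral_ball_le (inv_pos.2 hr₀) (hC f)
    _ ≤ 2 * (volume (ball (0 : E) r⁻¹) * K ^ 2 * (ENNReal.ofReal δ * κ))
        + 2 * (C * K ^ 2 * ENNReal.ofReal r) := by
        rw [setLIntegral_ball_rieszKernel 1 hδ₀, inv_inv]
        gcongr
    _ = 2 * (volume (ball (0 : E) r⁻¹) * K ^ 2 * κ) * ENNReal.ofReal δ
        + 2 * (C * K ^ 2) * ENNReal.ofReal r := by ring
    _ ≤ ε / 2 + ε / 2 := add_le_add hδ hr
    _ = ε := ENNReal.add_halves ε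

end ShortRange

section Vanishing

variable {E F : Type*} [NormedAddCommGroup E]

lemma rieszKernel_one_le_of_le_norm {r : ℝ} (hr : 0 < r) {z : E} (hz : r ≤ ‖z‖) :
    rieszKernel 1 z ≤ ENNReal.ofReal r⁻¹ := by
  rw [rieszKernel, Real.rpow_one, one_div]
  exact ENNReal.ofReal_le_ofReal (inv_anti₀ hr hz)

lemma rieszKernel_one_sub_mul_le {δ R : ℝ} (hδ : 0 < δ) (hR : 0 < R) (g : E → ℝ≥0∞) (x y : E) :
    rieszKernel 1 (x - y) * g y
      ≤ (ball x δ).indicator (fun y => rieszKernel 1 (x - y) * g y) y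
        + (ENNReal.ofReal δ⁻¹ * (ball x R).indicator g y + ENNReal.ofReal R⁻¹ * g y) := by
  have h_far {r : ℝ} (hr : 0 < r) (hy : y ∉ ball x r) :
      rieszKernel 1 (x - y) * g y ≤ ENNReal.ofReal r⁻¹ * g y := by
    rw [mem_ball', dist_eq_norm, not_lt] at hy
    gcongr
    exact rieszKernel_one_le_of_le_norm hr hy
  by_cases h_near : y ∈ ball x δ
  · rw [Set.indicator_of_mem h_near]
    exact le_self_add
  by_cases h_mid : y ∈ ball x R
  · rw [Set.indicator_of_mem h_mid]
    exact le_add_left (le_add_right (h_far hδ h_near))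
  · exact le_add_left (le_add_left (h_far hR h_mid))

variable [InnerProductSpace ℝ E] [FiniteDimensional ℝ E] [MeasurableSpace E] [BorelSpace E]

lemma rieszPotential_one_le {δ R : ℝ} (hδ : 0 < δ) (hR : 0 < R) {g : E → ℝ≥0∞}
    (hg : Measurable g) (x : E) :
    rieszPotential 1 g x ≤ (∫⁻ y in ball x δ, rieszKernel 1 (x - y) * g y)
      + (ENNReal.ofReal δ⁻¹ * (∫⁻ y in ball x R, g y) + ENNReal.ofReal R⁻¹ * ∫⁻ y, g y) := by
  have h_meas : Measurable fun y => rieszKernel 1 (x - y) * g y :=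
    ((measurable_rieszKernel 1).comp (measurable_const.sub measurable_id)).mul hg
  refine (lintegral_mono fun y => rieszKernel_one_sub_mul_le hδ hR g x y).trans_eq ?_
  rw [lintegral_add_left (h_meas.indicator measurableSet_ball),
    lintegral_indicator measurableSet_ball,
    lintegral_add_left ((hg.indicator measurableSet_ball).const_mul _),
    lintegral_const_mul _ (hg.indicator measurableSet_ball),
    lintegral_indicator measurableSet_ball, lintegral_const_mul _ hg]

lemma rieszForm_one_le {δ R : ℝ} (hδ : 0 < δ) (hR : 0 < R) {g : E → ℝ≥0∞} (hg : Measurable g)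
    {c : ℝ≥0∞} (hc : ∀ a, ∫⁻ y in ball a R, g y ≤ c) :
    rieszForm 1 g g ≤ (∫⁻ x, g x * ∫⁻ y in ball x δ, rieszKernel 1 (x - y) * g y)
      + (∫⁻ x, g x) * (ENNReal.ofReal δ⁻¹ * c + ENNReal.ofReal R⁻¹ * ∫⁻ y, g y) := by
  rw [← lintegral_mul_const _ hg, ← lintegral_add_right _ (hg.mul_const _)]
  refine lintegral_mono fun x => ?_
  simp only [← mul_add]
  gcongr
  exact (rieszPotential_one_le hδ hR hg x).trans (by gcongr; exact hc x)

variable [NormedAddCommGroup F] [InnerProductSpace ℂ F] [CompleteSpace F]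

lemma exists_erieszEnergy_one_le_of_setLIntegral_ball_le (hd : 2 < finrank ℝ E) (K : ℝ≥0)
    {ε : ℝ≥0∞} (hε : ε ≠ 0) :
    ∃ R c : ℝ, 0 < c ∧ ∀ f : Lp F 2 (volume : Measure E),
      ∫⁻ x, density f x ≤ K → ekinetic f ≤ K →
      (∀ a, ∫⁻ y in ball a R, density f y ≤ ENNReal.ofReal c) → erieszEnergy 1 f ≤ ε := by
  have hε₂ : ε / 2 ≠ 0 := (ENNReal.half_pos hε).ne'
  have hε₄ : ε / 2 / 2 ≠ 0 := (ENNReal.half_pos hε₂).ne'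
  obtain ⟨δ, hδ₀, hδ⟩ :=
    exists_lintegral_density_mul_setLIntegral_ball_le (F := F) hd K hε₂
  obtain ⟨r, hr₀, -, hr⟩ := exists_pos_le_one_mul_ofReal_le (c := (K : ℝ≥0∞) ^ 2)
    (by finiteness) hε₄
  obtain ⟨c, hc₀, -, hc⟩ := exists_pos_le_one_mul_ofReal_le (c := K * ENNReal.ofReal δ⁻¹)
    (by finiteness) hε₄
  refine ⟨r⁻¹, c, hc₀, fun f hfM hfT hf => ?_⟩
  calc erieszEnergy 1 f
      ≤ (∫⁻ x, density f x * ∫⁻ y in ball x δ, rieszKernel 1 (x - y) * density f y)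
        + (∫⁻ x, density f x) * (ENNReal.ofReal δ⁻¹ * ENNReal.ofReal c
          + ENNReal.ofReal r⁻¹⁻¹ * ∫⁻ y, density f y) :=
        rieszForm_one_le hδ₀ (inv_pos.2 hr₀) (measurable_density f) hf
    _ ≤ ε / 2 + K * (ENNReal.ofReal δ⁻¹ * ENNReal.ofReal c + ENNReal.ofReal r * K) := by
        rw [inv_inv]
        gcongr
        exact hδ f hfM hfT
    _ = ε / 2 + (K * ENNReal.ofReal δ⁻¹ * ENNReal.ofReal c + K ^ 2 * ENNReal.ofReal r) := by ring
    _ ≤ ε / 2 + (ε / 2 / 2 + ε / 2 / 2) := by gcongr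
    _ = ε := by rw [ENNReal.add_halves, ENNReal.add_halves]

end Vanishing

section InvSqrtKinetic

lemma kineticSymbol_pos {m : ℝ} (hm : 0 < m) (ξ : R3) : 0 < kineticSymbol m ξ :=
  hm.trans_le (le_kineticSymbol m ξ)

lemma memLp_top_inv_sqrt_kineticSymbol {m : ℝ} (hm : 0 < m) :
    MemLp (fun ξ : R3 => (((√(kineticSymbol m ξ))⁻¹ : ℝ) : ℂ)) ∞ volume := by
  refine memLp_top_of_bound (C := (√m)⁻¹) ?_ (ae_of_all _ fun ξ => ?_)
  · exact (Complex.measurable_ofReal.comp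
      (continuous_kineticSymbol m).measurable.sqrt.inv).aestronglyMeasurable
  · rw [Complex.norm_real, Real.norm_of_nonneg (by positivity)]
    exact inv_anti₀ (Real.sqrt_pos.2 hm) (Real.sqrt_le_sqrt (le_kineticSymbol m ξ))

/-- The map `G ↦ (-Δ + m²)^(-1/4) 𝓕⁻¹ G` from the Fourier side, an isometry onto `H^(1/2)` normed
by `√(kinetic m)`. It turns weak convergence in `H^(1/2)` into weak convergence in `L²`. -/
def invSqrtKinetic {m : ℝ} (hm : 0 < m) : L2 →L[ℂ] L2 :=
  ((Lp.fourierTransformₗᵢ R3 ℂ).symm.toContinuousLinearEquiv : L2 →L[ℂ] L2) ∘L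
    (ContinuousLinearMap.lsmul ℂ ℂ).holderL volume ∞ 2 2
      (memLp_top_inv_sqrt_kineticSymbol hm).toLp

lemma fourier_invSqrtKinetic {m : ℝ} (hm : 0 < m) (G : L2) :
    (𝓕 (invSqrtKinetic hm G) : L2) =ᵐ[volume]
      fun ξ => (((√(kineticSymbol m ξ))⁻¹ : ℝ) : ℂ) * G ξ := by
  have h_mem := memLp_top_inv_sqrt_kineticSymbol hm
  have h_fourier : (𝓕 (invSqrtKinetic hm G) : L2)
      = (ContinuousLinearMap.lsmul ℂ ℂ).holder 2 h_mem.toLp G :=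
    (Lp.fourierTransformₗᵢ R3 ℂ).apply_symm_apply _
  rw [h_fourier]
  filter_upwards [(ContinuousLinearMap.lsmul ℂ ℂ).coeFn_holder (r := 2) h_mem.toLp G,
    h_mem.coeFn_toLp] with ξ h_holder h_toLp
  rw [h_holder, h_toLp, ContinuousLinearMap.lsmul_apply, smul_eq_mul]

lemma kineticSymbol_mul_norm_sq_fourier_invSqrtKinetic {m : ℝ} (hm : 0 < m) (G : L2) :
    ∀ᵐ ξ, kineticSymbol m ξ * ‖(𝓕 (invSqrtKinetic hm G) : L2) ξ‖ ^ 2 = ‖G ξ‖ ^ 2 := by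
  filter_upwards [fourier_invSqrtKinetic hm G] with ξ hξ
  have h_pos := kineticSymbol_pos hm ξ
  rw [hξ, norm_mul, mul_pow, Complex.norm_real, Real.norm_of_nonneg (by positivity), inv_pow,
    Real.sq_sqrt h_pos.le, mul_inv_cancel_left₀ h_pos.ne']

lemma kinetic_invSqrtKinetic {m : ℝ} (hm : 0 < m) (G : L2) :
    kinetic m (invSqrtKinetic hm G) = ‖G‖ ^ 2 := by
  rw [kinetic_eq, ← integral_norm_sq]
  exact integral_congr_ae (kineticSymbol_mul_norm_sq_fourier_invSqrtKinetic hm G)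

lemma enorm_le_ofReal_kineticSymbol (m : ℝ) (ξ : R3) :
    ‖ξ‖ₑ ≤ ENNReal.ofReal (kineticSymbol m ξ) := by
  rw [← ofReal_norm]
  refine ENNReal.ofReal_le_ofReal (le_trans ?_ (kineticSymbol_zero_le m ξ))
  rw [kineticSymbol_zero]
  exact le_mul_of_one_le_left (norm_nonneg ξ) (by linarith [Real.pi_gt_three])

lemma memHHalf_invSqrtKinetic {m : ℝ} (hm : 0 < m) (G : L2) :
    MemHHalf (invSqrtKinetic hm G) := by
  rw [memHHalf_iff_ekinetic_lt_top]
  refine (lintegral_mono_ae ?_).trans_lt (lintegral_density_ne_top G).lt_top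
  filter_upwards [kineticSymbol_mul_norm_sq_fourier_invSqrtKinetic hm G] with ξ hξ
  rw [← ofReal_norm_sq G, ← hξ, ENNReal.ofReal_mul (kineticSymbol_nonneg m ξ), ofReal_norm_sq]
  gcongr
  exact enorm_le_ofReal_kineticSymbol m ξ

lemma memLp_sqrt_kineticSymbol_mul_fourier (m : ℝ) {f : L2} (hf : MemHHalf f) :
    MemLp (fun ξ => ((√(kineticSymbol m ξ) : ℝ) : ℂ) * (𝓕 f : L2) ξ) 2 volume := by
  have h_meas : AEStronglyMeasurable
      (fun ξ => ((√(kineticSymbol m ξ) : ℝ) : ℂ) * (𝓕 f : L2) ξ) volume :=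
    (Complex.continuous_ofReal.comp
      (continuous_kineticSymbol m).sqrt).aestronglyMeasurable.mul (Lp.aestronglyMeasurable _)
  rw [memLp_two_iff_integrable_sq_norm h_meas]
  refine (integrable_kineticSymbol_mul_fourier m hf).congr (ae_of_all _ fun ξ => ?_)
  beta_reduce
  rw [norm_mul, mul_pow, Complex.norm_real, Real.norm_of_nonneg (by positivity),
    Real.sq_sqrt (kineticSymbol_nonneg m ξ)]

lemma exists_invSqrtKinetic_eq {m : ℝ} (hm : 0 < m) {f : L2} (hf : MemHHalf f) :
    ∃ G : L2, invSqrtKinetic hm G = f := by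
  have h_mem := memLp_sqrt_kineticSymbol_mul_fourier m hf
  refine ⟨h_mem.toLp, (Lp.fourierTransformₗᵢ R3 ℂ).injective (Lp.ext ?_)⟩
  filter_upwards [fourier_invSqrtKinetic hm h_mem.toLp, h_mem.coeFn_toLp] with ξ h_inv h_toLp
  have h_ne : (√(kineticSymbol m ξ) : ℂ) ≠ 0 := by
    exact_mod_cast (Real.sqrt_pos.2 (kineticSymbol_pos hm ξ)).ne'
  change (𝓕 (invSqrtKinetic hm h_mem.toLp) : L2) ξ = (𝓕 f : L2) ξ
  rw [h_inv, h_toLp, Complex.ofReal_inv, inv_mul_cancel_left₀ h_ne]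

end InvSqrtKinetic

section WeakConvergence

variable {H H' : Type*} [NormedAddCommGroup H] [InnerProductSpace ℂ H] [NormedAddCommGroup H']
  [InnerProductSpace ℂ H']

/-- Weak convergence of a sequence in a complex Hilbert space. -/
def WeaklyTendsto (f : ℕ → H) (g : H) : Prop :=
  ∀ h : H, Tendsto (fun n => inner ℂ h (f n)) atTop (𝓝 (inner ℂ h g))

lemma exists_weaklyTendsto_subseq [CompleteSpace H] [TopologicalSpace.SeparableSpace H]
    (f : ℕ → H) {K : ℝ} (hK : ∀ n, ‖f n‖ ≤ K) :
    ∃ (k : ℕ → ℕ) (g : H), StrictMono k ∧ WeaklyTendsto (fun n => f (k n)) g := by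
  let x (n : ℕ) : WeakDual ℂ H := StrongDual.toWeakDual (InnerProductSpace.toDual ℂ H (f n))
  have hx (n : ℕ) : x n ∈ WeakDual.toStrongDual ⁻¹' closedBall (0 : StrongDual ℂ H) K := by
    rw [Set.mem_preimage, mem_closedBall_zero_iff]
    exact ((InnerProductSpace.toDual ℂ H).norm_map (f n)).trans_le (hK n)
  obtain ⟨L, -, k, hk, h_lim⟩ := WeakDual.isSeqCompact_closedBall ℂ H 0 K hx
  refine ⟨k, (InnerProductSpace.toDual ℂ H).symm (WeakDual.toStrongDual L), hk, fun h => ?_⟩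
  have h_inner : Tendsto (fun n => inner ℂ (f (k n)) h) atTop
      (𝓝 (inner ℂ ((InnerProductSpace.toDual ℂ H).symm (WeakDual.toStrongDual L)) h)) := by
    rw [InnerProductSpace.toDual_symm_apply]
    exact ((WeakDual.eval_continuous h).tendsto L).comp h_lim
  simpa only [Function.comp_def, inner_conj_symm]
    using (Complex.continuous_conj.tendsto _).comp h_inner

lemma WeaklyTendsto.map [CompleteSpace H] [CompleteSpace H'] {f : ℕ → H} {g : H}
    (h : WeaklyTendsto f g) (T : H →L[ℂ] H') : WeaklyTendsto (fun n => T (f n)) (T g) := by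
  intro v
  simp only [← ContinuousLinearMap.adjoint_inner_left]
  exact h _

lemma WeaklyTendsto.sub_limit {f : ℕ → H} {g : H} (h : WeaklyTendsto f g) :
    WeaklyTendsto (fun n => f n - g) 0 := by
  intro v
  simpa only [inner_sub_right, sub_self, inner_zero_right] using (h v).sub_const (inner ℂ v g)

lemma WeaklyTendsto.tendsto_norm_sq_sub {f : ℕ → H} {g : H} (h : WeaklyTendsto f g) :
    Tendsto (fun n => ‖f n‖ ^ 2 - ‖g‖ ^ 2 - ‖f n - g‖ ^ 2) atTop (𝓝 0) := by
  have h_eq (n : ℕ) :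
      ‖f n‖ ^ 2 - ‖g‖ ^ 2 - ‖f n - g‖ ^ 2 = 2 * (inner ℂ g (f n - g)).re := by
    have h_add := norm_add_sq (𝕜 := ℂ) g (f n - g)
    rw [add_sub_cancel, RCLike.re_to_complex] at h_add
    rw [h_add]
    ring
  simp_rw [h_eq]
  simpa only [Function.comp_def, inner_zero_right, Complex.zero_re, mul_zero]
    using ((Complex.continuous_re.tendsto _).comp (h.sub_limit g)).const_mul 2

end WeakConvergence

section Rellich

variable {E : Type*} [NormedAddCommGroup E] [InnerProductSpace ℝ E] [FiniteDimensional ℝ E]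
  [MeasurableSpace E] [BorelSpace E]

lemma WeaklyTendsto.tendsto_setIntegral_fourier {u : ℕ → Lp ℂ 2 (volume : Measure E)}
    (hu : WeaklyTendsto u 0) (A : ℝ) (x : E) :
    Tendsto (fun n => ∫ ξ in ball (0 : E) A, Real.fourierChar ⟪ξ, x⟫ • 𝓕 (u n) ξ)
      atTop (𝓝 0) := by
  let χ : E → ℂ := fun ξ => (starRingEnd ℂ) (Real.fourierChar ⟪ξ, x⟫ : ℂ)
  have hχ : Continuous χ := Complex.continuous_conj.comp
    (continuous_subtype_val.comp (Real.continuous_fourierChar.comp (by fun_prop)))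
  have h_mem : MemLp ((ball (0 : E) A).indicator χ) 2 volume := by
    rw [memLp_indicator_iff_restrict measurableSet_ball]
    have : IsFiniteMeasure (volume.restrict (ball (0 : E) A)) :=
      ⟨by rw [Measure.restrict_apply_univ]; exact measure_ball_lt_top⟩
    refine MemLp.of_bound hχ.aestronglyMeasurable 1 (ae_of_all _ fun ξ => ?_)
    rw [RCLike.norm_conj, Circle.norm_coe]
  have h_inner (n : ℕ) : inner ℂ h_mem.toLp (𝓕 (u n)) =
      ∫ ξ in ball (0 : E) A, Real.fourierChar ⟪ξ, x⟫ • 𝓕 (u n) ξ := by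
    rw [L2.inner_def, ← integral_indicator measurableSet_ball]
    apply integral_congr_ae
    filter_upwards [h_mem.coeFn_toLp] with ξ hξ
    rw [hξ]
    by_cases hξA : ξ ∈ ball (0 : E) A
    · simp only [Set.indicator_of_mem hξA, RCLike.inner_apply, χ, Complex.conj_conj,
        Circle.smul_def, smul_eq_mul, mul_comm]
    · simp only [Set.indicator_of_notMem hξA, inner_zero_left]
  have h_lim := hu.map ((Lp.fourierTransformₗᵢ E ℂ).toContinuousLinearEquiv :
    Lp ℂ 2 (volume : Measure E) →L[ℂ] Lp ℂ 2 (volume : Measure E)) h_mem.toLp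
  simp only [map_zero, inner_zero_right] at h_lim
  exact h_lim.congr h_inner

lemma WeaklyTendsto.tendsto_setLIntegral_density_lowPass
    {u : ℕ → Lp ℂ 2 (volume : Measure E)} (hu : WeaklyTendsto u 0) {K : ℝ≥0}
    (hK : ∀ n, ∫⁻ x, density (u n) x ≤ K) (A R : ℝ) :
    Tendsto (fun n => ∫⁻ x in ball (0 : E) R, density (lowPass A (u n)) x) atTop (𝓝 0) := by
  rw [← lintegral_zero (μ := volume.restrict (ball (0 : E) R))]
  refine tendsto_lintegral_of_dominated_convergence (fun _ => volume (ball (0 : E) A) * K)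
    (fun n => measurable_density _) (fun n => ae_restrict_of_ae ?_) ?_ (ae_restrict_of_ae ?_)
  · filter_upwards [density_lowPass_le_volume_mul A (u n)] with x hx
    exact hx.trans (by gcongr; exact hK n)
  · rw [setLIntegral_const]
    exact ENNReal.mul_ne_top (ENNReal.mul_ne_top measure_ball_lt_top.ne ENNReal.coe_ne_top)
      measure_ball_lt_top.ne
  · filter_upwards [ae_all_iff.2 fun n => lowPass_ae_eq_setIntegral A (u n)] with x hx
    simp only [density, hx]
    have h := ((ENNReal.continuous_pow 2).tendsto _).comp
      ((continuous_enorm.tendsto _).comp (hu.tendsto_setIntegral_fourier A x))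
    simpa only [Function.comp_def, enorm_zero, zero_pow two_ne_zero] using h

theorem WeaklyTendsto.tendsto_setLIntegral_ball_density
    {u : ℕ → Lp ℂ 2 (volume : Measure E)} (hu : WeaklyTendsto u 0) {K : ℝ≥0}
    (hK : ∀ n, ∫⁻ x, density (u n) x ≤ K) (hT : ∀ n, ekinetic (u n) ≤ K) (R : ℝ) :
    Tendsto (fun n => ∫⁻ x in ball (0 : E) R, density (u n) x) atTop (𝓝 0) := by
  rw [ENNReal.tendsto_nhds_zero]
  intro ε hε
  have hε₂ : 0 < ε / 2 := ENNReal.half_pos hε.ne'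
  obtain ⟨r, hr₀, -, hr⟩ := exists_pos_le_one_mul_ofReal_le (c := 2 * K) (by finiteness) hε₂.ne'
  have h_low := ENNReal.Tendsto.const_mul (a := 2)
    (hu.tendsto_setLIntegral_density_lowPass hK r⁻¹ R) (Or.inr ENNReal.ofNat_ne_top)
  rw [mul_zero] at h_low
  filter_upwards [ENNReal.tendsto_nhds_zero.1 h_low (ε / 2) hε₂] with n hn
  have h_high : ∫⁻ x in ball (0 : E) R, density (highPass r⁻¹ (u n)) x ≤ ENNReal.ofReal r * K :=
    calc ∫⁻ x in ball (0 : E) R, density (highPass r⁻¹ (u n)) x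
        ≤ ∫⁻ x, density (highPass r⁻¹ (u n)) x := setLIntegral_le_lintegral _ _
      _ ≤ ENNReal.ofReal r⁻¹⁻¹ * ekinetic (u n) :=
          lintegral_density_highPass_le_ekinetic (inv_pos.2 hr₀) (u n)
      _ ≤ ENNReal.ofReal r * K := by
          rw [inv_inv]
          gcongr
          exact hT n
  have h_split := setLIntegral_density_add_le (lowPass r⁻¹ (u n)) (highPass r⁻¹ (u n))
    (ball (0 : E) R)
  rw [lowPass_add_highPass] at h_split
  calc ∫⁻ x in ball (0 : E) R, density (u n) x
      ≤ 2 * (∫⁻ x in ball (0 : E) R, density (lowPass r⁻¹ (u n)) x)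
        + 2 * ∫⁻ x in ball (0 : E) R, density (highPass r⁻¹ (u n)) x := h_split
    _ ≤ ε / 2 + 2 * (ENNReal.ofReal r * K) := by gcongr
    _ = ε / 2 + 2 * K * ENNReal.ofReal r := by ring
    _ ≤ ε / 2 + ε / 2 := by gcongr
    _ = ε := ENNReal.add_halves ε

end Rellich

section CrossDensity

variable {X F : Type*} [MeasurableSpace X] {μ : Measure X} [NormedAddCommGroup F]

/-- The bound `2 |f| |u|` for the cross term in the expansion of `|f + u|²`. -/
def crossDensity (f u : Lp F 2 μ) (x : X) : ℝ≥0∞ := 2 * (‖f x‖ₑ * ‖u x‖ₑ)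

lemma measurable_crossDensity (f u : Lp F 2 μ) : Measurable (crossDensity f u) :=
  ((Lp.stronglyMeasurable f).enorm.mul (Lp.stronglyMeasurable u).enorm).const_mul 2

lemma density_add_le_add_crossDensity (f u : Lp F 2 μ) :
    density (f + u) ≤ᵐ[μ] density f + density u + crossDensity f u := by
  filter_upwards [Lp.coeFn_add f u] with x hx
  calc density (f + u) x = ‖f x + u x‖ₑ ^ 2 := by rw [density, hx, Pi.add_apply]
    _ ≤ (‖f x‖ₑ + ‖u x‖ₑ) ^ 2 := by gcongr; exact enorm_add_le _ _
    _ = (density f + density u + crossDensity f u) x := by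
        simp only [Pi.add_apply, density, crossDensity]
        ring

lemma density_add_density_le (f u : Lp F 2 μ) :
    density f + density u ≤ᵐ[μ] density (f + u) + crossDensity f u := by
  filter_upwards [Lp.coeFn_add f u] with x hx
  have h : (‖f x‖ - ‖u x‖) ^ 2 ≤ ‖f x + u x‖ ^ 2 := by
    have := abs_norm_sub_norm_le (f x) (-u x)
    rw [norm_neg, sub_neg_eq_add] at this
    exact sq_le_sq.2 (this.trans (le_abs_self _))
  have h_cross : crossDensity f u x = ENNReal.ofReal (2 * (‖f x‖ * ‖u x‖)) := by
    rw [crossDensity, ENNReal.ofReal_mul zero_le_two, ENNReal.ofReal_mul (norm_nonneg _),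
      ofReal_norm, ofReal_norm, ENNReal.ofReal_ofNat]
  simp only [Pi.add_apply, ← ofReal_norm_sq, h_cross, hx]
  rw [← ENNReal.ofReal_add (by positivity) (by positivity),
    ← ENNReal.ofReal_add (by positivity) (by positivity)]
  exact ENNReal.ofReal_le_ofReal (by linarith)

lemma sq_setLIntegral_crossDensity_le (f u : Lp F 2 μ) (S : Set X) :
    (∫⁻ x in S, crossDensity f u x ∂μ) ^ 2
      ≤ 4 * ((∫⁻ x in S, density f x ∂μ) * ∫⁻ x in S, density u x ∂μ) := by
  have hf : Measurable fun x => ‖f x‖ₑ := (Lp.stronglyMeasurable f).enorm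
  have hu : Measurable fun x => ‖u x‖ₑ := (Lp.stronglyMeasurable u).enorm
  have hfu : Measurable fun x => ‖f x‖ₑ * ‖u x‖ₑ := hf.mul hu
  calc (∫⁻ x in S, crossDensity f u x ∂μ) ^ 2
      = 4 * (∫⁻ x in S, ‖f x‖ₑ * ‖u x‖ₑ ∂μ) ^ 2 := by
        simp only [crossDensity]
        rw [lintegral_const_mul _ hfu, mul_pow]
        norm_num
    _ ≤ 4 * ((∫⁻ x in S, density f x ∂μ) * ∫⁻ x in S, density u x ∂μ) := by
        gcongr
        exact lintegral_mul_sq_le hf.aemeasurable hu.aemeasurable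

end CrossDensity

section LocallyVanishing

lemma tendsto_zero_of_forall_le_add {ι : Type*} {l : Filter ι} {a : ι → ℝ≥0∞}
    {b : ℕ → ι → ℝ≥0∞} {c : ℕ → ℝ≥0∞} (hb : ∀ k, Tendsto (b k) l (𝓝 0))
    (hc : Tendsto c atTop (𝓝 0)) (h : ∀ k i, a i ≤ b k i + c k) : Tendsto a l (𝓝 0) := by
  rw [ENNReal.tendsto_nhds_zero]
  intro ε hε
  have hε₂ : 0 < ε / 2 := ENNReal.half_pos hε.ne'
  obtain ⟨k, hk⟩ := (ENNReal.tendsto_nhds_zero.1 hc (ε / 2) hε₂).exists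
  filter_upwards [ENNReal.tendsto_nhds_zero.1 (hb k) (ε / 2) hε₂] with i hi
  exact (h k i).trans ((add_le_add hi hk).trans_eq (ENNReal.add_halves ε))

variable {E F : Type*} [NormedAddCommGroup E] [InnerProductSpace ℝ E] [FiniteDimensional ℝ E]
  [MeasurableSpace E] [BorelSpace E] [NormedAddCommGroup F]

lemma tendsto_setLIntegral_compl_ball {g : E → ℝ≥0∞} (hg : Measurable g)
    (hg_fin : ∫⁻ x, g x ≠ ⊤) :
    Tendsto (fun n : ℕ => ∫⁻ x in (ball (0 : E) n)ᶜ, g x) atTop (𝓝 0) := by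
  simp only [← lintegral_indicator measurableSet_ball.compl]
  rw [← lintegral_zero (μ := (volume : Measure E))]
  refine tendsto_lintegral_of_dominated_convergence g
    (fun n => hg.indicator measurableSet_ball.compl)
    (fun n => ae_of_all _ fun x => Set.indicator_le_self _ _ _) hg_fin (ae_of_all _ fun x => ?_)
  refine tendsto_const_nhds.congr' ?_
  filter_upwards [eventually_gt_atTop ⌈‖x‖⌉₊] with n hn
  rw [Set.indicator_of_notMem]
  exact not_not_intro (mem_ball_zero_iff.2 (Nat.lt_of_ceil_lt hn))

lemma sq_lintegral_crossDensity_le (f u : Lp F 2 (volume : Measure E)) (S : Set E)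
    (hS : MeasurableSet S) :
    (∫⁻ x, crossDensity f u x) ^ 2
      ≤ 8 * ((∫⁻ x, density f x) * ∫⁻ x in S, density u x)
        + 8 * ((∫⁻ x in Sᶜ, density f x) * ∫⁻ x, density u x) := by
  have h_sq : ∀ a b : ℝ≥0∞, (a + b) ^ 2 ≤ 2 * (a ^ 2 + b ^ 2) := fun a b => by
    have h := ENNReal.rpow_add_le_mul_rpow_add_rpow a b one_le_two
    norm_num at h
    exact h
  calc (∫⁻ x, crossDensity f u x) ^ 2
      = ((∫⁻ x in S, crossDensity f u x) + ∫⁻ x in Sᶜ, crossDensity f u x) ^ 2 := by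
        rw [lintegral_add_compl _ hS]
    _ ≤ 2 * ((∫⁻ x in S, crossDensity f u x) ^ 2 + (∫⁻ x in Sᶜ, crossDensity f u x) ^ 2) :=
        h_sq _ _
    _ ≤ 2 * (4 * ((∫⁻ x in S, density f x) * ∫⁻ x in S, density u x)
        + 4 * ((∫⁻ x in Sᶜ, density f x) * ∫⁻ x in Sᶜ, density u x)) := by
        gcongr <;> exact sq_setLIntegral_crossDensity_le f u _
    _ ≤ 2 * (4 * ((∫⁻ x, density f x) * ∫⁻ x in S, density u x)
        + 4 * ((∫⁻ x in Sᶜ, density f x) * ∫⁻ x, density u x)) := by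
        gcongr <;> exact Measure.restrict_le_self
    _ = 8 * ((∫⁻ x, density f x) * ∫⁻ x in S, density u x)
        + 8 * ((∫⁻ x in Sᶜ, density f x) * ∫⁻ x, density u x) := by ring

lemma tendsto_lintegral_crossDensity (f : Lp F 2 (volume : Measure E))
    {u : ℕ → Lp F 2 (volume : Measure E)} {K : ℝ≥0} (hK : ∀ n, ∫⁻ x, density (u n) x ≤ K)
    (hu : ∀ R, Tendsto (fun n => ∫⁻ x in ball (0 : E) R, density (u n) x) atTop (𝓝 0)) :
    Tendsto (fun n => ∫⁻ x, crossDensity f (u n) x) atTop (𝓝 0) := by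
  have h_sq : Tendsto (fun n => (∫⁻ x, crossDensity f (u n) x) ^ 2) atTop (𝓝 0) := by
    refine tendsto_zero_of_forall_le_add
      (b := fun k n => 8 * ((∫⁻ x, density f x) * ∫⁻ x in ball (0 : E) k, density (u n) x))
      (c := fun k => 8 * ((∫⁻ x in (ball (0 : E) k)ᶜ, density f x) * K))
      (fun k => ?_) ?_ fun k n => ?_
    · simpa only [mul_zero] using ENNReal.Tendsto.const_mul (a := 8) (ENNReal.Tendsto.const_mul
        (hu k) (Or.inr (lintegral_density_ne_top f))) (Or.inr ENNReal.ofNat_ne_top)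
    · have h := tendsto_setLIntegral_compl_ball (measurable_density f) (lintegral_density_ne_top f)
      simpa only [zero_mul, mul_zero] using ENNReal.Tendsto.const_mul (a := 8)
        (ENNReal.Tendsto.mul_const h (Or.inr ENNReal.coe_ne_top)) (Or.inr ENNReal.ofNat_ne_top)
    · refine (sq_lintegral_crossDensity_le f (u n) (ball 0 k) measurableSet_ball).trans ?_
      gcongr
      exact hK n
  have h := h_sq.ennrpow_const ((2 : ℕ) : ℝ)⁻¹
  rwa [ENNReal.zero_rpow_of_pos (by norm_num),
    funext fun n => ENNReal.pow_rpow_inv_natCast two_ne_zero (∫⁻ x, crossDensity f (u n) x)] at h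

end LocallyVanishing

section RieszSplitting

variable {E F : Type*} [NormedAddCommGroup E] [InnerProductSpace ℝ E] [FiniteDimensional ℝ E]
  [MeasurableSpace E] [BorelSpace E] [NormedAddCommGroup F]

lemma rieszPotential_indicator_compl_ball_le {s : ℝ} (hs : 0 ≤ s) {R D : ℝ} (hD : 0 < D)
    {h : E → ℝ≥0∞} (hh : Measurable h) {x : E} (hx : x ∈ ball (0 : E) R) :
    rieszPotential s ((ball (0 : E) (R + D))ᶜ.indicator h) x
      ≤ ENNReal.ofReal (D ^ (-s)) * ∫⁻ y, h y := by
  rw [rieszPotential, ← lintegral_const_mul _ hh]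
  refine lintegral_mono fun y => ?_
  by_cases hy : y ∈ (ball (0 : E) (R + D))ᶜ
  · simp only [Set.indicator_of_mem hy, rieszKernel]
    gcongr
    have hxy : D ≤ ‖x - y‖ := by
      rw [Set.mem_compl_iff, mem_ball_zero_iff, not_lt] at hy
      have h_tri := norm_sub_norm_le y x
      rw [norm_sub_rev] at h_tri
      linarith [mem_ball_zero_iff.1 hx]
    rw [Real.rpow_neg hD.le, one_div]
    gcongr
  · simp only [Set.indicator_of_notMem hy, mul_zero, zero_le]

lemma rieszForm_indicator_ball_compl_le {s : ℝ} (hs : 0 ≤ s) {R D : ℝ} (hD : 0 < D)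
    {g h : E → ℝ≥0∞} (hg : Measurable g) (hh : Measurable h) :
    rieszForm s ((ball (0 : E) R).indicator g) ((ball (0 : E) (R + D))ᶜ.indicator h)
      ≤ ENNReal.ofReal (D ^ (-s)) * ((∫⁻ x, g x) * ∫⁻ x, h x) := by
  calc rieszForm s ((ball (0 : E) R).indicator g) ((ball (0 : E) (R + D))ᶜ.indicator h)
      ≤ ∫⁻ x, g x * (ENNReal.ofReal (D ^ (-s)) * ∫⁻ y, h y) := by
        refine lintegral_mono fun x => ?_
        by_cases hx : x ∈ ball (0 : E) R
        · simp only [Set.indicator_of_mem hx]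
          gcongr
          exact rieszPotential_indicator_compl_ball_le hs hD hh hx
        · simp only [Set.indicator_of_notMem hx, zero_mul, zero_le]
    _ = ENNReal.ofReal (D ^ (-s)) * ((∫⁻ x, g x) * ∫⁻ x, h x) := by
        rw [lintegral_mul_const _ hg]
        ring

lemma rieszForm_le_add_add {s : ℝ} (hs : 0 ≤ s) {R D : ℝ} (hD : 0 < D) {g h : E → ℝ≥0∞}
    (hg : Measurable g) (hh : Measurable h) {P : ℝ≥0∞} (hgP : ∀ x, rieszPotential s g x ≤ P)
    (hhP : ∀ x, rieszPotential s h x ≤ P) :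
    rieszForm s g h ≤ (∫⁻ x in ball (0 : E) (R + D), h x) * P
      + (ENNReal.ofReal (D ^ (-s)) * ((∫⁻ x, g x) * ∫⁻ x, h x)
        + (∫⁻ x in (ball (0 : E) R)ᶜ, g x) * P) := by
  set gin := (ball (0 : E) R).indicator g with hgin
  set gout := (ball (0 : E) R)ᶜ.indicator g with hgout
  set hin := (ball (0 : E) (R + D)).indicator h with hhin
  set hout := (ball (0 : E) (R + D))ᶜ.indicator h with hhout
  have mgin : Measurable gin := hg.indicator measurableSet_ball
  have mhin : Measurable hin := hh.indicator measurableSet_ball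
  have h_near : rieszForm s gin hin ≤ (∫⁻ x in ball (0 : E) (R + D), h x) * P := by
    rw [rieszForm_comm s mgin mhin, ← lintegral_indicator measurableSet_ball]
    exact rieszForm_le_of_rieszPotential_le s mhin fun x => (rieszPotential_mono s
      (ae_of_all _ fun y => Set.indicator_le_self _ _ _) x).trans (hgP x)
  have h_far : rieszForm s gout h ≤ (∫⁻ x in (ball (0 : E) R)ᶜ, g x) * P := by
    rw [← lintegral_indicator measurableSet_ball.compl]
    exact rieszForm_le_of_rieszPotential_le s (hg.indicator measurableSet_ball.compl) hhP
  calc rieszForm s g h = rieszForm s gin hin + (rieszForm s gin hout + rieszForm s gout h) := by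
        rw [← add_assoc, ← rieszForm_add_right s mgin mhin, hhin, hhout,
          Set.indicator_self_add_compl, ← rieszForm_add_left s mgin hh, hgin, hgout,
          Set.indicator_self_add_compl]
    _ ≤ _ := add_le_add h_near
        (add_le_add (rieszForm_indicator_ball_compl_le hs hD hg hh) h_far)

lemma tendsto_rieszForm {s : ℝ} (hs : 0 < s) {g : E → ℝ≥0∞} (hg : Measurable g)
    (hg_fin : ∫⁻ x, g x ≠ ⊤) {h : ℕ → E → ℝ≥0∞} (hh : ∀ n, Measurable (h n)) {K P : ℝ≥0}
    (hK : ∀ n, ∫⁻ x, h n x ≤ K) (hgP : ∀ x, rieszPotential s g x ≤ P)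
    (hhP : ∀ n x, rieszPotential s (h n) x ≤ P)
    (h_loc : ∀ R, Tendsto (fun n => ∫⁻ x in ball (0 : E) R, h n x) atTop (𝓝 0)) :
    Tendsto (fun n => rieszForm s g (h n)) atTop (𝓝 0) := by
  refine tendsto_zero_of_forall_le_add
    (b := fun k n => (∫⁻ x in ball (0 : E) ((k : ℝ) + (k + 1)), h n x) * P)
    (c := fun k => ENNReal.ofReal (((k : ℝ) + 1) ^ (-s)) * ((∫⁻ x, g x) * K)
      + (∫⁻ x in (ball (0 : E) k)ᶜ, g x) * P) (fun k => ?_) ?_ fun k n => ?_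
  · simpa only [zero_mul] using ENNReal.Tendsto.mul_const (h_loc _) (Or.inr ENNReal.coe_ne_top)
  · have h_pow : Tendsto (fun k : ℕ => ENNReal.ofReal (((k : ℝ) + 1) ^ (-s))) atTop (𝓝 0) := by
      simpa only [ENNReal.ofReal_zero, Function.comp_def] using ENNReal.tendsto_ofReal
        ((tendsto_rpow_neg_atTop hs).comp (tendsto_atTop_add_const_right _ 1
          tendsto_natCast_atTop_atTop))
    simpa only [zero_mul, add_zero] using
      (ENNReal.Tendsto.mul_const h_pow (Or.inr (ENNReal.mul_ne_top hg_fin ENNReal.coe_ne_top))).add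
        (ENNReal.Tendsto.mul_const (tendsto_setLIntegral_compl_ball hg hg_fin)
          (Or.inr ENNReal.coe_ne_top))
  · refine (rieszForm_le_add_add (R := k) (D := k + 1) hs.le (by positivity) hg (hh n) hgP
      (hhP n)).trans ?_
    gcongr
    exact hK n

lemma rieszForm_crossDensity_le (s : ℝ) (f u : Lp F 2 (volume : Measure E)) {P : ℝ≥0∞}
    (hf : ∀ x, rieszPotential s (density f) x ≤ P)
    (hu : ∀ x, rieszPotential s (density u) x ≤ P)
    (hfu : ∀ x, rieszPotential s (density (f + u)) x ≤ P) :
    rieszForm s (crossDensity f u) (density f) + rieszForm s (crossDensity f u) (density u)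
      + rieszForm s (crossDensity f u) (density (f + u))
      ≤ 3 * ((∫⁻ x, crossDensity f u x) * P) := by
  have h_le : ∀ {h : E → ℝ≥0∞}, (∀ x, rieszPotential s h x ≤ P) →
      rieszForm s (crossDensity f u) h ≤ (∫⁻ x, crossDensity f u x) * P :=
    rieszForm_le_of_rieszPotential_le s (measurable_crossDensity f u)
  calc _ ≤ (∫⁻ x, crossDensity f u x) * P + (∫⁻ x, crossDensity f u x) * P
        + (∫⁻ x, crossDensity f u x) * P :=
        add_le_add (add_le_add (h_le hf) (h_le hu)) (h_le hfu)
    _ = 3 * ((∫⁻ x, crossDensity f u x) * P) := by ring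

lemma erieszEnergy_add_le (s : ℝ) (f u : Lp F 2 (volume : Measure E)) {P : ℝ≥0∞}
    (hf : ∀ x, rieszPotential s (density f) x ≤ P)
    (hu : ∀ x, rieszPotential s (density u) x ≤ P)
    (hfu : ∀ x, rieszPotential s (density (f + u)) x ≤ P) :
    erieszEnergy s (f + u) ≤ erieszEnergy s f + erieszEnergy s u
      + (2 * rieszForm s (density f) (density u) + 3 * ((∫⁻ x, crossDensity f u x) * P)) := by
  have mf := measurable_density f
  have mu := measurable_density u
  have mfu := measurable_density (f + u)
  have mc := measurable_crossDensity f u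
  have h_le := density_add_le_add_crossDensity f u
  set c := crossDensity f u
  calc erieszEnergy s (f + u)
      ≤ rieszForm s (density (f + u)) (density f + density u + c) :=
        rieszForm_mono s (ae_of_all _ fun _ => le_rfl) h_le
    _ = rieszForm s (density (f + u)) (density f + density u)
        + rieszForm s c (density (f + u)) := by
        rw [rieszForm_add_right s mfu (mf.add mu), rieszForm_comm s mfu mc]
    _ ≤ rieszForm s (density f + density u + c) (density f + density u)
        + rieszForm s c (density (f + u)) := by
        gcongr
        exact rieszForm_mono s h_le (ae_of_all _ fun _ => le_rfl)
    _ = erieszEnergy s f + erieszEnergy s u + (2 * rieszForm s (density f) (density u)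
        + (rieszForm s c (density f) + rieszForm s c (density u)
          + rieszForm s c (density (f + u)))) := by
        rw [rieszForm_add_left s (mf.add mu) (mf.add mu), rieszForm_add_left s mf (mf.add mu),
          rieszForm_add_right s mf mf, rieszForm_add_right s mu mf, rieszForm_add_right s mc mf,
          rieszForm_comm s mu mf, erieszEnergy, erieszEnergy]
        ring
    _ ≤ _ := by
        gcongr
        exact rieszForm_crossDensity_le s f u hf hu hfu

lemma erieszEnergy_add_erieszEnergy_le (s : ℝ) (f u : Lp F 2 (volume : Measure E)) {P : ℝ≥0∞}
    (hf : ∀ x, rieszPotential s (density f) x ≤ P)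
    (hu : ∀ x, rieszPotential s (density u) x ≤ P)
    (hfu : ∀ x, rieszPotential s (density (f + u)) x ≤ P) :
    erieszEnergy s f + erieszEnergy s u
      ≤ erieszEnergy s (f + u) + 3 * ((∫⁻ x, crossDensity f u x) * P) := by
  have mf := measurable_density f
  have mu := measurable_density u
  have mfu := measurable_density (f + u)
  have mc := measurable_crossDensity f u
  have h_le := density_add_density_le f u
  set c := crossDensity f u
  calc erieszEnergy s f + erieszEnergy s u
      ≤ erieszEnergy s f + rieszForm s (density f) (density u)
        + (rieszForm s (density u) (density f) + erieszEnergy s u) :=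
        add_le_add le_self_add le_add_self
    _ = rieszForm s (density f + density u) (density f + density u) := by
        rw [rieszForm_add_left s mf (mf.add mu), rieszForm_add_right s mf mf,
          rieszForm_add_right s mu mf, erieszEnergy, erieszEnergy]
    _ ≤ rieszForm s (density (f + u) + c) (density f + density u) :=
        rieszForm_mono s h_le (ae_of_all _ fun _ => le_rfl)
    _ = rieszForm s (density (f + u)) (density f + density u)
        + (rieszForm s c (density f) + rieszForm s c (density u)) := by
        rw [rieszForm_add_left s mfu (mf.add mu), rieszForm_add_right s mc mf]
    _ ≤ rieszForm s (density (f + u)) (density (f + u) + c)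
        + (rieszForm s c (density f) + rieszForm s c (density u)) := by
        gcongr
        exact rieszForm_mono s (ae_of_all _ fun _ => le_rfl) h_le
    _ = erieszEnergy s (f + u) + (rieszForm s c (density f) + rieszForm s c (density u)
        + rieszForm s c (density (f + u))) := by
        rw [rieszForm_add_right s mfu mfu, rieszForm_comm s mfu mc, erieszEnergy]
        ring
    _ ≤ _ := by
        gcongr
        exact rieszForm_crossDensity_le s f u hf hu hfu

lemma abs_rieszEnergy_add_sub_le {s : ℝ} {f u : Lp F 2 (volume : Measure E)} {P ε : ℝ≥0∞}
    (hP : P ≠ ⊤) (hf : ∀ x, rieszPotential s (density f) x ≤ P)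
    (hu : ∀ x, rieszPotential s (density u) x ≤ P)
    (hfu : ∀ x, rieszPotential s (density (f + u)) x ≤ P)
    (hε : 2 * rieszForm s (density f) (density u) + 3 * ((∫⁻ x, crossDensity f u x) * P) ≤ ε)
    (hε_fin : ε ≠ ⊤) :
    |rieszEnergy s (f + u) - rieszEnergy s f - rieszEnergy s u| ≤ ε.toReal := by
  have h_fin : ∀ {g : Lp F 2 (volume : Measure E)}, (∀ x, rieszPotential s (density g) x ≤ P) →
      erieszEnergy s g ≠ ⊤ := fun {g} hg => ne_top_of_le_ne_top
    (ENNReal.mul_ne_top (lintegral_density_ne_top g) hP)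
    (rieszForm_le_of_rieszPotential_le s (measurable_density g) hg)
  have h_upper : erieszEnergy s (f + u) ≤ erieszEnergy s f + erieszEnergy s u + ε :=
    (erieszEnergy_add_le s f u hf hu hfu).trans (by gcongr)
  have h_lower : erieszEnergy s f + erieszEnergy s u ≤ erieszEnergy s (f + u) + ε :=
    (erieszEnergy_add_erieszEnergy_le s f u hf hu hfu).trans
      (by gcongr; exact le_add_self.trans hε)
  have hsum : erieszEnergy s f + erieszEnergy s u ≠ ⊤ :=
    ENNReal.add_ne_top.2 ⟨h_fin hf, h_fin hu⟩
  have h_upper_real := ENNReal.toReal_mono (ENNReal.add_ne_top.2 ⟨hsum, hε_fin⟩) h_upper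
  have h_lower_real := ENNReal.toReal_mono (ENNReal.add_ne_top.2 ⟨h_fin hfu, hε_fin⟩) h_lower
  rw [ENNReal.toReal_add hsum hε_fin, ENNReal.toReal_add (h_fin hf) (h_fin hu)] at h_upper_real
  rw [ENNReal.toReal_add (h_fin hfu) hε_fin, ENNReal.toReal_add (h_fin hf) (h_fin hu)]
    at h_lower_real
  rw [abs_le]
  unfold rieszEnergy
  constructor <;> linarith

theorem tendsto_rieszEnergy_add_sub {s : ℝ} (hs : 0 < s) {f : Lp F 2 (volume : Measure E)}
    {u : ℕ → Lp F 2 (volume : Measure E)} {K P : ℝ≥0} (hK : ∀ n, ∫⁻ x, density (u n) x ≤ K)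
    (hf : ∀ x, rieszPotential s (density f) x ≤ P)
    (hu : ∀ n x, rieszPotential s (density (u n)) x ≤ P)
    (hfu : ∀ n x, rieszPotential s (density (f + u n)) x ≤ P)
    (h_loc : ∀ R, Tendsto (fun n => ∫⁻ x in ball (0 : E) R, density (u n) x) atTop (𝓝 0)) :
    Tendsto (fun n => rieszEnergy s (f + u n) - rieszEnergy s f - rieszEnergy s (u n))
      atTop (𝓝 0) := by
  have h_err : Tendsto (fun n => 2 * rieszForm s (density f) (density (u n))
      + 3 * ((∫⁻ x, crossDensity f (u n) x) * P)) atTop (𝓝 0) := by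
    have h_form := ENNReal.Tendsto.const_mul (a := 2) (tendsto_rieszForm hs (measurable_density f)
      (lintegral_density_ne_top f) (fun n => measurable_density (u n)) hK hf hu h_loc)
      (Or.inr ENNReal.ofNat_ne_top)
    have h_cross := ENNReal.Tendsto.const_mul (a := 3) (ENNReal.Tendsto.mul_const
      (b := (P : ℝ≥0∞)) (tendsto_lintegral_crossDensity f hK h_loc) (Or.inr ENNReal.coe_ne_top))
      (Or.inr ENNReal.ofNat_ne_top)
    simpa only [zero_mul, mul_zero, add_zero] using h_form.add h_cross
  have h_real := (ENNReal.tendsto_toReal ENNReal.zero_ne_top).comp h_err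
  refine squeeze_zero_norm' ?_ h_real
  filter_upwards [ENNReal.tendsto_nhds_zero.1 h_err 1 one_pos] with n hn
  exact abs_rieszEnergy_add_sub_le ENNReal.coe_ne_top hf (hu n) (hfu n) le_rfl
    (ne_top_of_le_ne_top ENNReal.one_ne_top hn)

end RieszSplitting

section WeakSplitting

variable {E F : Type*} [NormedAddCommGroup E] [InnerProductSpace ℝ E] [FiniteDimensional ℝ E]
  [MeasurableSpace E] [BorelSpace E] [NormedAddCommGroup F] [InnerProductSpace ℂ F]
  [CompleteSpace F]

lemma ekinetic_add_le (f g : Lp F 2 (volume : Measure E)) :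
    ekinetic (f + g) ≤ 2 * ekinetic f + 2 * ekinetic g := by
  have measurable_weight : ∀ h : Lp F 2 (volume : Measure E),
      Measurable fun ξ : E => ‖ξ‖ₑ * density (𝓕 h) ξ := fun h =>
    measurable_enorm.mul (measurable_density _)
  simp only [ekinetic]
  rw [← lintegral_const_mul _ (measurable_weight f), ← lintegral_const_mul _ (measurable_weight g),
    ← lintegral_add_left ((measurable_weight f).const_mul 2)]
  refine lintegral_mono_ae ?_
  have h_add : 𝓕 (f + g) = 𝓕 f + 𝓕 g := map_add (Lp.fourierTransformₗᵢ E F) f g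
  filter_upwards [density_add_le (𝓕 f) (𝓕 g) one_pos] with ξ hξ
  norm_num at hξ
  rw [h_add]
  calc ‖ξ‖ₑ * density (𝓕 f + 𝓕 g) ξ
      ≤ ‖ξ‖ₑ * (2 * density (𝓕 f) ξ + 2 * density (𝓕 g) ξ) := by gcongr
    _ = 2 * (‖ξ‖ₑ * density (𝓕 f) ξ) + 2 * (‖ξ‖ₑ * density (𝓕 g) ξ) := by ring

theorem WeaklyTendsto.tendsto_rieszEnergy_add_sub (hd : 2 < finrank ℝ E) {s : ℝ} (hs₀ : 0 < s)
    (hs₁ : s ≤ 1) {f : Lp ℂ 2 (volume : Measure E)} (hf : ekinetic f < ⊤)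
    {u : ℕ → Lp ℂ 2 (volume : Measure E)} (hu : WeaklyTendsto u 0) {K : ℝ≥0}
    (hK : ∀ n, ∫⁻ x, density (u n) x ≤ K) (hT : ∀ n, ekinetic (u n) ≤ K) :
    Tendsto (fun n => rieszEnergy s (f + u n) - rieszEnergy s f - rieszEnergy s (u n))
      atTop (𝓝 0) := by
  obtain ⟨C, hC⟩ := exists_rieszPotential_density_le (E := E) (F := ℂ) hd
  set T : ℝ≥0∞ := 2 * ekinetic f + 2 * K
  set M : ℝ≥0∞ := 2 * (∫⁻ x, density f x) + 2 * K
  have hP : ((C * T + M).toNNReal : ℝ≥0∞) = C * T + M := by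
    have hf_mass := lintegral_density_ne_top f
    exact ENNReal.coe_toNNReal (by finiteness)
  have h_bound : ∀ g : Lp ℂ 2 (volume : Measure E), ekinetic g ≤ T → ∫⁻ x, density g x ≤ M →
      ∀ x, rieszPotential s (density g) x ≤ (C * T + M).toNNReal := fun g hgT hgM x => by
    rw [hP]
    exact (hC s hs₀ hs₁ g x).trans (by gcongr)
  have le_two_mul : ∀ a : ℝ≥0∞, a ≤ 2 * a := fun a => le_mul_of_one_le_left' one_le_two
  refine BosonStar.tendsto_rieszEnergy_add_sub hs₀ hK
    (h_bound f ((le_two_mul _).trans le_self_add) ((le_two_mul _).trans le_self_add))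
    (fun n => h_bound _ ((hT n).trans ((le_two_mul _).trans le_add_self))
      ((hK n).trans ((le_two_mul _).trans le_add_self)))
    (fun n => h_bound _ ((ekinetic_add_le f (u n)).trans
      (add_le_add_right (mul_le_mul_right (hT n) 2) _)) ?_)
    (hu.tendsto_setLIntegral_ball_density hK hT)
  have h_mass := setLIntegral_density_add_le f (u n) Set.univ
  simp only [Measure.restrict_univ] at h_mass
  exact h_mass.trans (add_le_add_right (mul_le_mul_right (hK n) 2) _)

end WeakSplitting

section ProfileSplitting

variable {m α : ℝ}

lemma lintegral_density_le_of_kinetic_le (hm : 0 < m) {M : ℝ} {f : L2} (hf : MemHHalf f)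
    (h : kinetic m f ≤ M) : ∫⁻ x, density f x ≤ (M / m + M).toNNReal := by
  rw [lintegral_density_eq_mass]
  refine ENNReal.ofReal_le_ofReal ?_
  have h_mass : mass f ≤ M / m := by
    rw [le_div_iff₀ hm]
    linarith [mul_mass_le_kinetic m hf]
  linarith [(kinetic_nonneg m f).trans h]

lemma ekinetic_le_kinetic_zero {f : L2} (hf : MemHHalf f) :
    ekinetic f ≤ ENNReal.ofReal (kinetic 0 f) := by
  rw [ekinetic_eq hf]
  exact ENNReal.ofReal_le_ofReal
    (div_le_self (kinetic_nonneg 0 f) (by linarith [Real.pi_gt_three]))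

lemma ekinetic_le_of_kinetic_le (hm : 0 < m) {M : ℝ} {f : L2} (hf : MemHHalf f)
    (h : kinetic m f ≤ M) : ekinetic f ≤ (M / m + M).toNNReal := by
  refine (ekinetic_le_kinetic_zero hf).trans (ENNReal.ofReal_le_ofReal ?_)
  have hM := (kinetic_nonneg m f).trans h
  have : 0 ≤ M / m := by positivity
  linarith [kinetic_zero_le m hf]

/-- The sequence `f + u n` splits into its weak limit `f` and remainders `u n` that are bounded in
`H^{1/2}`, with asymptotically additive kinetic energies. -/
structure IsProfileSplitting (m : ℝ) (f : L2) (u : ℕ → L2) : Prop where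
  memHHalf : MemHHalf f
  memHHalf_remainder : ∀ n, MemHHalf (u n)
  exists_kinetic_le : ∃ B, ∀ n, kinetic m (u n) ≤ B
  weaklyTendsto : WeaklyTendsto (fun n => f + u n) f
  tendsto_kinetic :
    Tendsto (fun n => kinetic m (f + u n) - kinetic m f - kinetic m (u n)) atTop (𝓝 0)

lemma exists_isProfileSplitting (hm : 0 < m) {ψ : ℕ → L2} (hψ : ∀ n, MemHHalf (ψ n)) {B : ℝ}
    (hB : ∀ n, kinetic m (ψ n) ≤ B) :
    ∃ (k : ℕ → ℕ) (f : L2) (u : ℕ → L2),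
      StrictMono k ∧ IsProfileSplitting m f u ∧ ∀ n, f + u n = ψ (k n) := by
  choose G hG using fun n => exists_invSqrtKinetic_eq hm (hψ n)
  have hG_norm : ∀ n, ‖G n‖ ≤ √B := fun n => by
    refine Real.le_sqrt_of_sq_le ?_
    rw [← kinetic_invSqrtKinetic hm, hG]
    exact hB n
  have : Fact ((2 : ℝ≥0∞) ≠ ∞) := ⟨by norm_num⟩
  obtain ⟨k, G₀, hk, hweak⟩ := exists_weaklyTendsto_subseq G hG_norm
  have h_add : ∀ n, invSqrtKinetic hm G₀ + invSqrtKinetic hm (G (k n) - G₀) = ψ (k n) :=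
    fun n => by rw [← map_add, add_sub_cancel, hG]
  refine ⟨k, invSqrtKinetic hm G₀, fun n => invSqrtKinetic hm (G (k n) - G₀), hk,
    ⟨memHHalf_invSqrtKinetic hm _, fun n => memHHalf_invSqrtKinetic hm _,
      ⟨(√B + ‖G₀‖) ^ 2, fun n => ?_⟩, ?_, ?_⟩, h_add⟩
  · rw [kinetic_invSqrtKinetic]
    gcongr
    exact (norm_sub_le _ _).trans (by gcongr; exact hG_norm _)
  · simpa only [h_add, hG] using hweak.map (invSqrtKinetic hm)
  · refine hweak.tendsto_norm_sq_sub.congr fun n => ?_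
    rw [h_add, ← hG, kinetic_invSqrtKinetic, kinetic_invSqrtKinetic, kinetic_invSqrtKinetic]

namespace IsProfileSplitting

variable {f : L2} {u : ℕ → L2}

lemma weaklyTendsto_remainder (h : IsProfileSplitting m f u) : WeaklyTendsto u 0 := by
  simpa only [add_sub_cancel_left] using h.weaklyTendsto.sub_limit

lemma tendsto_mass (h : IsProfileSplitting m f u) :
    Tendsto (fun n => mass (f + u n) - mass f - mass (u n)) atTop (𝓝 0) := by
  simpa only [mass_eq_norm_sq, add_sub_cancel_left] using h.weaklyTendsto.tendsto_norm_sq_sub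

lemma memHHalf_add (h : IsProfileSplitting m f u) (n : ℕ) : MemHHalf (f + u n) := by
  have hf := (memHHalf_iff_ekinetic_lt_top f).1 h.memHHalf
  have hu := (memHHalf_iff_ekinetic_lt_top (u n)).1 (h.memHHalf_remainder n)
  refine (memHHalf_iff_ekinetic_lt_top _).2 ((ekinetic_add_le f (u n)).trans_lt ?_)
  finiteness

lemma tendsto_rieszEnergy (h : IsProfileSplitting m f u) (hm : 0 < m) {s : ℝ} (hs₀ : 0 < s)
    (hs₁ : s ≤ 1) :
    Tendsto (fun n => rieszEnergy s (f + u n) - rieszEnergy s f - rieszEnergy s (u n))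
      atTop (𝓝 0) := by
  obtain ⟨B, hB⟩ := h.exists_kinetic_le
  exact h.weaklyTendsto_remainder.tendsto_rieszEnergy_add_sub two_lt_finrank_R3 hs₀ hs₁
    ((memHHalf_iff_ekinetic_lt_top f).1 h.memHHalf)
    (fun n => lintegral_density_le_of_kinetic_le hm (h.memHHalf_remainder n) (hB n))
    (fun n => ekinetic_le_of_kinetic_le hm (h.memHHalf_remainder n) (hB n))

lemma tendsto_energy (h : IsProfileSplitting m f u) (hm : 0 < m) (hα₀ : 0 < α) (hα₁ : α ≤ 1)
    (β : ℝ) :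
    Tendsto (fun n => energy m α β (f + u n) - energy m α β f - energy m α β (u n))
      atTop (𝓝 0) := by
  have h_lim := (h.tendsto_kinetic.const_mul (1 / 2)).add
    ((((h.tendsto_rieszEnergy hm hα₀ hα₁).const_mul β).sub
      (h.tendsto_rieszEnergy hm one_pos le_rfl)).const_mul (1 / 4))
  simp only [mul_zero, sub_zero, add_zero] at h_lim
  refine h_lim.congr fun n => ?_
  rw [energy_eq hα₀ hα₁ m β (h.memHHalf_add n), energy_eq hα₀ hα₁ m β h.memHHalf,
    energy_eq hα₀ hα₁ m β (h.memHHalf_remainder n)]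
  ring

end IsProfileSplitting

end ProfileSplitting

section Existence

variable {m α β N : ℝ}

lemma energy_translate (hα₀ : 0 < α) (hα₁ : α ≤ 1) (β : ℝ) (a : R3) {f : L2} (hf : MemHHalf f) :
    energy m α β (translate a f) = energy m α β f := by
  rw [energy_eq hα₀ hα₁ m β hf, energy_eq hα₀ hα₁ m β (hf.translate a), kinetic_translate,
    rieszEnergy_translate, rieszEnergy_translate]

lemma exists_lt_rieszEnergy_one (hα₀ : 0 < α) (hα₁ : α ≤ 1) (β N : ℝ) {η : ℝ} (hη : 0 < η) :
    ∃ ε : ℝ, 0 < ε ∧ ∀ φ : L2, MemHHalf φ → mass φ = N → energy m α β φ ≤ 1 / 2 * (m * N) - η →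
      ε < rieszEnergy 1 φ := by
  obtain ⟨r, hr, hr₀⟩ : ∃ r : ℝ, |β| * N ^ 2 * r ^ (-α) < 2 * η ∧ 0 < r := by
    have h_lim := (tendsto_rpow_neg_atTop hα₀).const_mul (|β| * N ^ 2)
    rw [mul_zero] at h_lim
    exact ((h_lim.eventually_lt_const (by positivity)).and (eventually_gt_atTop 0)).exists
  refine ⟨2 * η / (1 + |β| * r ^ (1 - α)), by positivity, fun φ hφ hφN hE => ?_⟩
  have h_kinetic : m * N ≤ kinetic m φ := hφN ▸ mul_mass_le_kinetic m hφ
  have h_deficit : 4 * η ≤ rieszEnergy 1 φ - β * rieszEnergy α φ := by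
    rw [energy_eq hα₀ hα₁ m β hφ] at hE
    linarith
  have h_riesz : -(β * rieszEnergy α φ) < |β| * r ^ (1 - α) * rieszEnergy 1 φ + 2 * η := by
    calc -(β * rieszEnergy α φ) = -β * rieszEnergy α φ := (neg_mul _ _).symm
      _ ≤ |β| * (r ^ (1 - α) * rieszEnergy 1 φ + r ^ (-α) * N ^ 2) :=
        mul_le_mul (neg_le_abs β) (hφN ▸ rieszEnergy_le hα₀ hα₁ hr₀ hφ) (rieszEnergy_nonneg α φ)
          (abs_nonneg β)
      _ = |β| * r ^ (1 - α) * rieszEnergy 1 φ + |β| * N ^ 2 * r ^ (-α) := by ring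
      _ < _ := by gcongr
  rw [div_lt_iff₀ (by positivity)]
  linarith

lemma exists_lt_setLIntegral_ball_density (hα₀ : 0 < α) (hα₁ : α < 1) (β : ℝ) (hN₀ : 0 ≤ N)
    (hN : N < criticalMass) {e : ℝ} (he : e < 1 / 2 * (m * N)) :
    ∃ R c K : ℝ, 0 < c ∧ ∀ φ : L2, MemHHalf φ → mass φ = N → energy m α β φ ≤ e →
      kinetic 0 φ ≤ K ∧ ∃ a, ENNReal.ofReal c < ∫⁻ y in ball a R, density φ y := by
  obtain ⟨ε, hε, h_riesz⟩ :=
    exists_lt_rieszEnergy_one (m := m) hα₀ hα₁.le β N (sub_pos.2 he)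
  obtain ⟨q, K, hq, h_coercive⟩ :=
    exists_const_mul_kinetic_sub_le_energy (m := m) hα₀ hα₁ β hN₀ hN
  set T := (e + K) / q with hT
  obtain ⟨R, c, hc, h_vanishing⟩ := exists_erieszEnergy_one_le_of_setLIntegral_ball_le
    (F := ℂ) two_lt_finrank_R3 (N + |T|).toNNReal (ENNReal.ofReal_pos.2 hε).ne'
  refine ⟨R, c, T, hc, fun φ hφ hφN hφe => ?_⟩
  have h_kinetic : kinetic 0 φ ≤ T := by
    rw [hT, le_div_iff₀ hq]
    linarith [h_coercive φ hφ hφN.le]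
  refine ⟨h_kinetic, ?_⟩
  by_contra! h_ball
  have h_mass_le : ∫⁻ x, density φ x ≤ (N + |T|).toNNReal := by
    rw [lintegral_density_eq_mass, hφN]
    exact ENNReal.ofReal_le_ofReal (le_add_of_nonneg_right (abs_nonneg T))
  have h_kinetic_le : ekinetic φ ≤ (N + |T|).toNNReal :=
    (ekinetic_le_kinetic_zero hφ).trans (ENNReal.ofReal_le_ofReal
      (h_kinetic.trans ((le_abs_self T).trans (le_add_of_nonneg_left hN₀))))
  have h_small : rieszEnergy 1 φ ≤ ε :=
    ENNReal.toReal_le_of_le_ofReal hε.le (h_vanishing φ h_mass_le h_kinetic_le h_ball)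
  exact h_small.not_gt (h_riesz φ hφ hφN (by linarith))

lemma exists_minimizing_seq (hα₀ : 0 < α) (hα₁ : α < 1) (hN₀ : 0 ≤ N) (hN : N < criticalMass)
    (hlt : infEnergy m α β N < 1 / 2 * (m * N)) :
    ∃ (R c K : ℝ) (ψ : ℕ → L2), 0 < c ∧ (∀ n, MemHHalf (ψ n)) ∧ (∀ n, mass (ψ n) = N) ∧
      (∀ n, kinetic 0 (ψ n) ≤ K) ∧
      (∀ n, ENNReal.ofReal c ≤ ∫⁻ x in ball 0 R, density (ψ n) x) ∧
      Tendsto (fun n => energy m α β (ψ n)) atTop (𝓝 (infEnergy m α β N)) := by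
  obtain ⟨e, he, he'⟩ := exists_between hlt
  obtain ⟨R, c, K, hc, h_conc⟩ := exists_lt_setLIntegral_ball_density hα₀ hα₁ β hN₀ hN he'
  obtain ⟨b, -, hb, hb_lim⟩ := exists_seq_strictAnti_tendsto' he
  choose φ hφ hφN hφE using fun n => exists_energy_lt hN₀ (hb n).1
  choose hφK a ha using fun n => h_conc (φ n) (hφ n) (hφN n) ((hφE n).trans (hb n).2).le
  refine ⟨R, c, K, fun n => translate (a n) (φ n), hc, fun n => (hφ n).translate _,
    fun n => (mass_translate _ _).trans (hφN n),
    fun n => (kinetic_translate _ _ _).trans_le (hφK n),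
    fun n => (ha n).le.trans_eq (setLIntegral_ball_density_translate _ _ _).symm, ?_⟩
  simp only [energy_translate hα₀ hα₁.le β _ (hφ _)]
  exact tendsto_of_tendsto_of_tendsto_of_le_of_le tendsto_const_nhds hb_lim
    (fun n => infEnergy_le hα₀ hα₁ hN₀ hN (hφ n) (hφN n)) (fun n => (hφE n).le)

lemma infEnergy_le_of_tendsto {M e B : ℝ} (hα₀ : 0 < α) (hα₁ : α < 1) (hM₀ : 0 < M)
    (hM : M < criticalMass) {u : ℕ → L2} (hu : ∀ n, MemHHalf (u n))
    (hB : ∀ n, kinetic m (u n) ≤ B) (h_mass : Tendsto (fun n => mass (u n)) atTop (𝓝 M))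
    (hE : Tendsto (fun n => energy m α β (u n)) atTop (𝓝 e)) : infEnergy m α β M ≤ e := by
  set t : ℕ → ℝ := fun n => √(M / mass (u n)) with ht
  have ht_lim : Tendsto t atTop (𝓝 1) := by
    have h_sqrt := ((tendsto_const_nhds (x := M)).div h_mass hM₀.ne').sqrt
    rwa [div_self hM₀.ne', Real.sqrt_one] at h_sqrt
  have h_coeff : Tendsto (fun n => t n ^ 2 * (t n ^ 2 - 1)) atTop (𝓝 0) := by
    simpa using (ht_lim.pow 2).mul ((ht_lim.pow 2).sub_const 1)
  have h_kinetic :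
      Tendsto (fun n => t n ^ 2 * (t n ^ 2 - 1) * (1 / 2 * kinetic m (u n))) atTop (𝓝 0) :=
    h_coeff.zero_mul_isBoundedUnder_le <| isBoundedUnder_of ⟨1 / 2 * B, fun n => by
      have := kinetic_nonneg m (u n)
      rw [Function.comp_apply, Real.norm_of_nonneg (by positivity)]
      gcongr
      exact hB n⟩
  have h_lim : Tendsto (fun n => energy m α β ((t n : ℂ) • u n)) atTop (𝓝 e) := by
    simpa only [energy_smul hα₀ hα₁.le _ (hu _), one_pow, one_mul, sub_zero]
      using ((ht_lim.pow 4).mul hE).sub h_kinetic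
  refine ge_of_tendsto h_lim ?_
  filter_upwards [h_mass.eventually_const_lt hM₀] with n hn
  refine infEnergy_le hα₀ hα₁ hM₀.le hM ((hu n).smul _) ?_
  rw [mass_smul, ht, Real.sq_sqrt (by positivity), div_mul_cancel₀ _ hn.ne']

lemma nonneg_of_tendsto_energy {e B : ℝ} (hα₀ : 0 < α) (hα₁ : α < 1) {u : ℕ → L2}
    (hu : ∀ n, MemHHalf (u n)) (hB : ∀ n, kinetic m (u n) ≤ B)
    (h_mass : Tendsto (fun n => mass (u n)) atTop (𝓝 0))
    (hE : Tendsto (fun n => energy m α β (u n)) atTop (𝓝 e)) : 0 ≤ e := by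
  obtain ⟨C, hC, h_riesz⟩ := exists_rieszEnergy_one_le
  have h_one : Tendsto (fun n => rieszEnergy 1 (u n)) atTop (𝓝 0) := by
    refine squeeze_zero (g := fun n => C * B * mass (u n)) (fun n => rieszEnergy_nonneg _ _)
      (fun n => (h_riesz _ (hu n)).trans ?_) (by simpa using h_mass.const_mul (C * B))
    gcongr
    · exact mass_nonneg _
    · exact (kinetic_zero_le m (hu n)).trans (hB n)
  have h_alpha : Tendsto (fun n => rieszEnergy α (u n)) atTop (𝓝 0) := by
    refine squeeze_zero (g := fun n => rieszEnergy 1 (u n) + mass (u n) ^ 2)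
      (fun n => rieszEnergy_nonneg _ _) (fun n => ?_) (by simpa using h_one.add (h_mass.pow 2))
    simpa using rieszEnergy_le hα₀ hα₁.le one_pos (hu n)
  have h_potential := ((h_alpha.const_mul β).sub h_one).const_mul (1 / 4)
  simp only [mul_zero, sub_zero] at h_potential
  refine le_of_tendsto_of_tendsto' h_potential hE fun n => ?_
  rw [energy_eq hα₀ hα₁.le m β (hu n)]
  linarith [kinetic_nonneg m (u n)]

lemma IsProfileSplitting.isMinimizer {f : L2} {u : ℕ → L2} (h : IsProfileSplitting m f u)
    (hf₀ : f ≠ 0) (hm : 0 < m) (hα₀ : 0 < α) (hα₁ : α < 1) (hN : N < criticalMass)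
    (h_mass : ∀ n, mass (f + u n) = N)
    (h_energy : Tendsto (fun n => energy m α β (f + u n)) atTop (𝓝 (infEnergy m α β N)))
    (hsub : ∀ l, 0 < l → l < N →
      infEnergy m α β N < infEnergy m α β l + infEnergy m α β (N - l)) :
    IsMinimizer m α β N f := by
  obtain ⟨B, hB⟩ := h.exists_kinetic_le
  have h_mass_u : Tendsto (fun n => mass (u n)) atTop (𝓝 (N - mass f)) := by
    simpa only [h_mass, sub_sub_cancel, sub_zero] using h.tendsto_mass.const_sub (N - mass f)
  have h_energy_u : Tendsto (fun n => energy m α β (u n)) atTop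
      (𝓝 (infEnergy m α β N - energy m α β f)) := by
    simpa only [sub_sub_cancel, sub_zero]
      using (h_energy.sub_const (energy m α β f)).sub (h.tendsto_energy hm hα₀ hα₁.le β)
  have hf_pos := mass_pos hf₀
  have hf_le : mass f ≤ N :=
    sub_nonneg.1 (ge_of_tendsto' h_mass_u fun n => mass_nonneg (u n))
  rcases hf_le.lt_or_eq with hlt | heq
  · have h_rest := infEnergy_le_of_tendsto hα₀ hα₁ (sub_pos.2 hlt) (by linarith)
      h.memHHalf_remainder hB h_mass_u h_energy_u
    have h_profile := infEnergy_le (m := m) (β := β) hα₀ hα₁ hf_pos.le (hlt.trans hN) h.memHHalf rfl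
    linarith [hsub _ hf_pos hlt]
  · rw [heq, sub_self] at h_mass_u
    have h_rest := nonneg_of_tendsto_energy hα₀ hα₁ h.memHHalf_remainder hB h_mass_u h_energy_u
    exact isMinimizer_of_energy_le hα₀ hα₁ (hf_pos.le.trans hf_le) hN h.memHHalf heq
      (sub_nonneg.1 h_rest)

theorem exists_isMinimizer (hm : 0 < m) (hα₀ : 0 < α) (hα₁ : α < 1) (hN₀ : 0 ≤ N)
    (hN : N < criticalMass) (hlt : infEnergy m α β N < 1 / 2 * (m * N))
    (hsub : ∀ l, 0 < l → l < N →
      infEnergy m α β N < infEnergy m α β l + infEnergy m α β (N - l)) :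
    ∃ φ : L2, IsMinimizer m α β N φ := by
  obtain ⟨R, c, K, ψ, hc, hψ, hψN, hψK, hψ_ball, hψE⟩ :=
    exists_minimizing_seq hα₀ hα₁ hN₀ hN hlt
  have hψ_kinetic : ∀ n, kinetic m (ψ n) ≤ K + m * N := fun n =>
    (kinetic_le hm.le (hψ n)).trans (by rw [hψN n]; gcongr; exact hψK n)
  obtain ⟨k, f, u, hk, h_split, h_add⟩ := exists_isProfileSplitting hm hψ hψ_kinetic
  have hf₀ : f ≠ 0 := by
    rintro rfl
    have h_weak : WeaklyTendsto (fun n => ψ (k n)) 0 := by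
      simpa only [h_add] using h_split.weaklyTendsto
    have h_ball := h_weak.tendsto_setLIntegral_ball_density
      (fun n => lintegral_density_le_of_kinetic_le hm (hψ (k n)) (hψ_kinetic (k n)))
      (fun n => ekinetic_le_of_kinetic_le hm (hψ (k n)) (hψ_kinetic (k n))) R
    exact (ENNReal.ofReal_pos.2 hc).not_ge (ge_of_tendsto' h_ball fun n => hψ_ball (k n))
  refine ⟨f, h_split.isMinimizer hf₀ hm hα₀ hα₁ hN (fun n => h_add n ▸ hψN (k n)) ?_ hsub⟩
  simpa only [h_add, Function.comp_def] using hψE.comp hk.tendsto_atTop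

end Existence

end BosonStar

end

theorem theorem1p1 (m α : ℝ) (hm : 0 < m) (hα0 : 0 < α) (hα1 : α < 1) :
    (∀ β N : ℝ, β ≤ 0 → 0 < N → N < BosonStar.criticalMass →
      ∃ φ : BosonStar.L2, BosonStar.IsMinimizer m α β N φ) ∧
    (∃ β₀ : ℝ, 0 < β₀ ∧ ∃ δ : ℝ, 0 < δ ∧
      ∀ β N : ℝ, 0 < β → β < β₀ → 0 < N → BosonStar.criticalMass - δ < N →
        N < BosonStar.criticalMass →
        ∃ φ : BosonStar.L2, BosonStar.IsMinimizer m α β N φ) ∧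
    (∀ β N : ℝ, BosonStar.criticalMass < N →
      BosonStar.groundEnergy m α β N = ⊥ ∧
      ¬ ∃ φ : BosonStar.L2, BosonStar.IsMinimizer m α β N φ) := by
  open BosonStar in
  refine ⟨fun β N hβ hN₀ hN => ?_, ?_, fun β N hN => ⟨?_, ?_⟩⟩
  · exact exists_isMinimizer hm hα0 hα1 hN₀.le hN
      (infEnergy_lt_of_nonpos hm hα0 hα1 hβ hN₀ hN)
      fun l hl₀ hlN => infEnergy_lt_add_of_nonpos hm hα0 hα1 hβ hN hl₀ hlN
  · obtain ⟨β₀, δ, hβ₀, hδ, h_energy⟩ := exists_infEnergy_lt hm hα0 hα1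
    refine ⟨β₀, hβ₀, δ, hδ, fun β N hβ hββ₀ hN₀ hδN hN => ?_⟩
    have hE : infEnergy m α β N < m * N / 6 := h_energy β N hβ hββ₀ hN₀ hδN hN
    refine exists_isMinimizer hm hα0 hα1 hN₀.le hN ?_
      fun l hl₀ hlN => infEnergy_lt_add_of_lt hα0 hα1 hβ.le hN hE hl₀ hlN
    linarith [mul_pos hm hN₀]
  · exact groundEnergy_eq_bot hm.le hα0 hα1 β hN
  · rintro ⟨φ, hφ⟩
    exact not_isMinimizer_of_criticalMass_lt hm.le hα0 hα1 β hN φ hφ
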